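/- Let $N$ be a non-negative integer. The Yangian $\mathrm{Y}(\mathfrak{gl}_N)$ is the unital associative algebra over $\mathbb{C}$ with generators $T_{ij}^{(r)}$ ($1\le i,j\le N$, $r=1,2,\dots$) and defining relations $$[T_{ij}^{(r+1)},T_{kl}^{(s)}]-[T_{ij}^{(r)},T_{kl}^{(s+1)}]=T_{kj}^{(r)}T_{il}^{(s)}-T_{kj}^{(s)}T_{il}^{(r)},\qquad r,s\ge 0,$$ where $T_{ij}^{(0)}=\delta_{ij}$. Put $T_{ij}(u)=\sum_{r\ge0}T_{ij}^{(r)}u^{-r}$ and $T(u)=(T_{ij}(u))_{i,j=1}^N$. The algebra $\mathrm{Y}(\mathfrak{gl}_N)$ is a Hopf algebra with $$\Delta:T_{ij}(u)\mapsto\sum_{k=1}^N T_{ik}(u)\otimes T_{kj}(u),\qquad \varepsilon:T_{ij}(u)\mapsto\delta_{ij},\qquad \mathrm{S}:T(u)\mapsto T(u)^{-1}.$$ There are two ascending filtrations on this algebra, defined by $\deg T_{ij}^{(r)}=r$ and by $\deg' T_{ij}^{(r)}=r-1$ for $r\ge1$: the $d$-th term of the filtration is spanned by all products of generators of total degree at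 most $d$. Let $\mathrm{gr}\,\mathrm{Y}(\mathfrak{gl}_N)$ and $\mathrm{gr}'\,\mathrm{Y}(\mathfrak{gl}_N)$ be the corresponding associated graded algebras. Denote by $\bar T_{ij}^{(r)}$ the image of $T_{ij}^{(r)}$ in the degree $r$ component of $\mathrm{gr}\,\mathrm{Y}(\mathfrak{gl}_N)$, and by $\tilde T_{ij}^{(r)}$ its image in the degree $r-1$ component of $\mathrm{gr}'\,\mathrm{Y}(\mathfrak{gl}_N)$. The filtration $\deg'$ is compatible with the Hopf algebra structure, so that $\mathrm{gr}'\,\mathrm{Y}(\mathfrak{gl}_N)$ inherits the structure of a graded Hopf algebra from $\mathrm{Y}(\mathfrak{gl}_N)$. Let $\mathfrak{gl}_N[z]=\mathfrak{gl}_N\otimes\mathbb{C}[z]$ be the polynomial current Lie algebra, $[Xz^s,Yz^t]=[X,Y]z^{s+t}$, graded by the degree in $z$. Let $\mathrm{U}(\mathfrak{gl}_N[z])$ be its universal enveloping algebra with the induced grading (so that $E_{ij}z^s$ has degree $s$, the $E_{ij}$ being the matrix units) and with its standard Hopf algebra structure $\Delta(X)=X\otimes1+1\otimes X$, $\varepsilon(X)=0$,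 $\mathrm{S}(X)=-X$ for $X\in\mathfrak{gl}_N[z]$. Theorem. All three of the following statements hold. (a) Given an arbitrary linear ordering of the set of generators $T_{ij}^{(r)}$ with $r\ge1$, any element of $\mathrm{Y}(\mathfrak{gl}_N)$ can be uniquely written as a (finite) linear combination of ordered monomials in these generators. (b) The assignments $E_{ij}z^{r-1}\mapsto\tilde T_{ij}^{(r)}$ for $r\ge1$ define an isomorphism $\mathrm{U}(\mathfrak{gl}_N[z])\to\mathrm{gr}'\,\mathrm{Y}(\mathfrak{gl}_N)$ of graded Hopf algebras. (c) The graded algebra $\mathrm{gr}\,\mathrm{Y}(\mathfrak{gl}_N)$ is the algebra of polynomials in the elements $\bar T_{ij}^{(r)}$ with $r\ge1$: it is commutative and is freely generated, as a commutative algebra, by these elements. -/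

import Mathlib

open scoped TensorProduct DirectSum Polynomial

/-- An ascending algebra filtration indexed by the natural numbers. -/
structure AlgFiltration (k A : Type*) [CommRing k] [Ring A] [Algebra k A] where
  F : ℕ → Submodule k A
  mono : Monotone F
  one_mem : (1 : A) ∈ F 0
  mul_mem : ∀ {a b : ℕ} {x y : A}, x ∈ F a → y ∈ F b → x * y ∈ F (a + b)

namespace AlgFiltration

variable {k A : Type*} [CommRing k] [Ring A] [Algebra k A]

/-- The previous term of the filtration, `F (d - 1)`, where `F (-1) = 0`. -/
def prev (𝓕 : AlgFiltration k A) : ℕ → Submodule k A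
  | 0 => ⊥
  | d + 1 => 𝓕.F d

/-- The component `F d / F (d - 1)` of degree `d` of the associated graded algebra. -/
def Piece (𝓕 : AlgFiltration k A) (d : ℕ) : Type _ :=
  𝓕.F d ⧸ (𝓕.prev d).submoduleOf (𝓕.F d)

instance (𝓕 : AlgFiltration k A) (d : ℕ) : AddCommGroup (𝓕.Piece d) :=
  inferInstanceAs (AddCommGroup (𝓕.F d ⧸ (𝓕.prev d).submoduleOf (𝓕.F d)))

instance (𝓕 : AlgFiltration k A) (d : ℕ) : Module k (𝓕.Piece d) :=
  inferInstanceAs (Module k (𝓕.F d ⧸ (𝓕.prev d).submoduleOf (𝓕.F d)))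

/-- The quotient map `F d → F d / F (d - 1)`. -/
def cls (𝓕 : AlgFiltration k A) (d : ℕ) : 𝓕.F d →ₗ[k] 𝓕.Piece d :=
  ((𝓕.prev d).submoduleOf (𝓕.F d)).mkQ

theorem cls_surjective (𝓕 : AlgFiltration k A) (d : ℕ) : Function.Surjective (𝓕.cls d) :=
  Submodule.mkQ_surjective _

theorem cls_eq_zero (𝓕 : AlgFiltration k A) {d : ℕ} {x : 𝓕.F d} :
    𝓕.cls d x = 0 ↔ (x : A) ∈ 𝓕.prev d :=
  Submodule.Quotient.mk_eq_zero _

/-- A linear map on `F d` which vanishes on `F (d - 1)` descends to `F d / F (d - 1)`. -/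
def liftPiece (𝓕 : AlgFiltration k A) (d : ℕ) {M : Type*} [AddCommGroup M] [Module k M]
    (f : 𝓕.F d →ₗ[k] M) (hf : ∀ x : 𝓕.F d, (x : A) ∈ 𝓕.prev d → f x = 0) : 𝓕.Piece d →ₗ[k] M :=
  ((𝓕.prev d).submoduleOf (𝓕.F d)).liftQ f (fun x hx => hf x hx)

theorem liftPiece_mk (𝓕 : AlgFiltration k A) (d : ℕ) {M : Type*} [AddCommGroup M] [Module k M]
    (f : 𝓕.F d →ₗ[k] M) (hf : ∀ x : 𝓕.F d, (x : A) ∈ 𝓕.prev d → f x = 0) (x : 𝓕.F d) :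
    𝓕.liftPiece d f hf (𝓕.cls d x) = f x := rfl

theorem prev_le (𝓕 : AlgFiltration k A) (d : ℕ) : 𝓕.prev d ≤ 𝓕.F d := by
  cases d with
  | zero => exact bot_le
  | succ d => exact 𝓕.mono (Nat.le_succ d)

theorem le_prev (𝓕 : AlgFiltration k A) {d e : ℕ} (h : d < e) : 𝓕.F d ≤ 𝓕.prev e := by
  cases e with
  | zero => omega
  | succ e => exact 𝓕.mono (by omega)

theorem mem_prev_iff (𝓕 : AlgFiltration k A) {d : ℕ} {x : A} :
    x ∈ 𝓕.prev d ↔ x = 0 ∨ ∃ e < d, x ∈ 𝓕.F e := by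
  cases d with
  | zero => simp [prev]
  | succ d =>
    constructor
    · exact fun h => Or.inr ⟨d, Nat.lt_succ_self d, h⟩
    · rintro (rfl | ⟨e, he, h⟩)
      · exact zero_mem _
      · exact 𝓕.mono (by omega) h

theorem mul_mem_prev_left (𝓕 : AlgFiltration k A) {a b : ℕ} {x y : A}
    (hx : x ∈ 𝓕.prev a) (hy : y ∈ 𝓕.F b) : x * y ∈ 𝓕.prev (a + b) := by
  rcases 𝓕.mem_prev_iff.1 hx with rfl | ⟨e, he, h⟩
  · simp
  · exact 𝓕.le_prev (by omega) (𝓕.mul_mem h hy)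

theorem mul_mem_prev_right (𝓕 : AlgFiltration k A) {a b : ℕ} {x y : A}
    (hx : x ∈ 𝓕.F a) (hy : y ∈ 𝓕.prev b) : x * y ∈ 𝓕.prev (a + b) := by
  rcases 𝓕.mem_prev_iff.1 hy with rfl | ⟨e, he, h⟩
  · simp
  · exact 𝓕.le_prev (by omega) (𝓕.mul_mem hx h)

/-- The multiplication `F a × F b → F (a + b)`. -/
def mulF (𝓕 : AlgFiltration k A) (a b : ℕ) : 𝓕.F a →ₗ[k] 𝓕.F b →ₗ[k] 𝓕.F (a + b) :=
  LinearMap.mk₂ k (fun x y => ⟨(x : A) * y, 𝓕.mul_mem x.2 y.2⟩)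
    (fun _ _ _ => Subtype.ext (add_mul _ _ _))
    (fun _ _ _ => Subtype.ext (smul_mul_assoc _ _ _))
    (fun _ _ _ => Subtype.ext (mul_add _ _ _))
    (fun _ _ _ => Subtype.ext (mul_smul_comm _ _ _))

/-- The multiplication on the components of the associated graded algebra, induced by that of
the filtered algebra. -/
def mulPiece (𝓕 : AlgFiltration k A) (a b : ℕ) :
    𝓕.Piece a →ₗ[k] 𝓕.Piece b →ₗ[k] 𝓕.Piece (a + b) :=
  𝓕.liftPiece a
    (LinearMap.mk₂ k
      (fun (x : 𝓕.F a) (y : 𝓕.Piece b) =>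
        𝓕.liftPiece b (𝓕.cls (a + b) ∘ₗ 𝓕.mulF a b x)
          (fun y hy => 𝓕.cls_eq_zero.2 (𝓕.mul_mem_prev_right x.2 hy)) y)
      (fun x x' y => by
        obtain ⟨y, rfl⟩ := 𝓕.cls_surjective _ y
        simp [liftPiece_mk])
      (fun c x y => by
        obtain ⟨y, rfl⟩ := 𝓕.cls_surjective _ y
        simp [liftPiece_mk])
      (fun x y y' => by simp)
      (fun c x y => by simp))
    (fun x hx => by
      ext y
      obtain ⟨y, rfl⟩ := 𝓕.cls_surjective _ y
      exact 𝓕.cls_eq_zero.2 (𝓕.mul_mem_prev_left hx y.2))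

theorem mulPiece_mk (𝓕 : AlgFiltration k A) {a b : ℕ} (x : 𝓕.F a) (y : 𝓕.F b) :
    𝓕.mulPiece a b (𝓕.cls a x) (𝓕.cls b y) = 𝓕.cls (a + b) (𝓕.mulF a b x y) := rfl

theorem gradedMonoid_ext (𝓕 : AlgFiltration k A) {a b : ℕ} (h : a = b) (x : 𝓕.F a) (y : 𝓕.F b)
    (hxy : (x : A) = y) :
    (GradedMonoid.mk a (𝓕.cls a x) : GradedMonoid 𝓕.Piece) = GradedMonoid.mk b (𝓕.cls b y) := by
  subst h
  rw [Subtype.ext hxy]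

/-- The unit, as an element of `F 0`. -/
def oneF (𝓕 : AlgFiltration k A) : 𝓕.F 0 := ⟨1, 𝓕.one_mem⟩

instance (𝓕 : AlgFiltration k A) : GradedMonoid.GMul 𝓕.Piece where
  mul x y := 𝓕.mulPiece _ _ x y

instance (𝓕 : AlgFiltration k A) : GradedMonoid.GOne 𝓕.Piece where
  one := 𝓕.cls 0 𝓕.oneF

instance (𝓕 : AlgFiltration k A) : DirectSum.GRing 𝓕.Piece where
  mul_zero _ := map_zero _
  zero_mul y := by
    change 𝓕.mulPiece _ _ 0 y = 0
    simp
  mul_add _ _ _ := map_add _ _ _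
  add_mul x y z := by
    change 𝓕.mulPiece _ _ (x + y) z = 𝓕.mulPiece _ _ x z + 𝓕.mulPiece _ _ y z
    simp
  one_mul := by
    rintro ⟨a, x⟩
    obtain ⟨x, rfl⟩ := 𝓕.cls_surjective _ x
    exact 𝓕.gradedMonoid_ext (zero_add a) _ _ (one_mul _)
  mul_one := by
    rintro ⟨a, x⟩
    obtain ⟨x, rfl⟩ := 𝓕.cls_surjective _ x
    exact 𝓕.gradedMonoid_ext (add_zero a) _ _ (mul_one _)
  mul_assoc := by
    rintro ⟨a, x⟩ ⟨b, y⟩ ⟨c, z⟩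
    obtain ⟨x, rfl⟩ := 𝓕.cls_surjective _ x
    obtain ⟨y, rfl⟩ := 𝓕.cls_surjective _ y
    obtain ⟨z, rfl⟩ := 𝓕.cls_surjective _ z
    exact 𝓕.gradedMonoid_ext (add_assoc a b c) _ _ (mul_assoc _ _ _)
  natCast n := n • 𝓕.cls 0 𝓕.oneF
  natCast_zero := zero_smul _ _
  natCast_succ n := succ_nsmul _ _
  intCast n := n • 𝓕.cls 0 𝓕.oneF
  intCast_ofNat n := natCast_zsmul _ _
  intCast_negSucc_ofNat n := negSucc_zsmul _ _

instance (𝓕 : AlgFiltration k A) : DirectSum.GAlgebra k 𝓕.Piece where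
  toFun :=
    { toFun := fun c => c • 𝓕.cls 0 𝓕.oneF
      map_zero' := zero_smul _ _
      map_add' := fun c d => add_smul _ _ _ }
  map_one := one_smul _ _
  map_mul r s := 𝓕.gradedMonoid_ext (zero_add 0).symm ((r * s) • 𝓕.oneF)
    (𝓕.mulF 0 0 (r • 𝓕.oneF) (s • 𝓕.oneF)) (by
      simp only [mulF, oneF, LinearMap.mk₂_apply, Submodule.coe_smul, smul_mul_smul_comm, mul_one])
  commutes := by
    rintro r ⟨a, x⟩
    obtain ⟨x, rfl⟩ := 𝓕.cls_surjective _ x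
    exact 𝓕.gradedMonoid_ext (by omega) (𝓕.mulF 0 a (r • 𝓕.oneF) x)
      (𝓕.mulF a 0 x (r • 𝓕.oneF)) (by simp [mulF, oneF])
  smul_def := by
    rintro r ⟨a, x⟩
    obtain ⟨x, rfl⟩ := 𝓕.cls_surjective _ x
    exact 𝓕.gradedMonoid_ext (by omega) (r • x)
      (𝓕.mulF 0 a (r • 𝓕.oneF) x) (by simp [mulF, oneF])

/-- The associated graded algebra of a filtered algebra. -/
abbrev Gr (𝓕 : AlgFiltration k A) : Type _ := ⨁ d, 𝓕.Piece d

noncomputable section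

/-- The class of an element of `F d` in the component of degree `d`. -/
def symb (𝓕 : AlgFiltration k A) (d : ℕ) : 𝓕.F d →ₗ[k] 𝓕.Gr :=
  DirectSum.lof k ℕ 𝓕.Piece d ∘ₗ 𝓕.cls d

/-- The component of degree `d` of the associated graded algebra, as a subspace of it. -/
def grComponent (𝓕 : AlgFiltration k A) (d : ℕ) : Submodule k 𝓕.Gr :=
  LinearMap.range (DirectSum.lof k ℕ 𝓕.Piece d)

theorem symb_mul (𝓕 : AlgFiltration k A) {a b : ℕ} (x : 𝓕.F a) (y : 𝓕.F b) :
    𝓕.symb a x * 𝓕.symb b y = 𝓕.symb (a + b) ⟨(x : A) * y, 𝓕.mul_mem x.2 y.2⟩ :=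
  DirectSum.of_mul_of (A := 𝓕.Piece) _ _

theorem symb_one (𝓕 : AlgFiltration k A) : 𝓕.symb 0 𝓕.oneF = 1 := rfl

theorem symb_congr (𝓕 : AlgFiltration k A) {a b : ℕ} (h : a = b) (x : 𝓕.F a) (y : 𝓕.F b)
    (hxy : (x : A) = y) : 𝓕.symb a x = 𝓕.symb b y := by
  subst h
  rw [Subtype.ext hxy]

theorem symb_eq_zero (𝓕 : AlgFiltration k A) {d : ℕ} (x : 𝓕.F d) (hx : (x : A) ∈ 𝓕.prev d) :
    𝓕.symb d x = 0 := by
  rw [symb, LinearMap.comp_apply, 𝓕.cls_eq_zero.2 hx, map_zero]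

theorem gr_induction (𝓕 : AlgFiltration k A) {P : 𝓕.Gr → Prop} (zero : P 0)
    (symb : ∀ d x, P (𝓕.symb d x)) (add : ∀ x y, P x → P y → P (x + y)) (x : 𝓕.Gr) : P x := by
  induction x using DirectSum.induction_on with
  | zero => exact zero
  | of d x =>
    obtain ⟨x, rfl⟩ := 𝓕.cls_surjective _ x
    exact symb d x
  | add x y hx hy => exact add x y hx hy

end

end AlgFiltration

namespace AlgFiltration
noncomputable section

section Hopf

set_option linter.unusedSectionVars false

variable {k A : Type*} [Field k] [Ring A]

/-- The tensor product filtration on `A ⊗ A`: the sum of all `F a ⊗ F b` with `a + b = d`. -/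
def tensorF [Algebra k A] (𝓕 : AlgFiltration k A) (d : ℕ) : Submodule k (A ⊗[k] A) :=
  Submodule.span k {t | ∃ a b : ℕ, a + b = d ∧ ∃ y ∈ 𝓕.F a, ∃ z ∈ 𝓕.F b, y ⊗ₜ[k] z = t}

/-- The comultiplication and the antipode of the Hopf algebra `A` preserve the filtration. (The
counit always does, the ground field being concentrated in degree `0`.) -/
class IsHopfFiltration [HopfAlgebra k A] (𝓕 : AlgFiltration k A) : Prop where
  comul_mem : ∀ (d : ℕ) (x : A), x ∈ 𝓕.F d → Coalgebra.comul (R := k) x ∈ 𝓕.tensorF d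
  antipode_mem : ∀ (d : ℕ) (x : A), x ∈ 𝓕.F d → HopfAlgebra.antipode k x ∈ 𝓕.F d

section

variable [Algebra k A]

/-- Some linear extension of the symbol map from `F d` to the whole algebra. -/
def symbExt (𝓕 : AlgFiltration k A) (d : ℕ) : A →ₗ[k] 𝓕.Gr :=
  (LinearMap.exists_extend (𝓕.symb d)).choose

theorem symbExt_apply (𝓕 : AlgFiltration k A) {d : ℕ} {x : A} (hx : x ∈ 𝓕.F d) :
    𝓕.symbExt d x = 𝓕.symb d ⟨x, hx⟩ :=
  LinearMap.congr_fun (LinearMap.exists_extend (𝓕.symb d)).choose_spec ⟨x, hx⟩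

theorem symbExt_eq_zero (𝓕 : AlgFiltration k A) {d e : ℕ} {x : A} (hx : x ∈ 𝓕.F e) (h : e < d) :
    𝓕.symbExt d x = 0 := by
  rw [𝓕.symbExt_apply (𝓕.mono h.le hx)]
  exact 𝓕.symb_eq_zero _ (𝓕.le_prev h hx)

/-- The symbol map in degree `d` for the tensor product filtration; see `tensorSymb_tmul` and
`tensorSymb_eq_zero`. -/
def tensorSymb (𝓕 : AlgFiltration k A) (d : ℕ) : A ⊗[k] A →ₗ[k] 𝓕.Gr ⊗[k] 𝓕.Gr :=
  ∑ p ∈ Finset.HasAntidiagonal.antidiagonal d, TensorProduct.map (𝓕.symbExt p.1) (𝓕.symbExt p.2)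

/-- A bookkeeping lemma: in a sum over `p.1 + p.2 = a + b` only `p = (a, b)` survives. -/
theorem sum_antidiagonal_eq {M : Type*} [AddCommMonoid M] {a b d : ℕ} (h : a + b = d)
    (f : ℕ × ℕ → M) (h1 : ∀ p : ℕ × ℕ, a < p.1 → f p = 0) (h2 : ∀ p : ℕ × ℕ, b < p.2 → f p = 0) :
    ∑ p ∈ Finset.HasAntidiagonal.antidiagonal d, f p = f (a, b) := by
  refine Finset.sum_eq_single_of_mem _ (by simpa using h) ?_
  rintro ⟨p, q⟩ hp hne
  rw [Finset.HasAntidiagonal.mem_antidiagonal] at hp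
  rcases lt_trichotomy a p with hlt | heq | hgt
  · exact h1 _ hlt
  · exact absurd (by ext <;> simp at * <;> omega) hne
  · exact h2 _ (by simp at *; omega)

theorem tensorSymb_tmul (𝓕 : AlgFiltration k A) {a b d : ℕ} (h : a + b = d) {y z : A}
    (hy : y ∈ 𝓕.F a) (hz : z ∈ 𝓕.F b) :
    𝓕.tensorSymb d (y ⊗ₜ z) = 𝓕.symb a ⟨y, hy⟩ ⊗ₜ 𝓕.symb b ⟨z, hz⟩ := by
  rw [tensorSymb, LinearMap.sum_apply, sum_antidiagonal_eq h]
  · simp [symbExt_apply, hy, hz]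
  · intro p hp
    simp [𝓕.symbExt_eq_zero hy hp]
  · intro p hp
    simp [𝓕.symbExt_eq_zero hz hp]

theorem tensorSymb_eq_zero (𝓕 : AlgFiltration k A) {d e : ℕ} (h : e < d) {t : A ⊗[k] A}
    (ht : t ∈ 𝓕.tensorF e) : 𝓕.tensorSymb d t = 0 := by
  induction ht using Submodule.span_induction with
  | mem t ht =>
    obtain ⟨a, b, hab, y, hy, z, hz, rfl⟩ := ht
    rw [𝓕.tensorSymb_tmul (a := a) (b := d - a) (by omega) hy (𝓕.mono (by omega) hz),
      𝓕.symb_eq_zero ⟨z, _⟩ (𝓕.le_prev (by omega) hz), TensorProduct.tmul_zero]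
  | zero => exact map_zero _
  | add x y _ _ hx hy => rw [map_add, hx, hy, add_zero]
  | smul c x _ hx => rw [map_smul, hx, smul_zero]

theorem tensorSymb_mul (𝓕 : AlgFiltration k A) {a b : ℕ} {s t : A ⊗[k] A}
    (hs : s ∈ 𝓕.tensorF a) (ht : t ∈ 𝓕.tensorF b) :
    𝓕.tensorSymb (a + b) (s * t) = 𝓕.tensorSymb a s * 𝓕.tensorSymb b t := by
  induction hs using Submodule.span_induction with
  | mem s hs =>
    obtain ⟨a₁, a₂, rfl, y, hy, z, hz, rfl⟩ := hs
    induction ht using Submodule.span_induction with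
    | mem t ht =>
      obtain ⟨b₁, b₂, rfl, y', hy', z', hz', rfl⟩ := ht
      rw [Algebra.TensorProduct.tmul_mul_tmul,
        𝓕.tensorSymb_tmul (a := a₁ + b₁) (b := a₂ + b₂) (by omega) (𝓕.mul_mem hy hy')
          (𝓕.mul_mem hz hz'), 𝓕.tensorSymb_tmul rfl hy hz, 𝓕.tensorSymb_tmul rfl hy' hz',
        Algebra.TensorProduct.tmul_mul_tmul, symb_mul, symb_mul]
    | zero => simp
    | add x y _ _ hx hy => simp only [mul_add, map_add, hx, hy]
    | smul c x _ hx => simp only [mul_smul_comm, map_smul, hx]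
  | zero => simp
  | add x y _ _ hx hy => simp only [add_mul, map_add, hx, hy]
  | smul c x _ hx => simp only [smul_mul_assoc, map_smul, hx]

theorem gr_hom_ext (𝓕 : AlgFiltration k A) {M : Type*} [AddCommMonoid M] [Module k M]
    {f g : 𝓕.Gr →ₗ[k] M} (h : ∀ d x, f (𝓕.symb d x) = g (𝓕.symb d x)) : f = g := by
  refine LinearMap.ext fun x => ?_
  induction x using 𝓕.gr_induction with
  | zero => simp
  | symb d x => exact h d x
  | add x y hx hy => rw [map_add, map_add, hx, hy]

end

variable [HopfAlgebra k A] (𝓕 : AlgFiltration k A) [𝓕.IsHopfFiltration]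

theorem comul_mem_tensorF {d : ℕ} {x : A} (hx : x ∈ 𝓕.F d) :
    Coalgebra.comul (R := k) x ∈ 𝓕.tensorF d := IsHopfFiltration.comul_mem d x hx

theorem antipode_mem {d : ℕ} {x : A} (hx : x ∈ 𝓕.F d) :
    HopfAlgebra.antipode k x ∈ 𝓕.F d := IsHopfFiltration.antipode_mem d x hx

/-- The comultiplication of the associated graded algebra on the component of degree `d`. -/
def grComulPiece (d : ℕ) : 𝓕.Piece d →ₗ[k] 𝓕.Gr ⊗[k] 𝓕.Gr :=
  𝓕.liftPiece d (𝓕.tensorSymb d ∘ₗ Coalgebra.comul ∘ₗ (𝓕.F d).subtype) (by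
    rintro ⟨x, hx⟩ hxd
    rcases 𝓕.mem_prev_iff.1 hxd with rfl | ⟨e, he, h⟩
    · exact map_zero _
    · exact 𝓕.tensorSymb_eq_zero he (𝓕.comul_mem_tensorF h))

/-- The comultiplication of the associated graded algebra, induced by that of `A`. -/
def grComul : 𝓕.Gr →ₗ[k] 𝓕.Gr ⊗[k] 𝓕.Gr := DirectSum.toModule k ℕ _ 𝓕.grComulPiece

/-- The counit of the associated graded algebra on the component of degree `d`. -/
def grCounitPiece : ∀ d : ℕ, 𝓕.Piece d →ₗ[k] k
  | 0 => 𝓕.liftPiece 0 (Coalgebra.counit ∘ₗ (𝓕.F 0).subtype) (by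
      rintro ⟨x, hx⟩ hxd
      obtain rfl : x = 0 := hxd
      exact map_zero _)
  | _ + 1 => 0

/-- The counit of the associated graded algebra, induced by that of `A`. -/
def grCounit : 𝓕.Gr →ₗ[k] k := DirectSum.toModule k ℕ _ 𝓕.grCounitPiece

/-- The antipode of the associated graded algebra on the component of degree `d`. -/
def grAntipodePiece (d : ℕ) : 𝓕.Piece d →ₗ[k] 𝓕.Gr :=
  𝓕.liftPiece d
    (𝓕.symb d ∘ₗ (HopfAlgebra.antipode k (A := A)).restrict (fun _ hx => 𝓕.antipode_mem hx)) (by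
    rintro ⟨x, hx⟩ hxd
    refine 𝓕.symb_eq_zero _ ?_
    rcases 𝓕.mem_prev_iff.1 hxd with h0 | ⟨e, he, h⟩
    · simp [show x = 0 from h0]
    · exact 𝓕.le_prev he (𝓕.antipode_mem h))

/-- The antipode of the associated graded algebra, induced by that of `A`. -/
def grAntipode : 𝓕.Gr →ₗ[k] 𝓕.Gr := DirectSum.toModule k ℕ _ 𝓕.grAntipodePiece

theorem grComul_symb (d : ℕ) (x : 𝓕.F d) :
    𝓕.grComul (𝓕.symb d x) = 𝓕.tensorSymb d (Coalgebra.comul (R := k) (x : A)) := by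
  simp only [grComul, symb, LinearMap.comp_apply, DirectSum.toModule_lof]
  rfl

theorem grCounit_symb (d : ℕ) (x : 𝓕.F d) :
    𝓕.grCounit (𝓕.symb d x) = if d = 0 then Coalgebra.counit (R := k) (x : A) else 0 := by
  simp only [grCounit, symb, LinearMap.comp_apply, DirectSum.toModule_lof]
  cases d <;> rfl

theorem grAntipode_symb (d : ℕ) (x : 𝓕.F d) :
    𝓕.grAntipode (𝓕.symb d x)
      = 𝓕.symb d ⟨HopfAlgebra.antipode k (x : A), 𝓕.antipode_mem x.2⟩ := by
  simp only [grAntipode, symb, LinearMap.comp_apply, DirectSum.toModule_lof]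
  rfl

theorem rTensor_grComul_tensorSymb {d : ℕ} {t : A ⊗[k] A} (ht : t ∈ 𝓕.tensorF d) :
    𝓕.grComul.rTensor 𝓕.Gr (𝓕.tensorSymb d t)
      = (∑ p ∈ Finset.HasAntidiagonal.antidiagonal d, TensorProduct.map (𝓕.tensorSymb p.1) (𝓕.symbExt p.2))
          ((Coalgebra.comul (R := k)).rTensor A t) := by
  induction ht using Submodule.span_induction with
  | mem t ht =>
    obtain ⟨a, b, hab, y, hy, z, hz, rfl⟩ := ht
    rw [LinearMap.sum_apply, sum_antidiagonal_eq hab]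
    · simp [𝓕.tensorSymb_tmul hab hy hz, grComul_symb, symbExt_apply, hz]
    · intro p hp
      simp [𝓕.tensorSymb_eq_zero hp (𝓕.comul_mem_tensorF hy)]
    · intro p hp
      simp [𝓕.symbExt_eq_zero hz hp]
  | zero => simp only [map_zero]
  | add x y _ _ hx hy => simp only [map_add, hx, hy]
  | smul c x _ hx => simp only [map_smul, hx]

theorem lTensor_grComul_tensorSymb {d : ℕ} {t : A ⊗[k] A} (ht : t ∈ 𝓕.tensorF d) :
    𝓕.grComul.lTensor 𝓕.Gr (𝓕.tensorSymb d t)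
      = (∑ p ∈ Finset.HasAntidiagonal.antidiagonal d, TensorProduct.map (𝓕.symbExt p.1) (𝓕.tensorSymb p.2))
          ((Coalgebra.comul (R := k)).lTensor A t) := by
  induction ht using Submodule.span_induction with
  | mem t ht =>
    obtain ⟨a, b, hab, y, hy, z, hz, rfl⟩ := ht
    rw [LinearMap.sum_apply, sum_antidiagonal_eq hab]
    · simp [𝓕.tensorSymb_tmul hab hy hz, grComul_symb, symbExt_apply, hy]
    · intro p hp
      simp [𝓕.symbExt_eq_zero hy hp]
    · intro p hp
      simp [𝓕.tensorSymb_eq_zero hp (𝓕.comul_mem_tensorF hz)]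
  | zero => simp only [map_zero]
  | add x y _ _ hx hy => simp only [map_add, hx, hy]
  | smul c x _ hx => simp only [map_smul, hx]

theorem rTensor_grCounit_tensorSymb {d : ℕ} {t : A ⊗[k] A} (ht : t ∈ 𝓕.tensorF d) :
    𝓕.grCounit.rTensor 𝓕.Gr (𝓕.tensorSymb d t)
      = (𝓕.symbExt d).lTensor k ((Coalgebra.counit (R := k)).rTensor A t) := by
  induction ht using Submodule.span_induction with
  | mem t ht =>
    obtain ⟨a, b, hab, y, hy, z, hz, rfl⟩ := ht
    rw [𝓕.tensorSymb_tmul hab hy hz]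
    simp only [LinearMap.rTensor_tmul, LinearMap.lTensor_tmul, grCounit_symb]
    rcases Nat.eq_zero_or_pos a with rfl | ha
    · obtain rfl : b = d := by omega
      simp [symbExt_apply, hz]
    · rw [if_neg (by omega), 𝓕.symbExt_eq_zero hz (by omega)]
      simp
  | zero => simp only [map_zero]
  | add x y _ _ hx hy => simp only [map_add, hx, hy]
  | smul c x _ hx => simp only [map_smul, hx]

theorem lTensor_grCounit_tensorSymb {d : ℕ} {t : A ⊗[k] A} (ht : t ∈ 𝓕.tensorF d) :
    𝓕.grCounit.lTensor 𝓕.Gr (𝓕.tensorSymb d t)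
      = (𝓕.symbExt d).rTensor k ((Coalgebra.counit (R := k)).lTensor A t) := by
  induction ht using Submodule.span_induction with
  | mem t ht =>
    obtain ⟨a, b, hab, y, hy, z, hz, rfl⟩ := ht
    rw [𝓕.tensorSymb_tmul hab hy hz]
    simp only [LinearMap.rTensor_tmul, LinearMap.lTensor_tmul, grCounit_symb]
    rcases Nat.eq_zero_or_pos b with rfl | hb
    · obtain rfl : a = d := by omega
      simp [symbExt_apply, hy]
    · rw [if_neg (by omega), 𝓕.symbExt_eq_zero hy (by omega)]
      simp
  | zero => simp only [map_zero]
  | add x y _ _ hx hy => simp only [map_add, hx, hy]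
  | smul c x _ hx => simp only [map_smul, hx]

theorem mul_rTensor_grAntipode_tensorSymb {d : ℕ} {t : A ⊗[k] A} (ht : t ∈ 𝓕.tensorF d) :
    LinearMap.mul' k 𝓕.Gr (𝓕.grAntipode.rTensor 𝓕.Gr (𝓕.tensorSymb d t))
      = 𝓕.symbExt d (LinearMap.mul' k A ((HopfAlgebra.antipode k).rTensor A t)) := by
  induction ht using Submodule.span_induction with
  | mem t ht =>
    obtain ⟨a, b, rfl, y, hy, z, hz, rfl⟩ := ht
    rw [𝓕.tensorSymb_tmul rfl hy hz]
    simp only [LinearMap.rTensor_tmul, LinearMap.mul'_apply, grAntipode_symb, symb_mul]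
    rw [𝓕.symbExt_apply (𝓕.mul_mem (𝓕.antipode_mem hy) hz)]
  | zero => simp only [map_zero]
  | add x y _ _ hx hy => simp only [map_add, hx, hy]
  | smul c x _ hx => simp only [map_smul, hx]

theorem mul_lTensor_grAntipode_tensorSymb {d : ℕ} {t : A ⊗[k] A} (ht : t ∈ 𝓕.tensorF d) :
    LinearMap.mul' k 𝓕.Gr (𝓕.grAntipode.lTensor 𝓕.Gr (𝓕.tensorSymb d t))
      = 𝓕.symbExt d (LinearMap.mul' k A ((HopfAlgebra.antipode k).lTensor A t)) := by
  induction ht using Submodule.span_induction with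
  | mem t ht =>
    obtain ⟨a, b, rfl, y, hy, z, hz, rfl⟩ := ht
    rw [𝓕.tensorSymb_tmul rfl hy hz]
    simp only [LinearMap.lTensor_tmul, LinearMap.mul'_apply, grAntipode_symb, symb_mul]
    rw [𝓕.symbExt_apply (𝓕.mul_mem hy (𝓕.antipode_mem hz))]
  | zero => simp only [map_zero]
  | add x y _ _ hx hy => simp only [map_add, hx, hy]
  | smul c x _ hx => simp only [map_smul, hx]

theorem assoc_sum_tensorSymb (d : ℕ) (u : (A ⊗[k] A) ⊗[k] A) :
    TensorProduct.assoc k 𝓕.Gr 𝓕.Gr 𝓕.Gr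
        ((∑ p ∈ Finset.HasAntidiagonal.antidiagonal d, TensorProduct.map (𝓕.tensorSymb p.1) (𝓕.symbExt p.2)) u)
      = (∑ p ∈ Finset.HasAntidiagonal.antidiagonal d, TensorProduct.map (𝓕.symbExt p.1) (𝓕.tensorSymb p.2))
          (TensorProduct.assoc k A A A u) := by
  induction u using TensorProduct.induction_on with
  | zero => simp only [map_zero]
  | add x y hx hy => simp only [map_add, hx, hy]
  | tmul t z =>
    induction t using TensorProduct.induction_on with
    | zero => simp only [TensorProduct.zero_tmul, map_zero]
    | add x y hx hy => simp only [TensorProduct.add_tmul, map_add, hx, hy]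
    | tmul x y =>
      simp only [LinearMap.sum_apply, TensorProduct.map_tmul, TensorProduct.assoc_tmul,
        tensorSymb, TensorProduct.sum_tmul, TensorProduct.tmul_sum, map_sum]
      rw [Finset.sum_sigma', Finset.sum_sigma']
      refine Finset.sum_nbij' (fun q => ⟨(q.2.1, q.2.2 + q.1.2), (q.2.2, q.1.2)⟩)
        (fun q => ⟨(q.1.1 + q.2.1, q.2.2), (q.1.1, q.2.1)⟩) ?_ ?_ ?_ ?_ ?_
      · rintro ⟨⟨a, b⟩, ⟨c, e⟩⟩ h
        simp only [Finset.mem_sigma, Finset.HasAntidiagonal.mem_antidiagonal] at h ⊢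
        obtain ⟨h₁, h₂⟩ := h
        exact ⟨by omega, trivial⟩
      · rintro ⟨⟨a, b⟩, ⟨c, e⟩⟩ h
        simp only [Finset.mem_sigma, Finset.HasAntidiagonal.mem_antidiagonal] at h ⊢
        obtain ⟨h₁, h₂⟩ := h
        exact ⟨by omega, trivial⟩
      · rintro ⟨⟨a, b⟩, ⟨c, e⟩⟩ h
        simp only [Finset.mem_sigma, Finset.HasAntidiagonal.mem_antidiagonal] at h
        obtain ⟨-, rfl⟩ := h
        rfl
      · rintro ⟨⟨a, b⟩, ⟨c, e⟩⟩ h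
        simp only [Finset.mem_sigma, Finset.HasAntidiagonal.mem_antidiagonal] at h
        obtain ⟨-, rfl⟩ := h
        rfl
      · rintro ⟨⟨a, b⟩, ⟨c, e⟩⟩ _
        simp

theorem symbExt_algebraMap (d : ℕ) (c : k) :
    𝓕.symbExt d (algebraMap k A c) = algebraMap k 𝓕.Gr (if d = 0 then c else 0) := by
  rw [Algebra.algebraMap_eq_smul_one, Algebra.algebraMap_eq_smul_one, map_smul]
  rcases Nat.eq_zero_or_pos d with rfl | hd
  · rw [if_pos rfl, 𝓕.symbExt_apply 𝓕.one_mem]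
    rfl
  · rw [𝓕.symbExt_eq_zero 𝓕.one_mem hd, if_neg (by omega), zero_smul, smul_zero]

/-- The Hopf algebra structure of the associated graded algebra of a filtered Hopf algebra,
induced by that of the filtered algebra. -/
instance : HopfAlgebra k 𝓕.Gr :=
  letI : Coalgebra k 𝓕.Gr :=
    { comul := 𝓕.grComul
      counit := 𝓕.grCounit
      coassoc := 𝓕.gr_hom_ext fun d x => by
        simp only [LinearMap.comp_apply, LinearEquiv.coe_coe, grComul_symb]
        rw [𝓕.rTensor_grComul_tensorSymb (𝓕.comul_mem_tensorF x.2),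
          𝓕.lTensor_grComul_tensorSymb (𝓕.comul_mem_tensorF x.2), assoc_sum_tensorSymb,
          Coalgebra.coassoc_apply]
      rTensor_counit_comp_comul := 𝓕.gr_hom_ext fun d x => by
        simp only [LinearMap.comp_apply, grComul_symb]
        rw [𝓕.rTensor_grCounit_tensorSymb (𝓕.comul_mem_tensorF x.2),
          Coalgebra.rTensor_counit_comul, LinearMap.lTensor_tmul, 𝓕.symbExt_apply x.2]
        rfl
      lTensor_counit_comp_comul := 𝓕.gr_hom_ext fun d x => by
        simp only [LinearMap.comp_apply, grComul_symb]
        rw [𝓕.lTensor_grCounit_tensorSymb (𝓕.comul_mem_tensorF x.2),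
          Coalgebra.lTensor_counit_comul, LinearMap.rTensor_tmul, 𝓕.symbExt_apply x.2]
        rfl }
  letI : Bialgebra k 𝓕.Gr := Bialgebra.mk' k 𝓕.Gr
    (by
      change 𝓕.grCounit 1 = 1
      rw [← symb_one, grCounit_symb, if_pos rfl]
      exact Bialgebra.counit_one)
    (by
      intro x y
      change 𝓕.grCounit (x * y) = 𝓕.grCounit x * 𝓕.grCounit y
      induction x using 𝓕.gr_induction with
      | zero => simp
      | add x x' hx hx' => simp only [add_mul, map_add, hx, hx']
      | symb a x =>
        induction y using 𝓕.gr_induction with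
        | zero => simp
        | add y y' hy hy' => simp only [mul_add, map_add, hy, hy']
        | symb b y =>
          rw [symb_mul, grCounit_symb, grCounit_symb, grCounit_symb, Bialgebra.counit_mul]
          by_cases ha : a = 0 <;> by_cases hb : b = 0 <;> simp [ha, hb])
    (by
      change 𝓕.grComul 1 = 1
      rw [← symb_one, grComul_symb]
      change 𝓕.tensorSymb 0 (Coalgebra.comul (R := k) (1 : A)) = 1
      rw [Bialgebra.comul_one, Algebra.TensorProduct.one_def,
        𝓕.tensorSymb_tmul (zero_add 0) 𝓕.one_mem 𝓕.one_mem]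
      rfl)
    (by
      intro x y
      change 𝓕.grComul (x * y) = 𝓕.grComul x * 𝓕.grComul y
      induction x using 𝓕.gr_induction with
      | zero => simp
      | add x x' hx hx' => simp only [add_mul, map_add, hx, hx']
      | symb a x =>
        induction y using 𝓕.gr_induction with
        | zero => simp
        | add y y' hy hy' => simp only [mul_add, map_add, hy, hy']
        | symb b y =>
          rw [symb_mul, grComul_symb, grComul_symb, grComul_symb, Bialgebra.comul_mul,
            𝓕.tensorSymb_mul (𝓕.comul_mem_tensorF x.2) (𝓕.comul_mem_tensorF y.2)])
  { antipode := 𝓕.grAntipode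
    mul_antipode_rTensor_comul := 𝓕.gr_hom_ext fun d x => by
      change LinearMap.mul' k 𝓕.Gr (𝓕.grAntipode.rTensor 𝓕.Gr (𝓕.grComul (𝓕.symb d x)))
        = algebraMap k 𝓕.Gr (𝓕.grCounit (𝓕.symb d x))
      rw [grComul_symb, 𝓕.mul_rTensor_grAntipode_tensorSymb (𝓕.comul_mem_tensorF x.2),
        HopfAlgebra.mul_antipode_rTensor_comul_apply, grCounit_symb,
        symbExt_algebraMap]
    mul_antipode_lTensor_comul := 𝓕.gr_hom_ext fun d x => by
      change LinearMap.mul' k 𝓕.Gr (𝓕.grAntipode.lTensor 𝓕.Gr (𝓕.grComul (𝓕.symb d x)))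
        = algebraMap k 𝓕.Gr (𝓕.grCounit (𝓕.symb d x))
      rw [grComul_symb, 𝓕.mul_lTensor_grAntipode_tensorSymb (𝓕.comul_mem_tensorF x.2),
        HopfAlgebra.mul_antipode_lTensor_comul_apply, grCounit_symb,
        symbExt_algebraMap] }

/-- The comultiplication of the associated graded algebra is the one induced by that of `A`: if
`x ∈ F d` and `Δ x = ∑ y i ⊗ z i` with `y i ∈ F (a i)`, `z i ∈ F (b i)` and `a i + b i = d`, then
`Δ` maps the class of `x` in degree `d` to the sum of the products of the classes of `y i` in
degree `a i` and of `z i` in degree `b i`. -/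
theorem comul_symb {ι : Type*} (s : Finset ι) (a b : ι → ℕ) (d : ℕ) (hab : ∀ i ∈ s, a i + b i = d)
    (y : ∀ i, 𝓕.F (a i)) (z : ∀ i, 𝓕.F (b i)) (x : 𝓕.F d)
    (h : Coalgebra.comul (R := k) (x : A) = ∑ i ∈ s, (y i : A) ⊗ₜ[k] (z i : A)) :
    Coalgebra.comul (R := k) (𝓕.symb d x) = ∑ i ∈ s, 𝓕.symb (a i) (y i) ⊗ₜ[k] 𝓕.symb (b i) (z i) := by
  change 𝓕.grComul (𝓕.symb d x) = _
  rw [grComul_symb, h, map_sum]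
  exact Finset.sum_congr rfl fun i hi => 𝓕.tensorSymb_tmul (hab i hi) (y i).2 (z i).2

theorem counit_symb (d : ℕ) (x : 𝓕.F d) :
    Coalgebra.counit (R := k) (𝓕.symb d x)
      = if d = 0 then Coalgebra.counit (R := k) (x : A) else 0 :=
  𝓕.grCounit_symb d x

theorem antipode_symb (d : ℕ) (x : 𝓕.F d) :
    HopfAlgebra.antipode k (𝓕.symb d x)
      = 𝓕.symb d ⟨HopfAlgebra.antipode k (x : A), 𝓕.antipode_mem x.2⟩ :=
  𝓕.grAntipode_symb d x

end Hopf
end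
end AlgFiltration

noncomputable section

/-- Given elements `g i` of an algebra, to which weights `w i` are assigned, this is the filtration
whose term of index `d` is spanned by the products `g i₁ ⋯ g iₘ` of total weight at most `d`. -/
def weightFiltration (k : Type*) {A ι : Type*} [CommRing k] [Ring A] [Algebra k A]
    (g : ι → A) (w : ι → ℕ) : AlgFiltration k A where
  F d := Submodule.span k {x | ∃ l : List ι, (l.map w).sum ≤ d ∧ (l.map g).prod = x}
  mono d e h := Submodule.span_mono fun _ ⟨l, hl, hx⟩ => ⟨l, hl.trans h, hx⟩
  one_mem := Submodule.subset_span ⟨[], by simp, by simp⟩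
  mul_mem := by
    intro a b x y hx hy
    induction hx using Submodule.span_induction with
    | zero => simp
    | add x x' _ _ hx hx' => rw [add_mul]; exact add_mem hx hx'
    | smul c x _ hx => rw [smul_mul_assoc]; exact Submodule.smul_mem _ _ hx
    | mem x hx =>
      obtain ⟨l, hl, rfl⟩ := hx
      induction hy using Submodule.span_induction with
      | zero => simp
      | add y y' _ _ hy hy' => rw [mul_add]; exact add_mem hy hy'
      | smul c y _ hy => rw [mul_smul_comm]; exact Submodule.smul_mem _ _ hy
      | mem y hy =>
        obtain ⟨l', hl', rfl⟩ := hy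
        exact Submodule.subset_span ⟨l ++ l', by simp; omega, by simp⟩

theorem mem_weightFiltration {k A ι : Type*} [CommRing k] [Ring A] [Algebra k A]
    (g : ι → A) (w : ι → ℕ) (i : ι) : g i ∈ (weightFiltration k g w).F (w i) :=
  Submodule.subset_span ⟨[i], by simp, by simp⟩

namespace AlgFiltration

variable {k A : Type*} [Field k] [Ring A]

theorem tensorF_mono [Algebra k A] (𝓕 : AlgFiltration k A) {d e : ℕ} (h : d ≤ e) :
    𝓕.tensorF d ≤ 𝓕.tensorF e := by
  refine Submodule.span_mono ?_
  rintro _ ⟨a, b, hab, y, hy, z, hz, rfl⟩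
  exact ⟨a + (e - d), b, by omega, y, 𝓕.mono (by omega) hy, z, hz, rfl⟩

theorem tmul_mem_tensorF [Algebra k A] (𝓕 : AlgFiltration k A) {a b d : ℕ} (h : a + b ≤ d) {y z : A}
    (hy : y ∈ 𝓕.F a) (hz : z ∈ 𝓕.F b) : y ⊗ₜ[k] z ∈ 𝓕.tensorF d :=
  𝓕.tensorF_mono h (Submodule.subset_span ⟨a, b, rfl, y, hy, z, hz, rfl⟩)

theorem tensorF_mul_mem [Algebra k A] (𝓕 : AlgFiltration k A) {a b : ℕ} {s t : A ⊗[k] A}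
    (hs : s ∈ 𝓕.tensorF a) (ht : t ∈ 𝓕.tensorF b) : s * t ∈ 𝓕.tensorF (a + b) := by
  induction hs using Submodule.span_induction with
  | zero => simp
  | add x x' _ _ hx hx' => rw [add_mul]; exact add_mem hx hx'
  | smul c x _ hx => rw [smul_mul_assoc]; exact Submodule.smul_mem _ _ hx
  | mem x hx =>
    obtain ⟨a₁, a₂, rfl, y, hy, z, hz, rfl⟩ := hx
    induction ht using Submodule.span_induction with
    | zero => simp
    | add y y' _ _ hy hy' => rw [mul_add]; exact add_mem hy hy'
    | smul c y _ hy => rw [mul_smul_comm]; exact Submodule.smul_mem _ _ hy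
    | mem x hx =>
      obtain ⟨b₁, b₂, rfl, y', hy', z', hz', rfl⟩ := hx
      rw [Algebra.TensorProduct.tmul_mul_tmul]
      exact 𝓕.tmul_mem_tensorF (by omega) (𝓕.mul_mem hy hy') (𝓕.mul_mem hz hz')

theorem isHopfFiltration_weightFiltration {ι : Type*} [HopfAlgebra k A] (g : ι → A) (w : ι → ℕ)
    (hcomul : ∀ i, Coalgebra.comul (R := k) (g i) ∈ (weightFiltration k g w).tensorF (w i))
    (hanti : ∀ i, HopfAlgebra.antipode k (g i) ∈ (weightFiltration k g w).F (w i)) :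
    (weightFiltration k g w).IsHopfFiltration where
  comul_mem := by
    intro d x hx
    induction hx using Submodule.span_induction with
    | zero => simp
    | add x x' _ _ hx hx' => rw [map_add]; exact add_mem hx hx'
    | smul c x _ hx => rw [map_smul]; exact Submodule.smul_mem _ _ hx
    | mem x hx =>
      obtain ⟨l, hl, rfl⟩ := hx
      refine tensorF_mono _ hl ?_
      clear hl
      induction l with
      | nil =>
        simp only [List.map_nil, List.prod_nil, List.sum_nil, Bialgebra.comul_one]
        exact tmul_mem_tensorF _ (zero_add 0).le (AlgFiltration.one_mem _)
          (AlgFiltration.one_mem _)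
      | cons i l ih =>
        simp only [List.map_cons, List.prod_cons, List.sum_cons, Bialgebra.comul_mul]
        exact tensorF_mul_mem _ (hcomul i) ih
  antipode_mem := by
    intro d x hx
    induction hx using Submodule.span_induction with
    | zero => simp
    | add x x' _ _ hx hx' => rw [map_add]; exact add_mem hx hx'
    | smul c x _ hx => rw [map_smul]; exact Submodule.smul_mem _ _ hx
    | mem x hx =>
      obtain ⟨l, hl, rfl⟩ := hx
      refine (weightFiltration k g w).mono hl ?_
      clear hl
      induction l with
      | nil =>
        simp only [List.map_nil, List.prod_nil, List.sum_nil, HopfAlgebra.antipode_one]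
        exact AlgFiltration.one_mem _
      | cons i l ih =>
        simp only [List.map_cons, List.prod_cons, List.sum_cons, HopfAlgebra.antipode_mul_antidistrib]
        rw [add_comm]
        exact AlgFiltration.mul_mem _ ih (hanti i)

end AlgFiltration

/-- To verify the antipode axioms for an algebra anti-homomorphism it suffices to do so on
generators. -/
theorem antipode_rTensor_of_adjoin {k A : Type*} [CommRing k] [Ring A] [Bialgebra k A]
    (S : A →ₐ[k] Aᵐᵒᵖ) (s : Set A) (hs : Algebra.adjoin k s = ⊤)
    (h : ∀ x ∈ s, LinearMap.mul' k A
      (((MulOpposite.opLinearEquiv k).symm.toLinearMap ∘ₗ S.toLinearMap).rTensor A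
        (Coalgebra.comul (R := k) x)) = algebraMap k A (Coalgebra.counit x)) :
    LinearMap.mul' k A ∘ₗ
      ((MulOpposite.opLinearEquiv k).symm.toLinearMap ∘ₗ S.toLinearMap).rTensor A ∘ₗ
        Coalgebra.comul = (Algebra.linearMap k A) ∘ₗ Coalgebra.counit := by
  set S' : A →ₗ[k] A := (MulOpposite.opLinearEquiv k).symm.toLinearMap ∘ₗ S.toLinearMap with hS'
  have hmul : ∀ x y, S' (x * y) = S' y * S' x := fun x y => by simp [hS']
  have hone : S' 1 = 1 := by simp [hS']
  refine LinearMap.ext fun x => ?_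
  have hx : x ∈ Algebra.adjoin k s := hs ▸ Algebra.mem_top
  simp only [LinearMap.comp_apply, Algebra.linearMap_apply]
  induction hx using Algebra.adjoin_induction with
  | mem x hx => exact h x hx
  | algebraMap c =>
    rw [Algebra.algebraMap_eq_smul_one, map_smul, map_smul, map_smul, map_smul,
      Bialgebra.comul_one, Bialgebra.counit_one, Algebra.TensorProduct.one_def,
      LinearMap.rTensor_tmul, LinearMap.mul'_apply, hone, mul_one, smul_eq_mul, mul_one,
      Algebra.algebraMap_eq_smul_one]
  | add x y _ _ hx hy => simp only [map_add, hx, hy]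
  | mul x y _ _ hx hy =>
    have h1 : ∀ (v : A ⊗[k] A) (b c : A), LinearMap.mul' k A (S'.rTensor A (v * b ⊗ₜ c))
        = S' b * LinearMap.mul' k A (S'.rTensor A v) * c := by
      intro v b c
      induction v using TensorProduct.induction_on with
      | zero => simp
      | tmul p q => simp [hmul, mul_assoc]
      | add v v' hv hv' => simp only [add_mul, mul_add, map_add, hv, hv']
    have h2 : ∀ w : A ⊗[k] A,
        LinearMap.mul' k A (S'.rTensor A (Coalgebra.comul (R := k) x * w))
          = Coalgebra.counit (R := k) x • LinearMap.mul' k A (S'.rTensor A w) := by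
      intro w
      induction w using TensorProduct.induction_on with
      | zero => simp
      | tmul b c =>
        rw [h1, hx, LinearMap.rTensor_tmul, LinearMap.mul'_apply, ← Algebra.commutes, mul_assoc,
          Algebra.smul_def]
      | add v v' hv hv' => simp only [mul_add, map_add, hv, hv', smul_add]
    rw [Bialgebra.comul_mul, h2, hy, Bialgebra.counit_mul, map_mul, Algebra.smul_def]

theorem antipode_lTensor_of_adjoin {k A : Type*} [CommRing k] [Ring A] [Bialgebra k A]
    (S : A →ₐ[k] Aᵐᵒᵖ) (s : Set A) (hs : Algebra.adjoin k s = ⊤)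
    (h : ∀ x ∈ s, LinearMap.mul' k A
      (((MulOpposite.opLinearEquiv k).symm.toLinearMap ∘ₗ S.toLinearMap).lTensor A
        (Coalgebra.comul (R := k) x)) = algebraMap k A (Coalgebra.counit x)) :
    LinearMap.mul' k A ∘ₗ
      ((MulOpposite.opLinearEquiv k).symm.toLinearMap ∘ₗ S.toLinearMap).lTensor A ∘ₗ
        Coalgebra.comul = (Algebra.linearMap k A) ∘ₗ Coalgebra.counit := by
  set S' : A →ₗ[k] A := (MulOpposite.opLinearEquiv k).symm.toLinearMap ∘ₗ S.toLinearMap with hS'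
  have hmul : ∀ x y, S' (x * y) = S' y * S' x := fun x y => by simp [hS']
  have hone : S' 1 = 1 := by simp [hS']
  refine LinearMap.ext fun x => ?_
  have hx : x ∈ Algebra.adjoin k s := hs ▸ Algebra.mem_top
  simp only [LinearMap.comp_apply, Algebra.linearMap_apply]
  induction hx using Algebra.adjoin_induction with
  | mem x hx => exact h x hx
  | algebraMap c =>
    rw [Algebra.algebraMap_eq_smul_one, map_smul, map_smul, map_smul, map_smul,
      Bialgebra.comul_one, Bialgebra.counit_one, Algebra.TensorProduct.one_def,
      LinearMap.lTensor_tmul, LinearMap.mul'_apply, hone, mul_one, smul_eq_mul, mul_one,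
      Algebra.algebraMap_eq_smul_one]
  | add x y _ _ hx hy => simp only [map_add, hx, hy]
  | mul x y _ _ hx hy =>
    have h1 : ∀ (v : A ⊗[k] A) (b c : A), LinearMap.mul' k A (S'.lTensor A (b ⊗ₜ c * v))
        = b * LinearMap.mul' k A (S'.lTensor A v) * S' c := by
      intro v b c
      induction v using TensorProduct.induction_on with
      | zero => simp
      | tmul p q => simp [hmul, mul_assoc]
      | add v v' hv hv' => simp only [add_mul, mul_add, map_add, hv, hv']
    have h2 : ∀ w : A ⊗[k] A,
        LinearMap.mul' k A (S'.lTensor A (w * Coalgebra.comul (R := k) y))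
          = Coalgebra.counit (R := k) y • LinearMap.mul' k A (S'.lTensor A w) := by
      intro w
      induction w using TensorProduct.induction_on with
      | zero => simp
      | tmul b c =>
        rw [h1, hy, LinearMap.lTensor_tmul, LinearMap.mul'_apply, ← Algebra.commutes, mul_assoc,
          Algebra.smul_def]
      | add v v' hv hv' => simp only [add_mul, map_add, hv, hv', smul_add]
    rw [Bialgebra.comul_mul, h2, hx, Bialgebra.counit_mul,
      mul_comm (Coalgebra.counit (R := k) x), map_mul, Algebra.smul_def]

end

noncomputable section

/-- Elements `t i j r` (`i, j = 1, …, N`, `r = 0, 1, …`) of an algebra which satisfy the defining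
relations of the Yangian of `gl_N`. -/
structure IsYangianFamily {N : ℕ} {A : Type*} [Ring A] (t : Fin N → Fin N → ℕ → A) : Prop where
  zero : ∀ i j, t i j 0 = if i = j then 1 else 0
  rel : ∀ i j k l r s,
    (t i j (r + 1) * t k l s - t k l s * t i j (r + 1))
        - (t i j r * t k l (s + 1) - t k l (s + 1) * t i j r)
      = t k j r * t i l s - t k j s * t i l r

/-! The families are turned into power series in two commuting variables `x = u⁻¹` and `y = v⁻¹`. -/

namespace YangianSeries

open PowerSeries

variable {A : Type*} [Ring A]

/-- The series `∑ f r x ^ r`. -/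
def serU (f : ℕ → A) : PowerSeries (PowerSeries A) := C (PowerSeries.mk f)

/-- The series `∑ f r y ^ r`. -/
def serV (f : ℕ → A) : PowerSeries (PowerSeries A) := PowerSeries.mk fun s => C (f s)

/-- The variable `x`. -/
def varU (A : Type*) [Ring A] : PowerSeries (PowerSeries A) := C X

/-- The variable `y`. -/
def varV (A : Type*) [Ring A] : PowerSeries (PowerSeries A) := X

theorem varU_comm (f : PowerSeries (PowerSeries A)) : varU A * f = f * varU A := by
  ext b
  simp only [varU, coeff_C_mul, coeff_mul_C, (commute_X _).eq]

theorem varV_comm (f : PowerSeries (PowerSeries A)) : varV A * f = f * varV A :=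
  (commute_X f).eq.symm

/-- The coefficient at `x ^ a * y ^ b`. -/
def cf (a b : ℕ) (f : PowerSeries (PowerSeries A)) : A := coeff a (coeff b f)

theorem cf_add (a b : ℕ) (f g : PowerSeries (PowerSeries A)) :
    cf a b (f + g) = cf a b f + cf a b g := by simp [cf]

theorem cf_sub (a b : ℕ) (f g : PowerSeries (PowerSeries A)) :
    cf a b (f - g) = cf a b f - cf a b g := by simp [cf]

theorem cf_serU_serV (a b : ℕ) (f g : ℕ → A) : cf a b (serU f * serV g) = f a * g b := by
  simp [cf, serU, serV, coeff_C_mul, coeff_mul_C]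

theorem cf_serV_serU (a b : ℕ) (f g : ℕ → A) : cf a b (serV g * serU f) = g b * f a := by
  simp [cf, serU, serV, coeff_C_mul, coeff_mul_C]

theorem cf_varU_succ (a b : ℕ) (f : PowerSeries (PowerSeries A)) :
    cf (a + 1) b (varU A * f) = cf a b f := by
  simp [cf, varU, coeff_C_mul, coeff_succ_X_mul]

theorem cf_varU_zero (b : ℕ) (f : PowerSeries (PowerSeries A)) : cf 0 b (varU A * f) = 0 := by
  simp [cf, varU, coeff_C_mul]

theorem cf_varV_succ (a b : ℕ) (f : PowerSeries (PowerSeries A)) :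
    cf a (b + 1) (varV A * f) = cf a b f := by
  simp [cf, varV, coeff_succ_X_mul]

theorem cf_varV_zero (a : ℕ) (f : PowerSeries (PowerSeries A)) : cf a 0 (varV A * f) = 0 := by
  simp [cf, varV]

theorem cf_ext {f g : PowerSeries (PowerSeries A)} (h : ∀ a b, cf a b f = cf a b g) : f = g := by
  ext b a
  exact h a b

theorem serU_mul (f g : ℕ → A) :
    serU f * serU g = serU fun r => ∑ p ∈ Finset.HasAntidiagonal.antidiagonal r, f p.1 * g p.2 := by
  simp only [serU, ← map_mul]
  congr 1
  ext r
  simp [coeff_mul]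

theorem serV_mul (f g : ℕ → A) :
    serV f * serV g = serV fun r => ∑ p ∈ Finset.HasAntidiagonal.antidiagonal r, f p.1 * g p.2 := by
  ext b : 1
  simp [serV, coeff_mul]

theorem serU_sum {ι : Type*} (s : Finset ι) (f : ι → ℕ → A) :
    ∑ i ∈ s, serU (f i) = serU fun r => ∑ i ∈ s, f i r := by
  simp only [serU, ← map_sum]
  congr 1
  ext r
  simp

theorem serV_sum {ι : Type*} (s : Finset ι) (f : ι → ℕ → A) :
    ∑ i ∈ s, serV (f i) = serV fun r => ∑ i ∈ s, f i r := by
  ext b : 1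
  simp [serV]

theorem serU_one : serU (fun r => if r = 0 then (1 : A) else 0) = 1 := by
  rw [serU, ← map_one C]
  congr 1
  ext r
  simp [coeff_one]

theorem serV_one : serV (fun r => if r = 0 then (1 : A) else 0) = 1 := by
  ext b : 1
  by_cases hb : b = 0 <;> simp [serV, coeff_one, hb]

theorem serU_zero : serU (fun _ => (0 : A)) = 0 := by
  rw [serU, ← map_zero C]
  congr 1

theorem serV_zero : serV (fun _ => (0 : A)) = 0 := by
  ext b : 1
  simp [serV]

theorem rel_iff {N : ℕ} {t : Fin N → Fin N → ℕ → A}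
    (h0 : ∀ i j, t i j 0 = if i = j then 1 else 0) :
    IsYangianFamily t ↔ ∀ i j k l,
      (varV A - varU A) * (serU (t i j) * serV (t k l) - serV (t k l) * serU (t i j))
        = (varU A * varV A) * (serU (t k j) * serV (t i l) - serV (t k j) * serU (t i l)) := by
  have hc : ∀ i j (x : A), t i j 0 * x - x * t i j 0 = 0 := by
    intro i j x
    rw [h0]
    split_ifs <;> simp
  have hc' : ∀ i j (x : A), x * t i j 0 - t i j 0 * x = 0 := by
    intro i j x
    rw [h0]
    split_ifs <;> simp
  constructor
  · intro h i j k l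
    refine cf_ext fun a b => ?_
    rw [sub_mul, cf_sub, mul_assoc]
    rcases a with _ | a <;> rcases b with _ | b
    · simp only [cf_varU_zero, cf_varV_zero, sub_zero]
    · simp only [cf_varU_zero, cf_varV_succ, cf_sub, cf_serU_serV, cf_serV_serU, hc, sub_zero]
    · simp only [cf_varU_succ, cf_varV_zero, cf_sub, cf_serU_serV, cf_serV_serU, hc', sub_zero]
    · simp only [cf_varU_succ, cf_varV_succ, cf_sub, cf_serU_serV, cf_serV_serU]
      exact h.rel i j k l a b
  · intro h
    refine ⟨h0, fun i j k l r s => ?_⟩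
    have := congrArg (cf (r + 1) (s + 1)) (h i j k l)
    rw [sub_mul, cf_sub, mul_assoc] at this
    simpa only [cf_varU_succ, cf_varV_succ, cf_sub, cf_serU_serV, cf_serV_serU] using this

end YangianSeries

open YangianSeries

/-- The entries of the product of two `N × N` matrices of series. -/
def convFamily {N : ℕ} {A : Type*} [Ring A] (t t' : Fin N → Fin N → ℕ → A) :
    Fin N → Fin N → ℕ → A :=
  fun i j r => ∑ a, ∑ p ∈ Finset.HasAntidiagonal.antidiagonal r, t i a p.1 * t' a j p.2

theorem serU_convFamily {N : ℕ} {A : Type*} [Ring A] (t t' : Fin N → Fin N → ℕ → A) (i j : Fin N) :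
    serU (convFamily t t' i j) = ∑ a, serU (t i a) * serU (t' a j) := by
  simp only [serU_mul, serU_sum]
  rfl

theorem serV_convFamily {N : ℕ} {A : Type*} [Ring A] (t t' : Fin N → Fin N → ℕ → A) (i j : Fin N) :
    serV (convFamily t t' i j) = ∑ a, serV (t i a) * serV (t' a j) := by
  simp only [serV_mul, serV_sum]
  rfl

theorem convFamily_zero {N : ℕ} {A : Type*} [Ring A] {t t' : Fin N → Fin N → ℕ → A}
    (ht : ∀ i j, t i j 0 = if i = j then 1 else 0) (ht' : ∀ i j, t' i j 0 = if i = j then 1 else 0)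
    (i j : Fin N) : convFamily t t' i j 0 = if i = j then 1 else 0 := by
  simp [convFamily, ht, ht']

theorem IsYangianFamily.conv {N : ℕ} {A : Type*} [Ring A] {t t' : Fin N → Fin N → ℕ → A}
    (ht : IsYangianFamily t) (ht' : IsYangianFamily t')
    (hcomm : ∀ i j r k l s, Commute (t i j r) (t' k l s)) :
    IsYangianFamily (convFamily t t') := by
  rw [rel_iff (convFamily_zero ht.zero ht'.zero)]
  have h := (rel_iff ht.zero).1 ht
  have h' := (rel_iff ht'.zero).1 ht'
  have hUV : ∀ i j k l, serU (t i j) * serV (t' k l) = serV (t' k l) * serU (t i j) := fun i j k l =>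
    cf_ext fun a b => by rw [cf_serU_serV, cf_serV_serU, (hcomm _ _ _ _ _ _).eq]
  have hVU : ∀ i j k l, serU (t' i j) * serV (t k l) = serV (t k l) * serU (t' i j) := fun i j k l =>
    cf_ext fun a b => by rw [cf_serU_serV, cf_serV_serU, (hcomm _ _ _ _ _ _).eq]
  intro i j k l
  set z : PowerSeries (PowerSeries A) := varV A - varU A with hz
  set w : PowerSeries (PowerSeries A) := varU A * varV A with hw
  have hzc : ∀ f, z * f = f * z := fun f => by
    rw [hz, sub_mul, mul_sub, varU_comm, varV_comm]
  have hwc : ∀ f, w * f = f * w := fun f => by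
    rw [hw, mul_assoc, varV_comm, ← mul_assoc, varU_comm, mul_assoc]
  simp only [serU_convFamily, serV_convFamily]
  set U := fun i j => serU (t i j) with hU
  set V := fun i j => serV (t i j) with hV
  set U' := fun i j => serU (t' i j) with hU'
  set V' := fun i j => serV (t' i j) with hV'
  have e1 : ∀ i j k l a b, U i a * U' a j * (V k b * V' b l)
      = (U i a * V k b) * (U' a j * V' b l) := fun i j k l a b => by
    rw [mul_assoc, ← mul_assoc (U' a j), hVU, mul_assoc, mul_assoc]
  have e2 : ∀ i j k l a b, V k b * V' b l * (U i a * U' a j)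
      = (V k b * U i a) * (V' b l * U' a j) := fun i j k l a b => by
    rw [mul_assoc, ← mul_assoc (V' b l), ← hUV, mul_assoc, mul_assoc]
  have key : ∀ a b, z * (U i a * U' a j * (V k b * V' b l) - V k b * V' b l * (U i a * U' a j))
      = w * ((U k a * V i b) * (U' a j * V' b l) - (V k a * U i b) * (U' a j * V' b l))
        + w * ((V k b * U i a) * (U' b j * V' a l) - (V k b * U i a) * (V' b j * U' a l)) := by
    intro a b
    have h1 := h i a k b
    have h2 := h' a j b l
    change z * (U i a * V k b - V k b * U i a) = w * (U k a * V i b - V k a * U i b) at h1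
    change z * (U' a j * V' b l - V' b l * U' a j) = w * (U' b j * V' a l - V' b j * U' a l) at h2
    rw [e1, e2, ← sub_mul (U k a * V i b), ← mul_assoc w, ← h1, ← mul_sub (V k b * U i a),
      ← mul_assoc w, hwc (V k b * U i a), mul_assoc (V k b * U i a) w, ← h2,
      ← mul_assoc (V k b * U i a) z, ← hzc]
    noncomm_ring
  have expand : ∀ (X Y Z W : Fin N → PowerSeries (PowerSeries A)),
      (∑ a, X a * Y a) * (∑ b, Z b * W b) = ∑ a, ∑ b, X a * Y a * (Z b * W b) := by
    intro X Y Z W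
    rw [Finset.sum_mul]
    simp only [Finset.mul_sum]
  have lhs : (∑ a, U i a * U' a j) * (∑ b, V k b * V' b l)
        - (∑ b, V k b * V' b l) * (∑ a, U i a * U' a j)
      = ∑ a, ∑ b, (U i a * U' a j * (V k b * V' b l) - V k b * V' b l * (U i a * U' a j)) := by
    rw [expand, expand, Finset.sum_comm (f := fun b a => V k b * V' b l * (U i a * U' a j))]
    simp only [Finset.sum_sub_distrib]
  have rhs : (∑ a, U k a * U' a j) * (∑ b, V i b * V' b l)
        - (∑ b, V k b * V' b j) * (∑ a, U i a * U' a l)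
      = ∑ a, ∑ b, ((U k a * V i b) * (U' a j * V' b l) - (V k b * U i a) * (V' b j * U' a l)) := by
    rw [expand, expand,
      Finset.sum_comm (f := fun b a => V k b * V' b j * (U i a * U' a l))]
    simp only [Finset.sum_sub_distrib, e1, e2]
  have swap : ∑ a, ∑ b, (V k a * U i b) * (U' a j * V' b l)
      = ∑ a, ∑ b, (V k b * U i a) * (U' b j * V' a l) := Finset.sum_comm
  rw [lhs, rhs, Finset.mul_sum, Finset.mul_sum]
  simp only [Finset.mul_sum, key]
  simp only [← Finset.mul_sum, Finset.sum_add_distrib, Finset.sum_sub_distrib, swap, mul_sub]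
  abel

/-- The relation `(z - w P) T₁ T₂ = T₂ T₁ (z - w P)` for a pair of invertible matrices, where `z`
and `w` are central, implies the corresponding relation for their inverses. -/
theorem inverse_matrix_rel {n B : Type*} [Fintype n] [DecidableEq n] [Ring B] (z w : B)
    (hz : ∀ f, z * f = f * z) (hw : ∀ f, w * f = f * w) (U V U' V' : n → n → B)
    (hUU' : ∀ i j, ∑ a, U i a * U' a j = if i = j then 1 else 0)
    (hU'U : ∀ i j, ∑ a, U' i a * U a j = if i = j then 1 else 0)
    (hVV' : ∀ i j, ∑ a, V i a * V' a j = if i = j then 1 else 0)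
    (hV'V : ∀ i j, ∑ a, V' i a * V a j = if i = j then 1 else 0)
    (h : ∀ i j k l, z * (U i j * V k l - V k l * U i j) = w * (U k j * V i l - V k j * U i l))
    (i j k l : n) :
    z * (U' i j * V' k l - V' k l * U' i j) = w * (U' i l * V' k j - V' i l * U' k j) := by
  let M₁ : Matrix (n × n) (n × n) B := Matrix.of fun p q => if p.2 = q.2 then U p.1 q.1 else 0
  let M₂ : Matrix (n × n) (n × n) B := Matrix.of fun p q => if p.1 = q.1 then V p.2 q.2 else 0
  let M₁' : Matrix (n × n) (n × n) B := Matrix.of fun p q => if p.2 = q.2 then U' p.1 q.1 else 0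
  let M₂' : Matrix (n × n) (n × n) B := Matrix.of fun p q => if p.1 = q.1 then V' p.2 q.2 else 0
  let R : Matrix (n × n) (n × n) B :=
    Matrix.of fun p q => (if p = q then z else 0) - (if p = q.swap then w else 0)
  have m11 : M₁ * M₁' = 1 := by
    ext ⟨i, k⟩ ⟨j, l⟩ : 1
    by_cases hkl : k = l <;>
      simp [M₁, M₁', Matrix.mul_apply, Fintype.sum_prod_type, Matrix.one_apply, hkl, hUU']
  have m22 : M₂ * M₂' = 1 := by
    ext ⟨i, k⟩ ⟨j, l⟩ : 1
    by_cases hij : i = j <;>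
      simp [M₂, M₂', Matrix.mul_apply, Fintype.sum_prod_type, Matrix.one_apply, hij, hVV']
  have m11' : M₁' * M₁ = 1 := by
    ext ⟨i, k⟩ ⟨j, l⟩ : 1
    by_cases hkl : k = l <;>
      simp [M₁, M₁', Matrix.mul_apply, Fintype.sum_prod_type, Matrix.one_apply, hkl, hU'U]
  have m22' : M₂' * M₂ = 1 := by
    ext ⟨i, k⟩ ⟨j, l⟩ : 1
    by_cases hij : i = j <;>
      simp [M₂, M₂', Matrix.mul_apply, Fintype.sum_prod_type, Matrix.one_apply, hij, hV'V]
  have hRl : ∀ (M : Matrix (n × n) (n × n) B) (i k j l : n),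
      (R * M) (i, k) (j, l) = z * M (i, k) (j, l) - w * M (k, i) (j, l) := by
    intro M i k j l
    have : ∀ a b : n, ((i, k) = Prod.swap (a, b)) ↔ ((k, i) = (a, b)) := by
      intro a b
      simp [and_comm]
    simp only [R, Matrix.mul_apply, Fintype.sum_prod_type, Matrix.of_apply, sub_mul, this,
      Finset.sum_sub_distrib, ite_mul, zero_mul]
    simp [Prod.ext_iff, ite_and]
  have hRr : ∀ (M : Matrix (n × n) (n × n) B) (i k j l : n),
      (M * R) (i, k) (j, l) = M (i, k) (j, l) * z - M (i, k) (l, j) * w := by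
    intro M i k j l
    simp only [R, Matrix.mul_apply, Fintype.sum_prod_type, Matrix.of_apply, mul_sub,
      Finset.sum_sub_distrib, mul_ite, mul_zero]
    simp [Prod.ext_iff, ite_and]
  have h12 : ∀ i k j l, (M₁ * M₂) (i, k) (j, l) = U i j * V k l := by
    intro i k j l
    simp [M₁, M₂, Matrix.mul_apply, Fintype.sum_prod_type]
  have h21 : ∀ i k j l, (M₂ * M₁) (i, k) (j, l) = V k l * U i j := by
    intro i k j l
    simp [M₁, M₂, Matrix.mul_apply, Fintype.sum_prod_type]
  have h12' : ∀ i k j l, (M₁' * M₂') (i, k) (j, l) = U' i j * V' k l := by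
    intro i k j l
    simp [M₁', M₂', Matrix.mul_apply, Fintype.sum_prod_type]
  have h21' : ∀ i k j l, (M₂' * M₁') (i, k) (j, l) = V' k l * U' i j := by
    intro i k j l
    simp [M₁', M₂', Matrix.mul_apply, Fintype.sum_prod_type]
  have hR : R * (M₁ * M₂) = (M₂ * M₁) * R := by
    ext ⟨i, k⟩ ⟨j, l⟩ : 1
    rw [hRl, hRr, h12, h12, h21, h21, ← hz, ← hw]
    have := h i j k l
    rw [mul_sub, mul_sub, sub_eq_sub_iff_add_eq_add] at this
    rw [sub_eq_sub_iff_add_eq_add, this, add_comm]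
  have hR' : (M₁' * M₂') * R = R * (M₂' * M₁') :=
    calc (M₁' * M₂') * R = (M₁' * M₂') * (R * (M₁ * M₂)) * (M₂' * M₁') := by
          rw [mul_assoc (M₁' * M₂'), mul_assoc R, mul_assoc M₁ M₂, ← mul_assoc M₂ M₂', m22, one_mul,
            m11, mul_one]
      _ = (M₁' * M₂') * ((M₂ * M₁) * R) * (M₂' * M₁') := by rw [hR]
      _ = R * (M₂' * M₁') := by
          rw [← mul_assoc (M₁' * M₂') (M₂ * M₁), mul_assoc M₁', ← mul_assoc M₂', m22', one_mul,
            m11', one_mul]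
  have := congrFun (congrFun hR' (i, k)) (j, l)
  rw [hRl, hRr, h12', h12', h21', h21', ← hz, ← hw, sub_eq_sub_iff_add_eq_add] at this
  rw [mul_sub, mul_sub, sub_eq_sub_iff_add_eq_add, this, add_comm]

/-- If the matrix of series `s` is inverse to the matrix of series `t`, and the entries of `t`
satisfy the relations of the Yangian, then so do the entries of `s` in the opposite algebra. -/
theorem IsYangianFamily.op_of_inverse {N : ℕ} {A : Type*} [Ring A] {t s : Fin N → Fin N → ℕ → A}
    (ht : IsYangianFamily t) (hs : ∀ i j, s i j 0 = if i = j then 1 else 0)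
    (hts : ∀ i j r, convFamily t s i j r = if r = 0 then (if i = j then 1 else 0) else 0)
    (hst : ∀ i j r, convFamily s t i j r = if r = 0 then (if i = j then 1 else 0) else 0) :
    IsYangianFamily fun i j r => MulOpposite.op (s i j r) := by
  have h := (rel_iff ht.zero).1 ht
  set z : PowerSeries (PowerSeries A) := varV A - varU A with hz
  set w : PowerSeries (PowerSeries A) := varU A * varV A with hw
  have hzc : ∀ f, z * f = f * z := fun f => by
    rw [hz, sub_mul, mul_sub, varU_comm, varV_comm]
  have hwc : ∀ f, w * f = f * w := fun f => by
    rw [hw, mul_assoc, varV_comm, ← mul_assoc, varU_comm, mul_assoc]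
  have inv : ∀ {x y : Fin N → Fin N → ℕ → A},
      (∀ i j r, convFamily x y i j r = if r = 0 then (if i = j then 1 else 0) else 0) →
      (∀ i j, ∑ a, serU (x i a) * serU (y a j) = if i = j then 1 else 0) ∧
      (∀ i j, ∑ a, serV (x i a) * serV (y a j) = if i = j then 1 else 0) := by
    intro x y hxy
    constructor
    · intro i j
      rw [← serU_convFamily, show convFamily x y i j
        = fun r => if r = 0 then (if i = j then 1 else 0) else 0 from funext (hxy i j)]
      by_cases hij : i = j
      · simp only [hij, if_true, serU_one]
      · simp only [hij, if_false, ite_self, serU_zero]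
    · intro i j
      rw [← serV_convFamily, show convFamily x y i j
        = fun r => if r = 0 then (if i = j then 1 else 0) else 0 from funext (hxy i j)]
      by_cases hij : i = j
      · simp only [hij, if_true, serV_one]
      · simp only [hij, if_false, ite_self, serV_zero]
  obtain ⟨hUts, hVts⟩ := inv hts
  obtain ⟨hUst, hVst⟩ := inv hst
  have key := inverse_matrix_rel z w hzc hwc (fun i j => serU (t i j)) (fun i j => serV (t i j))
    (fun i j => serU (s i j)) (fun i j => serV (s i j)) hUts hUst hVts hVst h
  refine ⟨fun i j => ?_, fun i j k l r q => ?_⟩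
  · rw [hs]
    split_ifs <;> rfl
  · have e := congrArg (cf (r + 1) (q + 1)) (key i j k l)
    rw [hz, hw, sub_mul, cf_sub, mul_assoc] at e
    simp only [cf_varU_succ, cf_varV_succ, cf_sub, cf_serU_serV, cf_serV_serU] at e
    apply MulOpposite.unop_injective
    simp only [MulOpposite.unop_sub, MulOpposite.unop_mul, MulOpposite.unop_op]
    rw [← neg_inj, neg_sub (s i l q * s k j r), ← e]
    abel

end

noncomputable section

/-- The index set of the generators `T_ij^(r)`, where `i, j = 1, …, N` and `r = 1, 2, …`. -/
@[ext]
structure YangianIndex (N : ℕ) where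
  i : Fin N
  j : Fin N
  r : ℕ+

namespace Yangian

/-- The elements `T_ij^(r)`, `r ≥ 0`, of the free algebra, where `T_ij^(0)` is `1` if `i = j` and
`0` otherwise. -/
def freeT {N : ℕ} (i j : Fin N) : ℕ → FreeAlgebra ℂ (YangianIndex N)
  | 0 => if i = j then 1 else 0
  | r + 1 => FreeAlgebra.ι ℂ ⟨i, j, r.succPNat⟩

/-- The defining relations of the Yangian,
`[T_ij^(r+1), T_kl^(s)] - [T_ij^(r), T_kl^(s+1)] = T_kj^(r) T_il^(s) - T_kj^(s) T_il^(r)`. -/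
inductive Rel (N : ℕ) : FreeAlgebra ℂ (YangianIndex N) → FreeAlgebra ℂ (YangianIndex N) → Prop
  | comm (i j k l : Fin N) (r s : ℕ) : Rel N
      ((freeT i j (r + 1) * freeT k l s - freeT k l s * freeT i j (r + 1))
        - (freeT i j r * freeT k l (s + 1) - freeT k l (s + 1) * freeT i j r))
      (freeT k j r * freeT i l s - freeT k j s * freeT i l r)

end Yangian

/-- The Yangian `Y(gl_N)`. -/
def Yangian (N : ℕ) : Type := RingQuot (Yangian.Rel N)

namespace Yangian

variable {N : ℕ}

instance : Ring (Yangian N) := inferInstanceAs (Ring (RingQuot (Yangian.Rel N)))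

instance : Algebra ℂ (Yangian N) := inferInstanceAs (Algebra ℂ (RingQuot (Yangian.Rel N)))

/-- The elements `T_ij^(r)`, `r ≥ 0`, of the Yangian. -/
def T (i j : Fin N) (r : ℕ) : Yangian N := RingQuot.mkAlgHom ℂ (Yangian.Rel N) (freeT i j r)

/-- The generators `T_ij^(r)`, `r ≥ 1`, of the Yangian. -/
def gen (x : YangianIndex N) : Yangian N := T x.i x.j x.r

theorem gen_mk (i j : Fin N) (r : ℕ) : gen ⟨i, j, r.succPNat⟩ = T i j (r + 1) := rfl

theorem isYangianFamily_T (N : ℕ) : IsYangianFamily (T : Fin N → Fin N → ℕ → Yangian N) where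
  zero i j := by
    rw [T, freeT]
    split_ifs
    · exact map_one _
    · exact map_zero _
  rel i j k l r s := by
    have := RingQuot.mkAlgHom_rel ℂ (Rel.comm i j k l r s)
    simp only [map_sub, map_mul] at this
    exact this

theorem T_zero (i j : Fin N) : T i j 0 = if i = j then 1 else 0 := (isYangianFamily_T N).zero i j

/-- The universal property of the Yangian. -/
def lift {A : Type*} [Ring A] [Algebra ℂ A] (t : Fin N → Fin N → ℕ → A) (ht : IsYangianFamily t) :
    Yangian N →ₐ[ℂ] A :=
  RingQuot.liftAlgHom ℂ ⟨FreeAlgebra.lift ℂ fun x : YangianIndex N => t x.i x.j x.r, by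
    have h : ∀ i j r, FreeAlgebra.lift ℂ (fun x : YangianIndex N => t x.i x.j x.r) (freeT i j r)
        = t i j r := by
      intro i j r
      cases r with
      | zero =>
        rw [ht.zero, freeT]
        split_ifs
        · exact map_one _
        · exact map_zero _
      | succ r => simp [freeT]
    rintro _ _ ⟨i, j, k, l, r, s⟩
    simp only [map_sub, map_mul, h]
    exact ht.rel i j k l r s⟩

theorem lift_T {A : Type*} [Ring A] [Algebra ℂ A] (t : Fin N → Fin N → ℕ → A)
    (ht : IsYangianFamily t) (i j : Fin N) (r : ℕ) : lift t ht (T i j r) = t i j r := by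
  have : lift t ht (T i j r)
      = FreeAlgebra.lift ℂ (fun x : YangianIndex N => t x.i x.j x.r) (freeT i j r) :=
    RingQuot.liftAlgHom_mkAlgHom_apply ..
  rw [this]
  cases r with
  | zero =>
    rw [ht.zero, freeT]
    split_ifs
    · exact map_one _
    · exact map_zero _
  | succ r => simp [freeT]

theorem hom_ext {A : Type*} [Semiring A] [Algebra ℂ A] {f g : Yangian N →ₐ[ℂ] A}
    (h : ∀ i j r, f (T i j (r + 1)) = g (T i j (r + 1))) : f = g := by
  refine RingQuot.ringQuot_ext' ℂ (s := Rel N) f g (FreeAlgebra.hom_ext (funext ?_))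
  rintro ⟨i, j, r⟩
  obtain ⟨r, rfl⟩ : ∃ r' : ℕ, r = r'.succPNat := ⟨r.natPred, (PNat.succPNat_natPred r).symm⟩
  exact h i j r

theorem adjoin_eq_top (N : ℕ) : Algebra.adjoin ℂ (Set.range (gen (N := N))) = ⊤ := by
  set S := Algebra.adjoin ℂ (Set.range (gen (N := N))) with hS
  have hT : ∀ i j r, T i j r ∈ S := by
    intro i j r
    cases r with
    | zero =>
      rw [T_zero]
      split_ifs
      · exact one_mem _
      · exact zero_mem _
    | succ r => exact Algebra.subset_adjoin ⟨⟨i, j, r.succPNat⟩, rfl⟩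
  let f : Yangian N →ₐ[ℂ] S := lift (fun i j r => ⟨T i j r, hT i j r⟩)
    { zero := fun i j => Subtype.ext (by
        change T i j 0 = _
        rw [T_zero]
        split_ifs <;> rfl)
      rel := fun i j k l r s => Subtype.ext ((isYangianFamily_T N).rel i j k l r s) }
  have hf : S.val.comp f = AlgHom.id ℂ _ := hom_ext fun i j r => by
    simp only [AlgHom.comp_apply, f, lift_T]
    rfl
  refine Algebra.eq_top_iff.2 fun x => ?_
  have := congrArg (fun g : Yangian N →ₐ[ℂ] Yangian N => g x) hf
  have hx : (f x : Yangian N) = x := this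
  rw [← hx]
  exact (f x).2

/-! ### The Hopf algebra structure -/

/-- The matrix entries of `Δ (T (u))`: `∑ₖ ∑_{a + b = r} T_ik^(a) ⊗ T_kj^(b)`. -/
def comulT (i j : Fin N) (r : ℕ) : Yangian N ⊗[ℂ] Yangian N :=
  ∑ k, ∑ p ∈ Finset.HasAntidiagonal.antidiagonal r, T i k p.1 ⊗ₜ T k j p.2

theorem isYangianFamily_map {A B : Type*} [Ring A] [Ring B] {t : Fin N → Fin N → ℕ → A}
    (ht : IsYangianFamily t) (f : A →+* B) : IsYangianFamily fun i j r => f (t i j r) where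
  zero i j := by
    rw [ht.zero]
    split_ifs <;> simp
  rel i j k l r s := by
    simp only [← map_mul, ← map_sub]
    rw [ht.rel]

theorem isYangianFamily_comulT : IsYangianFamily (comulT (N := N)) := by
  have h1 := isYangianFamily_map (isYangianFamily_T N)
    (Algebra.TensorProduct.includeLeft (R := ℂ) (S := ℂ) (A := Yangian N)
      (B := Yangian N)).toRingHom
  have h2 := isYangianFamily_map (isYangianFamily_T N)
    (Algebra.TensorProduct.includeRight (R := ℂ) (A := Yangian N) (B := Yangian N)).toRingHom
  have h := h1.conv h2 fun i j r k l s => by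
    simp [Commute, SemiconjBy]
  convert h using 1
  funext i j r
  simp [comulT, convFamily]

/-- The comultiplication of the Yangian. -/
def comulHom (N : ℕ) : Yangian N →ₐ[ℂ] Yangian N ⊗[ℂ] Yangian N :=
  lift comulT isYangianFamily_comulT

theorem isYangianFamily_counit : IsYangianFamily
    fun (i j : Fin N) (r : ℕ) => if r = 0 then (if i = j then (1 : ℂ) else 0) else 0 where
  zero i j := rfl
  rel i j k l r s := by
    simp only [Nat.succ_ne_zero, if_false, zero_mul, mul_zero, sub_zero]
    by_cases hr : r = 0 <;> by_cases hs : s = 0 <;> simp [hr, hs]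

/-- The counit of the Yangian. -/
def counitHom (N : ℕ) : Yangian N →ₐ[ℂ] ℂ := lift _ isYangianFamily_counit

theorem counitHom_T (i j : Fin N) (r : ℕ) :
    counitHom N (T i j r) = if r = 0 then (if i = j then 1 else 0) else 0 := lift_T ..

theorem comulHom_T (i j : Fin N) (r : ℕ) : comulHom N (T i j r)
    = ∑ k, ∑ p ∈ Finset.HasAntidiagonal.antidiagonal r, T i k p.1 ⊗ₜ T k j p.2 := lift_T ..

theorem sum_triple {M : Type*} [AddCommMonoid M] (r : ℕ) (f : ℕ → ℕ → ℕ → M) :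
    ∑ p ∈ Finset.HasAntidiagonal.antidiagonal r,
        ∑ q ∈ Finset.HasAntidiagonal.antidiagonal p.1, f q.1 q.2 p.2
      = ∑ p ∈ Finset.HasAntidiagonal.antidiagonal r,
        ∑ q ∈ Finset.HasAntidiagonal.antidiagonal p.2, f p.1 q.1 q.2 := by
  rw [Finset.sum_sigma', Finset.sum_sigma']
  refine Finset.sum_nbij' (fun q => ⟨(q.2.1, q.2.2 + q.1.2), (q.2.2, q.1.2)⟩)
    (fun q => ⟨(q.1.1 + q.2.1, q.2.2), (q.1.1, q.2.1)⟩) ?_ ?_ ?_ ?_ ?_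
  · rintro ⟨⟨a, b⟩, ⟨c, e⟩⟩ h
    simp only [Finset.mem_sigma, Finset.HasAntidiagonal.mem_antidiagonal] at h ⊢
    obtain ⟨h₁, h₂⟩ := h
    exact ⟨by omega, trivial⟩
  · rintro ⟨⟨a, b⟩, ⟨c, e⟩⟩ h
    simp only [Finset.mem_sigma, Finset.HasAntidiagonal.mem_antidiagonal] at h ⊢
    obtain ⟨h₁, h₂⟩ := h
    exact ⟨by omega, trivial⟩
  · rintro ⟨⟨a, b⟩, ⟨c, e⟩⟩ h
    simp only [Finset.mem_sigma, Finset.HasAntidiagonal.mem_antidiagonal] at h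
    obtain ⟨-, rfl⟩ := h
    rfl
  · rintro ⟨⟨a, b⟩, ⟨c, e⟩⟩ h
    simp only [Finset.mem_sigma, Finset.HasAntidiagonal.mem_antidiagonal] at h
    obtain ⟨-, rfl⟩ := h
    rfl
  · rintro ⟨⟨a, b⟩, ⟨c, e⟩⟩ _
    rfl

instance : Bialgebra ℂ (Yangian N) :=
  Bialgebra.ofAlgHom (comulHom N) (counitHom N)
    (hom_ext fun i j r => by
      simp only [AlgHom.comp_apply, comulHom_T, map_sum, Algebra.TensorProduct.map_tmul,
        AlgHom.coe_id, id_eq, TensorProduct.sum_tmul, TensorProduct.tmul_sum]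
      change ∑ k, ∑ p ∈ Finset.HasAntidiagonal.antidiagonal (r + 1), ∑ l,
          ∑ q ∈ Finset.HasAntidiagonal.antidiagonal p.1, T i l q.1 ⊗ₜ[ℂ] (T l k q.2 ⊗ₜ[ℂ] T k j p.2)
        = ∑ k, ∑ p ∈ Finset.HasAntidiagonal.antidiagonal (r + 1), ∑ l,
          ∑ q ∈ Finset.HasAntidiagonal.antidiagonal p.2, T i k p.1 ⊗ₜ[ℂ] (T k l q.1 ⊗ₜ[ℂ] T l j q.2)
      simp only [Finset.sum_comm (s := Finset.HasAntidiagonal.antidiagonal (r + 1))]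
      rw [Finset.sum_comm]
      refine Finset.sum_congr rfl fun k _ => Finset.sum_congr rfl fun l _ => ?_
      exact sum_triple (r + 1) fun a b c => T i k a ⊗ₜ[ℂ] (T k l b ⊗ₜ[ℂ] T l j c))
    (hom_ext fun i j r => by
      simp only [AlgHom.comp_apply, comulHom_T, map_sum, Algebra.TensorProduct.map_tmul,
        AlgHom.coe_id, id_eq, counitHom_T]
      rw [Finset.sum_eq_single i, Finset.sum_eq_single (0, r + 1)]
      · simp
      · rintro ⟨a, b⟩ h hne
        rw [Finset.HasAntidiagonal.mem_antidiagonal] at h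
        have ha : a ≠ 0 := by
          rintro rfl
          simp at h
          simp [h] at hne
        simp [ha]
      · simp
      · intro k _ hk
        simp [hk.symm]
      · simp)
    (hom_ext fun i j r => by
      simp only [AlgHom.comp_apply, comulHom_T, map_sum, Algebra.TensorProduct.map_tmul,
        AlgHom.coe_id, id_eq, counitHom_T]
      rw [Finset.sum_eq_single j, Finset.sum_eq_single (r + 1, 0)]
      · simp
      · rintro ⟨a, b⟩ h hne
        rw [Finset.HasAntidiagonal.mem_antidiagonal] at h
        have ha : b ≠ 0 := by
          rintro rfl
          simp at h
          simp [h] at hne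
        simp [ha]
      · simp
      · intro k _ hk
        simp [hk]
      · simp)

theorem comul_T (i j : Fin N) (r : ℕ) : Coalgebra.comul (R := ℂ) (T i j r)
    = ∑ k, ∑ p ∈ Finset.HasAntidiagonal.antidiagonal r, T i k p.1 ⊗ₜ T k j p.2 := comulHom_T i j r

theorem counit_T (i j : Fin N) (r : ℕ) :
    Coalgebra.counit (R := ℂ) (T i j r) = if r = 0 then (if i = j then 1 else 0) else 0 :=
  counitHom_T i j r

/-- The series `T (u)`, as a power series in `u⁻¹` with matrix coefficients. -/
def seriesT (N : ℕ) : PowerSeries (Matrix (Fin N) (Fin N) (Yangian N)) :=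
  PowerSeries.mk fun r => Matrix.of fun i j => T i j r

theorem constantCoeff_seriesT :
    PowerSeries.constantCoeff (seriesT N)
      = ((1 : (Matrix (Fin N) (Fin N) (Yangian N))ˣ) : Matrix (Fin N) (Fin N) (Yangian N)) := by
  rw [← PowerSeries.coeff_zero_eq_constantCoeff_apply, seriesT, PowerSeries.coeff_mk]
  ext i j
  simp [T_zero, Matrix.one_apply]

/-- The coefficients of the entries of the inverse matrix `T (u)⁻¹`. -/
def invT (i j : Fin N) (r : ℕ) : Yangian N :=
  (PowerSeries.coeff r (PowerSeries.invOfUnit (seriesT N) 1) :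
    Matrix (Fin N) (Fin N) (Yangian N)) i j

theorem conv_T_invT (i j : Fin N) (r : ℕ) :
    convFamily T invT i j r = if r = 0 then (if i = j then 1 else 0) else 0 := by
  have h := PowerSeries.mul_invOfUnit (seriesT N) 1 constantCoeff_seriesT
  have h₁ : ∑ p ∈ Finset.HasAntidiagonal.antidiagonal r, PowerSeries.coeff p.1 (seriesT N)
      * PowerSeries.coeff p.2 (PowerSeries.invOfUnit (seriesT N) 1)
      = if r = 0 then (1 : Matrix (Fin N) (Fin N) (Yangian N)) else 0 := by
    rw [← PowerSeries.coeff_mul, h, PowerSeries.coeff_one]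
  have h' := congrFun (congrFun h₁ i) j
  rw [Matrix.sum_apply] at h'
  simp only [Matrix.mul_apply, seriesT, PowerSeries.coeff_mk, Matrix.of_apply] at h'
  rw [convFamily, Finset.sum_comm]
  refine h'.trans ?_
  split_ifs <;> simp [Matrix.one_apply, *]

theorem conv_invT_T (i j : Fin N) (r : ℕ) :
    convFamily invT T i j r = if r = 0 then (if i = j then 1 else 0) else 0 := by
  have h := PowerSeries.invOfUnit_mul (seriesT N) 1 constantCoeff_seriesT
  have h₁ : ∑ p ∈ Finset.HasAntidiagonal.antidiagonal r, PowerSeries.coeff p.1 (PowerSeries.invOfUnit (seriesT N) 1)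
      * PowerSeries.coeff p.2 (seriesT N)
      = if r = 0 then (1 : Matrix (Fin N) (Fin N) (Yangian N)) else 0 := by
    rw [← PowerSeries.coeff_mul, h, PowerSeries.coeff_one]
  have h' := congrFun (congrFun h₁ i) j
  rw [Matrix.sum_apply] at h'
  simp only [Matrix.mul_apply, seriesT, PowerSeries.coeff_mk, Matrix.of_apply] at h'
  rw [convFamily, Finset.sum_comm]
  refine h'.trans ?_
  split_ifs <;> simp [Matrix.one_apply, *]

theorem invT_zero (i j : Fin N) : invT i j 0 = if i = j then 1 else 0 := by
  have := conv_T_invT i j 0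
  simpa [convFamily, T_zero] using this

theorem isYangianFamily_invT :
    IsYangianFamily fun (i j : Fin N) (r : ℕ) => MulOpposite.op (invT i j r) :=
  (isYangianFamily_T N).op_of_inverse invT_zero conv_T_invT conv_invT_T

/-- The antipode of the Yangian, `T (u) ↦ T (u)⁻¹`, as a homomorphism to the opposite algebra. -/
def antipodeHom (N : ℕ) : Yangian N →ₐ[ℂ] (Yangian N)ᵐᵒᵖ := lift _ isYangianFamily_invT

theorem antipodeHom_T (i j : Fin N) (r : ℕ) :
    antipodeHom N (T i j r) = MulOpposite.op (invT i j r) := lift_T ..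

instance : HopfAlgebra ℂ (Yangian N) where
  antipode := (MulOpposite.opLinearEquiv ℂ).symm.toLinearMap ∘ₗ (antipodeHom N).toLinearMap
  mul_antipode_rTensor_comul := by
    refine antipode_rTensor_of_adjoin _ _ (adjoin_eq_top N) ?_
    rintro _ ⟨x, rfl⟩
    rw [gen, comul_T, counit_T]
    simp only [map_sum, LinearMap.rTensor_tmul, LinearMap.comp_apply, AlgHom.toLinearMap_apply,
      antipodeHom_T, LinearMap.mul'_apply]
    refine (conv_invT_T x.i x.j x.r).trans ?_
    simp
  mul_antipode_lTensor_comul := by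
    refine antipode_lTensor_of_adjoin _ _ (adjoin_eq_top N) ?_
    rintro _ ⟨x, rfl⟩
    rw [gen, comul_T, counit_T]
    simp only [map_sum, LinearMap.lTensor_tmul, LinearMap.comp_apply, AlgHom.toLinearMap_apply,
      antipodeHom_T, LinearMap.mul'_apply]
    refine (conv_T_invT x.i x.j x.r).trans ?_
    simp

theorem antipode_T (i j : Fin N) (r : ℕ) : HopfAlgebra.antipode ℂ (T i j r) = invT i j r := by
  change (MulOpposite.opLinearEquiv ℂ).symm (antipodeHom N (T i j r)) = _
  rw [antipodeHom_T]
  rfl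

/-! ### The two filtrations -/

/-- The first filtration on the Yangian, `deg T_ij^(r) = r`. -/
def filt (N : ℕ) : AlgFiltration ℂ (Yangian N) := weightFiltration ℂ gen fun x => (x.r : ℕ)

/-- The second filtration on the Yangian, `deg' T_ij^(r) = r - 1`. -/
def filt' (N : ℕ) : AlgFiltration ℂ (Yangian N) := weightFiltration ℂ gen fun x => (x.r : ℕ) - 1

/-- The image of `T_ij^(r)`, `r ≥ 1`, in the degree `r` component of `gr Y(gl_N)`. -/
def grGen (x : YangianIndex N) : (filt N).Gr :=
  (filt N).symb x.r ⟨gen x, mem_weightFiltration gen _ x⟩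

/-- The image of `T_ij^(r)`, `r ≥ 1`, in the degree `r - 1` component of `gr' Y(gl_N)`. -/
def grGen' (x : YangianIndex N) : (filt' N).Gr :=
  (filt' N).symb ((x.r : ℕ) - 1) ⟨gen x, mem_weightFiltration gen _ x⟩

theorem T_mem_filt' (i j : Fin N) (r : ℕ) : T i j r ∈ (filt' N).F (r - 1) := by
  cases r with
  | zero =>
    rw [T_zero]
    split_ifs
    · exact (filt' N).one_mem
    · exact zero_mem _
  | succ r => exact mem_weightFiltration gen (fun x => (x.r : ℕ) - 1) ⟨i, j, r.succPNat⟩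

theorem invT_mem_filt' (i j : Fin N) (r : ℕ) : invT i j r ∈ (filt' N).F (r - 1) := by
  induction r using Nat.strong_induction_on generalizing i j with
  | _ r ih =>
  rcases r with _ | r
  · rw [invT_zero]
    split_ifs
    · exact (filt' N).one_mem
    · exact zero_mem _
  · have h := conv_T_invT i j (r + 1)
    rw [convFamily, if_neg (Nat.succ_ne_zero r), Finset.sum_comm] at h
    rw [← Finset.add_sum_erase _ _ (show (0, r + 1) ∈ Finset.HasAntidiagonal.antidiagonal (r + 1)
      by simp)] at h
    simp only [T_zero, ite_mul, one_mul, zero_mul, Finset.sum_ite_eq, Finset.mem_univ,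
      if_true] at h
    rw [eq_neg_of_add_eq_zero_left h]
    refine neg_mem (sum_mem ?_)
    rintro ⟨a, b⟩ hp
    rw [Finset.mem_erase, Finset.HasAntidiagonal.mem_antidiagonal] at hp
    obtain ⟨hne, hab⟩ := hp
    have ha : a ≠ 0 := by
      rintro rfl
      simp at hab
      simp [hab] at hne
    dsimp only at hab
    refine sum_mem fun k _ => ?_
    exact (filt' N).mono (by omega)
      ((filt' N).mul_mem (T_mem_filt' i k a) (ih b (by omega) k j))

instance : (filt' N).IsHopfFiltration := by
  refine AlgFiltration.isHopfFiltration_weightFiltration _ _ ?_ ?_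
  · rintro ⟨i, j, r⟩
    obtain ⟨r, rfl⟩ : ∃ r' : ℕ, r = r'.succPNat := ⟨r.natPred, (PNat.succPNat_natPred r).symm⟩
    rw [gen_mk, comul_T]
    refine sum_mem fun k _ => sum_mem ?_
    rintro ⟨a, b⟩ hp
    rw [Finset.HasAntidiagonal.mem_antidiagonal] at hp
    refine AlgFiltration.tmul_mem_tensorF _ ?_ (T_mem_filt' i k a) (T_mem_filt' k j b)
    simp only [Nat.succPNat_coe]
    simp only at hp
    omega
  · rintro ⟨i, j, r⟩
    rw [gen, antipode_T]
    exact invT_mem_filt' i j r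

end Yangian

end

noncomputable section

/-! ### Enveloping algebras and polynomial current Lie algebras -/

section Enveloping

attribute [local instance 100] LieRing.ofAssociativeRing

namespace UniversalEnvelopingAlgebra

variable {k L : Type*} [CommRing k] [LieRing L] [LieAlgebra k L]

/-- The comultiplication `X ↦ X ⊗ 1 + 1 ⊗ X` of a universal enveloping algebra. -/
def comulHom (k L : Type*) [CommRing k] [LieRing L] [LieAlgebra k L] :
    UniversalEnvelopingAlgebra k L →ₐ[k]
      UniversalEnvelopingAlgebra k L ⊗[k] UniversalEnvelopingAlgebra k L :=
  lift k
    { toFun := fun x => ι k x ⊗ₜ 1 + 1 ⊗ₜ ι k x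
      map_add' := fun x y => by
        simp only [map_add, TensorProduct.add_tmul, TensorProduct.tmul_add]
        abel
      map_smul' := fun c x => by
        simp only [map_smul, TensorProduct.smul_tmul', TensorProduct.tmul_smul, smul_add,
          RingHom.id_apply]
      map_lie' := fun {x y} => by
        simp only [LieHom.map_lie, LieRing.of_associative_ring_bracket, mul_add, add_mul,
          Algebra.TensorProduct.tmul_mul_tmul, one_mul, mul_one, TensorProduct.sub_tmul,
          TensorProduct.tmul_sub]
        abel }

theorem comulHom_ι (x : L) : comulHom k L (ι k x) = ι k x ⊗ₜ 1 + 1 ⊗ₜ ι k x := lift_ι_apply ..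

/-- The counit `X ↦ 0` of a universal enveloping algebra. -/
def counitHom (k L : Type*) [CommRing k] [LieRing L] [LieAlgebra k L] :
    UniversalEnvelopingAlgebra k L →ₐ[k] k := lift k 0

theorem counitHom_ι (x : L) : counitHom k L (ι k x) = 0 := lift_ι_apply ..

/-- The antipode `X ↦ -X` of a universal enveloping algebra, as a homomorphism to the opposite
algebra. -/
def antipodeHom (k L : Type*) [CommRing k] [LieRing L] [LieAlgebra k L] :
    UniversalEnvelopingAlgebra k L →ₐ[k] (UniversalEnvelopingAlgebra k L)ᵐᵒᵖ :=
  lift k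
    { toFun := fun x => MulOpposite.op (-ι k x)
      map_add' := fun x y => by
        simp only [map_add, neg_add, MulOpposite.op_add]
      map_smul' := fun c x => by
        simp only [map_smul, ← smul_neg, MulOpposite.op_smul, RingHom.id_apply]
      map_lie' := fun {x y} => by
        simp only [LieHom.map_lie, LieRing.of_associative_ring_bracket, ← MulOpposite.op_mul,
          ← MulOpposite.op_sub, neg_mul_neg, neg_sub] }

theorem antipodeHom_ι (x : L) : antipodeHom k L (ι k x) = MulOpposite.op (-ι k x) :=
  lift_ι_apply ..

theorem adjoin_ι (k L : Type*) [CommRing k] [LieRing L] [LieAlgebra k L] :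
    Algebra.adjoin k (Set.range (ι k : L → UniversalEnvelopingAlgebra k L)) = ⊤ := by
  set S := Algebra.adjoin k (Set.range (ι k : L → UniversalEnvelopingAlgebra k L)) with hS
  have hι : ∀ x : L, ι k x ∈ S := fun x => Algebra.subset_adjoin ⟨x, rfl⟩
  let f : UniversalEnvelopingAlgebra k L →ₐ[k] S := lift k
    { toFun := fun x => ⟨ι k x, hι x⟩
      map_add' := fun x y => Subtype.ext (map_add _ _ _)
      map_smul' := fun c x => Subtype.ext (map_smul _ _ _)
      map_lie' := fun {x y} => Subtype.ext (LieHom.map_lie _ _ _) }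
  have hf : S.val.comp f = AlgHom.id k _ := by
    refine hom_ext k (LieHom.ext fun x => ?_)
    change S.val (f (ι k x)) = ι k x
    simp only [f, lift_ι_apply]
    rfl
  refine Algebra.eq_top_iff.2 fun x => ?_
  have hx : (f x : UniversalEnvelopingAlgebra k L) = x :=
    congrArg (fun g : UniversalEnvelopingAlgebra k L →ₐ[k] _ => g x) hf
  rw [← hx]
  exact (f x).2

theorem algHom_ext' {A : Type*} [Ring A] [Algebra k A]
    {f g : UniversalEnvelopingAlgebra k L →ₐ[k] A} (h : ∀ x : L, f (ι k x) = g (ι k x)) : f = g :=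
  hom_ext k (LieHom.ext h)

instance : Bialgebra k (UniversalEnvelopingAlgebra k L) :=
  Bialgebra.ofAlgHom (comulHom k L) (counitHom k L)
    (algHom_ext' fun x => by
      simp only [AlgHom.comp_apply, comulHom_ι, map_add, Algebra.TensorProduct.map_tmul, map_one,
        AlgHom.coe_id, id_eq, TensorProduct.add_tmul, TensorProduct.tmul_add]
      simp [Algebra.TensorProduct.one_def, add_assoc])
    (algHom_ext' fun x => by
      simp [-ι_apply, comulHom_ι, counitHom_ι])
    (algHom_ext' fun x => by
      simp [-ι_apply, comulHom_ι, counitHom_ι])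

theorem comul_ι (x : L) : Coalgebra.comul (R := k) (ι k x) = ι k x ⊗ₜ 1 + 1 ⊗ₜ ι k x :=
  comulHom_ι x

theorem counit_ι (x : L) : Coalgebra.counit (R := k) (ι k x) = 0 := counitHom_ι x

/-- The standard Hopf algebra structure of a universal enveloping algebra. -/
instance : HopfAlgebra k (UniversalEnvelopingAlgebra k L) where
  antipode := (MulOpposite.opLinearEquiv k).symm.toLinearMap ∘ₗ (antipodeHom k L).toLinearMap
  mul_antipode_rTensor_comul := by
    refine antipode_rTensor_of_adjoin _ _ (adjoin_ι k L) ?_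
    rintro _ ⟨x, rfl⟩
    rw [comul_ι, counit_ι]
    simp [-ι_apply, antipodeHom_ι]
  mul_antipode_lTensor_comul := by
    refine antipode_lTensor_of_adjoin _ _ (adjoin_ι k L) ?_
    rintro _ ⟨x, rfl⟩
    rw [comul_ι, counit_ι]
    simp [-ι_apply, antipodeHom_ι]

theorem antipode_ι (x : L) : HopfAlgebra.antipode k (ι k x) = -ι k x := by
  change (MulOpposite.opLinearEquiv k).symm (antipodeHom k L (ι k x)) = _
  rw [antipodeHom_ι]
  rfl

end UniversalEnvelopingAlgebra

/-- The polynomial current Lie algebra `gl_N[z] = ℂ[z] ⊗ gl_N`, with the bracket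
`[f ⊗ X, g ⊗ Y] = f g ⊗ [X, Y]`. -/
def GlCurrent (N : ℕ) : Type := ℂ[X] ⊗[ℂ] Matrix (Fin N) (Fin N) ℂ

namespace GlCurrent

variable {N : ℕ}

instance : LieRing (GlCurrent N) :=
  LieAlgebra.ExtendScalars.instLieRing ℂ ℂ[X] (Matrix (Fin N) (Fin N) ℂ)

instance : LieAlgebra ℂ (GlCurrent N) :=
  LieAlgebra.ExtendScalars.instBaseLieAlgebra ℂ ℂ[X] (Matrix (Fin N) (Fin N) ℂ)

/-- The element `X z ^ s` of the polynomial current Lie algebra, for `X` in `gl_N`. -/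
def elem (x : Matrix (Fin N) (Fin N) ℂ) (s : ℕ) : GlCurrent N :=
  ((Polynomial.X : ℂ[X]) ^ s) ⊗ₜ[ℂ] x

theorem lie_elem (x y : Matrix (Fin N) (Fin N) ℂ) (s t : ℕ) :
    ⁅elem x s, elem y t⁆ = elem (x * y - y * x) (s + t) := by
  rw [elem, elem, elem, pow_add]
  rfl

/-- The component of degree `d` of `U(gl_N[z])`, where `X z ^ s` has degree `s` for `X` in
`gl_N`. -/
def envComponent (N d : ℕ) : Submodule ℂ (UniversalEnvelopingAlgebra ℂ (GlCurrent N)) :=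
  Submodule.span ℂ {u | ∃ l : List (Matrix (Fin N) (Fin N) ℂ × ℕ), (l.map Prod.snd).sum = d ∧
    (l.map fun p => UniversalEnvelopingAlgebra.ι ℂ (elem p.1 p.2)).prod = u}

end GlCurrent

end Enveloping

/-- The ordered monomial in the generators `T_ij^(r)` of the Yangian, for a given linear ordering
of the generators, in which every generator occurs as many times as in the multiset `m`. -/
def Yangian.orderedMonomial {N : ℕ} [LinearOrder (YangianIndex N)]
    (m : Multiset (YangianIndex N)) : Yangian N :=
  ((m.sort (· ≤ ·)).map Yangian.gen).prod

end

/-! ### Words in generators -/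

section Words

variable {k A I : Type*} [CommRing k] [Ring A] [Algebra k A]

/-! All three statements rest on one fact: for every linear order on the generators, the ordered
monomials form a basis of the Yangian.

Spanning. The defining relation moves one unit of the upper index from the first factor of a
commutator to the second, at the cost of quadratic terms. Iterating down to `T_ij^(0)`, which is
scalar, shows that `[T_ij^(r), T_kl^(s)]` has `deg` at most `r + s - 1`, and that modulo smaller
`deg'` it is the bracket of `gl_N[z]`. Hence letters of a word can be interchanged modulo words that
are lighter or, at no greater weight, shorter (`weightFiltration_eq_span`).

Independence. Take commuting copies `E^κ` of `gl_N` and the product of their evaluation families at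
the points `c κ * X`, with `X` a central parameter. The image of `T_ij^(r+1)` is a polynomial in `X`
of degree at most `r` whose coefficient at `X ^ r` is `∑ κ, c κ ^ r * E^κ_ij`
(`listFamily_sub_monomial_mem`). The part of largest weight of a linear relation between ordered
monomials is therefore a relation between ordered monomials in these sums
(`exists_relation_leadingCoeff`). Next realise `E^κ_ij` as `x_κi (∂_κj + t y_κj)` with a second
parameter `t`. A second passage to leading coefficients, now in `t`, replaces `E^κ_ij` by the
commuting product `x_κi y_κj`. A dual Vandermonde matrix provides `c`, `y` and a specialisation of
`x` for which `∑ κ, c κ ^ r x_κi y_κj` becomes an independent variable for each `i, j` and each `r`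
below a given bound (`exists_leadingTerms`). So a nontrivial relation would give a nontrivial
relation between monomials in a polynomial ring.

Graded algebras. Since each term of either filtration is spanned by the ordered monomials it should
contain, their symbols form a basis of the associated graded algebra. The commutator estimates give
homomorphisms to it from the polynomial ring (for `deg`) and from `U(gl_N[z])` (for `deg'`). In both
sources the ordered monomials span and are carried to that basis, so both maps are bijective; the
linear independence of ordered monomials in `U(gl_N[z])` is not needed as an input.

Hopf structure. In `Δ T_ij^(r)` every term with two nontrivial tensor factors has `deg'` equal to `r
- 2`, one less than the generator. The symbols are thus primitive, like the elements of `gl_N[z]`,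
and agreement on generators is enough. -/

theorem weightFiltration_word_mem (g : I → A) (w : I → ℕ) (l : List I) :
    (l.map g).prod ∈ (weightFiltration k g w).F (l.map w).sum :=
  Submodule.subset_span ⟨l, le_rfl, rfl⟩

theorem symb_word (g : I → A) (w : I → ℕ) (l : List I) :
    (weightFiltration k g w).symb (l.map w).sum ⟨(l.map g).prod, weightFiltration_word_mem g w l⟩
      = (l.map fun i => (weightFiltration k g w).symb (w i)
          ⟨g i, mem_weightFiltration g w i⟩).prod := by
  induction l with
  | nil => exact AlgFiltration.symb_one _
  | cons i l ih =>
    simp only [List.map_cons, List.prod_cons, ← ih, AlgFiltration.symb_mul]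
    rfl

/-- Words of weight less than `d` have zero symbol in degree `d`, so only words of weight exactly
`d` remain. -/
theorem symb_mem_span_words (g : I → A) (w : I → ℕ) (d : ℕ) (x : (weightFiltration k g w).F d) :
    (weightFiltration k g w).symb d x ∈ Submodule.span k {y | ∃ l : List I, (l.map w).sum = d ∧
      (l.map fun i => (weightFiltration k g w).symb (w i)
          ⟨g i, mem_weightFiltration g w i⟩).prod = y} := by
  obtain ⟨x, hx⟩ := x
  refine Submodule.span_induction
    (p := fun x hx => (weightFiltration k g w).symb d ⟨x, hx⟩ ∈ _) ?_ ?_ ?_ ?_ hx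
  · rintro _ ⟨l, hl, rfl⟩
    rcases hl.lt_or_eq with hl | hl
    · rw [AlgFiltration.symb_eq_zero _ _ (AlgFiltration.le_prev _ hl
        (weightFiltration_word_mem g w l))]
      exact zero_mem _
    · refine Submodule.subset_span ⟨l, hl, ?_⟩
      rw [← symb_word]
      exact (weightFiltration k g w).symb_congr hl _ _ rfl
  · have : (⟨0, zero_mem _⟩ : (weightFiltration k g w).F d) = 0 := rfl
    rw [this, map_zero]
    exact zero_mem _
  · intro x y hx hy h1 h2
    have := add_mem h1 h2
    rwa [← map_add] at this
  · intro c x hx h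
    have := Submodule.smul_mem _ c h
    rwa [← map_smul] at this

end Words

/-- A linear map which sends a spanning family to a basis is bijective. -/
theorem LinearMap.bijective_of_comp_basis {k M M' ι : Type*} [CommRing k] [AddCommGroup M]
    [Module k M] [AddCommGroup M'] [Module k M'] (f : M →ₗ[k] M') (v : ι → M)
    (hv : Submodule.span k (Set.range v) = ⊤) (hli : LinearIndependent k fun i => f (v i))
    (hspan : Submodule.span k (Set.range fun i => f (v i)) = ⊤) : Function.Bijective f := by
  constructor
  · refine (injective_iff_map_eq_zero f).2 fun x hx => ?_
    have hx' : x ∈ Submodule.span k (Set.range v) := hv ▸ Submodule.mem_top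
    obtain ⟨c, rfl⟩ := (Finsupp.mem_span_range_iff_exists_finsupp).1 hx'
    have : Finsupp.linearCombination k (fun i => f (v i)) c = 0 := by
      rw [← hx, Finsupp.linearCombination_apply, map_finsuppSum]
      simp only [map_smul]
    rw [linearIndependent_iff.1 hli c this, Finsupp.sum_zero_index]
  · rw [← LinearMap.range_eq_top, eq_top_iff, ← hspan, Submodule.span_le]
    rintro _ ⟨i, rfl⟩
    exact ⟨v i, rfl⟩

/-- The weights only bound the degrees. The coefficient at the bound is multiplicative even when it
vanishes, so nothing is required of zero divisors in `B`. -/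
theorem natDegree_list_prod_le_and_coeff {I B : Type*} [Ring B] (g : I → B[X]) (w : I → ℕ)
    (hdeg : ∀ i, (g i).natDegree ≤ w i) (l : List I) :
    (l.map g).prod.natDegree ≤ (l.map w).sum ∧
      (l.map g).prod.coeff (l.map w).sum = (l.map fun i => (g i).coeff (w i)).prod := by
  induction l with
  | nil => simp
  | cons i l ih =>
    simp only [List.map_cons, List.prod_cons, List.sum_cons]
    exact ⟨Polynomial.natDegree_mul_le_of_le (hdeg i) ih.1, by
      rw [Polynomial.coeff_mul_add_eq_of_natDegree_le (hdeg i) ih.1, ih.2]⟩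

/-! ### Ordered monomials -/

section OrderedMonomials

variable {k A I : Type*} [LinearOrder I]

/-- The ordered monomial in the elements `g i` of an algebra in which every index occurs as many
times as in the multiset `m`. -/
def sortedMonomial [Monoid A] (g : I → A) (m : Multiset I) : A :=
  ((m.sort (· ≤ ·)).map g).prod

theorem sum_map_sort (w : I → ℕ) (m : Multiset I) :
    ((m.sort (· ≤ ·)).map w).sum = (m.map w).sum := by
  conv_rhs => rw [← Multiset.sort_eq m (· ≤ ·)]
  rw [Multiset.map_coe, Multiset.sum_coe]

theorem sortedMonomial_comm {A : Type*} [CommMonoid A] (g : I → A) (m : Multiset I) :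
    sortedMonomial g m = (m.map g).prod := by
  conv_rhs => rw [← Multiset.sort_eq m (· ≤ ·)]
  rw [Multiset.map_coe, Multiset.prod_coe, sortedMonomial]

theorem map_sortedMonomial {A B F : Type*} [Monoid A] [Monoid B] [FunLike F A B]
    [MonoidHomClass F A B] (f : F) (g : I → A) (m : Multiset I) :
    f (sortedMonomial g m) = sortedMonomial (fun i => f (g i)) m := by
  rw [sortedMonomial, map_list_prod, List.map_map]
  rfl

variable [CommRing k] [Ring A] [Algebra k A]

theorem sortedMonomial_mem (g : I → A) (w : I → ℕ) (m : Multiset I) :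
    sortedMonomial g m ∈ (weightFiltration k g w).F (m.map w).sum :=
  Submodule.subset_span ⟨m.sort (· ≤ ·), (sum_map_sort w m).le, rfl⟩

/-- If the commutators of the generators are, up to terms of lower weight, linear combinations of
generators, then the ordered monomials span. -/
theorem weightFiltration_eq_span (g : I → A) (w : I → ℕ)
    (hcomm : ∀ i j, g i * g j - g j * g i ∈ (weightFiltration k g w).prev (w i + w j) ⊔
      Submodule.span k (g '' {l | w l ≤ w i + w j})) (d : ℕ) :
    (weightFiltration k g w).F d
      = Submodule.span k (sortedMonomial g '' {m | (m.map w).sum ≤ d}) := by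
  induction d using Nat.strong_induction_on with
  | _ d ihd =>
  set 𝓕 := weightFiltration k g w with h𝓕
  set S : ℕ → Submodule k A := fun d =>
    Submodule.span k (sortedMonomial g '' {m | (m.map w).sum ≤ d}) with hS
  -- The outer induction on the weight disposes of every term of smaller weight.
  have hprev : 𝓕.prev d ≤ S d := by
    intro x hx
    rcases 𝓕.mem_prev_iff.1 hx with rfl | ⟨e, he, hx⟩
    · exact zero_mem _
    · rw [ihd e he] at hx
      exact Submodule.span_mono (Set.image_mono fun m hm => le_trans hm he.le) hx
  apply le_antisymm
  -- An inner induction on the length is needed as well: a commutator may contain generators of full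
  -- weight `w i + w j`, and weights may be zero. Such a term shortens the word without making it
  -- lighter.
  · have key : ∀ n : ℕ, ∀ l : List I, l.length ≤ n → (l.map w).sum ≤ d → (l.map g).prod ∈ S d := by
      intro n
      induction n with
      | zero =>
        intro l hl _
        obtain rfl : l = [] := List.length_eq_zero_iff.1 (Nat.le_zero.1 hl)
        exact Submodule.subset_span ⟨0, by simp, by simp [sortedMonomial]⟩
      | succ n ih =>
        -- The cost of interchanging two neighbouring letters: the lower part of the commutator
        -- falls under `hprev`, the linear part replaces two letters by one.
        have swap : ∀ (l₁ l₂ : List I) (i j : I), (l₁ ++ i :: j :: l₂).length ≤ n + 1 →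
            ((l₁ ++ i :: j :: l₂).map w).sum ≤ d →
            (l₁.map g).prod * (g i * g j - g j * g i) * (l₂.map g).prod ∈ S d := by
          intro l₁ l₂ i j hl hw
          simp only [List.length_append, List.length_cons] at hl
          simp only [List.map_append, List.map_cons, List.sum_append, List.sum_cons] at hw
          obtain ⟨y, hy, z, hz, hyz⟩ := Submodule.mem_sup.1 (hcomm i j)
          rw [← hyz, mul_add, add_mul]
          refine add_mem (hprev ?_) ?_
          · have h1 := 𝓕.mul_mem_prev_left
              (𝓕.mul_mem_prev_right (weightFiltration_word_mem g w l₁) hy)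
              (weightFiltration_word_mem g w l₂)
            rcases 𝓕.mem_prev_iff.1 h1 with h0 | ⟨e, he, h1⟩
            · rw [h0]
              exact zero_mem _
            · exact 𝓕.le_prev (by omega) h1
          · clear hyz
            induction hz using Submodule.span_induction with
            | mem z hz =>
              obtain ⟨p, hp, rfl⟩ := hz
              have := ih (l₁ ++ p :: l₂) (by simp; omega) (by
                have : w p ≤ w i + w j := hp
                simp
                omega)
              simpa [mul_assoc] using this
            | zero => simp
            | add x y _ _ hx hy => rw [mul_add, add_mul]; exact add_mem hx hy
            | smul c x _ hx =>
              rw [mul_smul_comm, smul_mul_assoc]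
              exact Submodule.smul_mem _ _ hx
        -- Permutations are generated by such interchanges. The prefix `l₁` is kept general so that
        -- the `cons` case can absorb the fixed first letter into it.
        have perm : ∀ l l' : List I, l.Perm l' → ∀ l₁ : List I, (l₁ ++ l).length ≤ n + 1 →
            ((l₁ ++ l).map w).sum ≤ d →
            (l₁.map g).prod * ((l.map g).prod - (l'.map g).prod) ∈ S d := by
          intro l l' h
          induction h with
          | nil => intros; simp
          | cons x h ih' =>
            intro l₁ hl hw
            have := ih' (l₁ ++ [x]) (by simpa using hl) (by simpa using hw)
            simpa [mul_assoc, mul_sub] using this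
          | swap x y l =>
            intro l₁ hl hw
            have := swap l₁ l y x hl hw
            simpa [mul_assoc, mul_sub, sub_mul] using this
          | trans h₁ h₂ ih₁ ih₂ =>
            intro l₁ hl hw
            have := add_mem (ih₁ l₁ hl hw) (ih₂ l₁
              (by simpa [h₁.length_eq] using hl) (by simpa [(h₁.map w).sum_eq] using hw))
            rwa [← mul_add, sub_add_sub_cancel] at this
        intro l hl hw
        have h1 := perm l ((l : Multiset I).sort (· ≤ ·))
          (by rw [← Multiset.coe_eq_coe, Multiset.sort_eq]) [] (by simpa using hl) (by simpa using hw)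
        have h2 : sortedMonomial g (l : Multiset I) ∈ S d :=
          Submodule.subset_span ⟨l, by simpa using hw, rfl⟩
        have := add_mem h1 h2
        rwa [List.map_nil, List.prod_nil, one_mul, sortedMonomial, sub_add_cancel] at this
    refine Submodule.span_le.2 ?_
    rintro _ ⟨l, hl, rfl⟩
    exact key _ l le_rfl hl
  · refine Submodule.span_le.2 ?_
    rintro _ ⟨m, hm, rfl⟩
    exact 𝓕.mono hm (sortedMonomial_mem g w m)

/-- Products of generators span, and each of them lies in some term of the filtration. With `w = 0`
the hypothesis says that commutators of generators are linear combinations of generators; in this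
form it applies to enveloping algebras and to polynomial rings. -/
theorem span_sortedMonomial_eq_top (g : I → A) (w : I → ℕ)
    (hcomm : ∀ i j, g i * g j - g j * g i ∈ (weightFiltration k g w).prev (w i + w j) ⊔
      Submodule.span k (g '' {l | w l ≤ w i + w j}))
    (hg : Algebra.adjoin k (Set.range g) = ⊤) :
    Submodule.span k (Set.range (sortedMonomial g)) = ⊤ := by
  refine eq_top_iff.2 fun x _ => ?_
  have hx : x ∈ Submodule.span k (Submonoid.closure (Set.range g) : Set A) := by
    rw [← Algebra.adjoin_eq_span, hg]
    trivial
  refine Submodule.span_le.2 ?_ hx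
  intro y hy
  obtain ⟨l, hl, rfl⟩ := Submonoid.exists_list_of_mem_closure hy
  obtain ⟨l, rfl⟩ : ∃ l' : List I, l'.map g = l := by
    clear hy
    induction l with
    | nil => exact ⟨[], rfl⟩
    | cons a l ih =>
      obtain ⟨l', h⟩ := ih fun y hy => hl y (List.mem_cons_of_mem _ hy)
      obtain ⟨i, hi⟩ := hl a List.mem_cons_self
      exact ⟨i :: l', by simp [h, hi]⟩
  have := weightFiltration_word_mem (k := k) g w l
  rw [weightFiltration_eq_span g w hcomm] at this
  exact Submodule.span_mono (Set.image_subset_range _ _) this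

/-! ### Leading coefficients -/

/-- A linear relation between ordered monomials yields a linear relation between the ordered
monomials in the leading coefficients. -/
theorem exists_relation_leadingCoeff {B : Type*} [Ring B] [Algebra k B] (φ : A →ₐ[k] B[X])
    (g : I → A) (w : I → ℕ) (hdeg : ∀ i, (φ (g i)).natDegree ≤ w i) {c : Multiset I →₀ k}
    (hc : c ≠ 0) (h : (c.sum fun m a => a • sortedMonomial g m) = 0) :
    ∃ c' : Multiset I →₀ k, c' ≠ 0 ∧ c'.support ⊆ c.support ∧
      (c'.sum fun m a => a • sortedMonomial (fun i => (φ (g i)).coeff (w i)) m) = 0 := by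
  classical
  -- The new relation is the part of largest weight `d` of the old one. It is nonzero because `m₀`
  -- occurs in it.
  obtain ⟨m₀, hm₀, hmax⟩ := Finset.exists_max_image c.support (fun m => (m.map w).sum)
    (Finsupp.support_nonempty_iff.2 hc)
  set d := (m₀.map w).sum with hd
  refine ⟨c.filter fun m => (m.map w).sum = d, fun h0 => ?_, ?_, ?_⟩
  · have := DFunLike.congr_fun h0 m₀
    rw [Finsupp.filter_apply_pos (fun m : Multiset I => (m.map w).sum = d) c hd.symm] at this
    exact (Finsupp.mem_support_iff.1 hm₀) this
  · rw [Finsupp.support_filter]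
    exact Finset.filter_subset _ _
  -- Take the coefficient at `d` of the image of the relation: monomials of weight `d` contribute
  -- the products of their leading coefficients, lighter ones have degree less than `d`.
  · have h1 := congrArg (fun p : B[X] => p.coeff d) (congrArg φ h)
    simp only [Finsupp.sum, map_sum, map_smul, map_zero, Polynomial.finsetSum_coeff,
      Polynomial.coeff_smul, Polynomial.coeff_zero, map_sortedMonomial] at h1
    rw [Finsupp.sum, Finsupp.support_filter, Finset.sum_filter]
    refine Eq.trans ?_ h1
    refine Finset.sum_congr rfl fun m hm => ?_
    have hl := natDegree_list_prod_le_and_coeff (fun i => φ (g i)) w hdeg (m.sort (· ≤ ·))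
    rw [sum_map_sort] at hl
    split_ifs with hmd
    · rw [Finsupp.filter_apply_pos (fun m : Multiset I => (m.map w).sum = d) c hmd, ← hmd]
      exact congrArg _ hl.2.symm
    · have hlt : (m.map w).sum < d := lt_of_le_of_ne (hmax m hm) hmd
      rw [sortedMonomial, Polynomial.coeff_eq_zero_of_natDegree_lt (hl.1.trans_lt hlt), smul_zero]

/-! ### Symbols of ordered monomials -/

/-- The class of an ordered monomial in the associated graded algebra. -/
noncomputable def sortedSymb (k : Type*) [CommRing k] [Algebra k A] (g : I → A) (w : I → ℕ)
    (m : Multiset I) : (weightFiltration k g w).Gr :=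
  (weightFiltration k g w).symb (m.map w).sum ⟨sortedMonomial g m, sortedMonomial_mem g w m⟩

theorem sortedSymb_eq (g : I → A) (w : I → ℕ) (m : Multiset I) :
    sortedSymb k g w m = sortedMonomial (fun i => (weightFiltration k g w).symb (w i)
          ⟨g i, mem_weightFiltration g w i⟩) m := by
  rw [sortedMonomial, ← symb_word]
  exact (weightFiltration k g w).symb_congr (sum_map_sort w m).symm _ _ rfl

/-- `F d` is spanned by ordered monomials of weight at most `d`, and those of weight less than `d`
vanish in degree `d`. -/
theorem span_sortedSymb (g : I → A) (w : I → ℕ)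
    (hcomm : ∀ i j, g i * g j - g j * g i ∈ (weightFiltration k g w).prev (w i + w j) ⊔
      Submodule.span k (g '' {l | w l ≤ w i + w j})) :
    Submodule.span k (Set.range (sortedSymb k g w)) = ⊤ := by
  refine eq_top_iff.2 fun x _ => ?_
  induction x using (weightFiltration k g w).gr_induction with
  | zero => exact zero_mem _
  | add x y hx hy => exact add_mem (hx trivial) (hy trivial)
  | symb d x =>
    obtain ⟨x, hx⟩ := x
    have hx' := hx
    rw [weightFiltration_eq_span g w hcomm] at hx'
    refine Submodule.span_induction (p := fun x _ => ∀ hx : x ∈ (weightFiltration k g w).F d,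
      (weightFiltration k g w).symb d ⟨x, hx⟩ ∈ _) ?_ ?_ ?_ ?_ hx' hx
    · rintro _ ⟨m, hm, rfl⟩ hx
      rcases (show (m.map w).sum ≤ d from hm).lt_or_eq with hm | rfl
      · rw [AlgFiltration.symb_eq_zero _ _ (AlgFiltration.le_prev _ hm (sortedMonomial_mem g w m))]
        exact zero_mem _
      · exact Submodule.subset_span ⟨m, rfl⟩
    · intro hx
      have : (⟨0, hx⟩ : (weightFiltration k g w).F d) = 0 := rfl
      rw [this, map_zero]
      exact zero_mem _
    · intro x y h1 h2 ih1 ih2 hxy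
      rw [← weightFiltration_eq_span g w hcomm] at h1 h2
      have := add_mem (ih1 h1) (ih2 h2)
      rwa [← map_add] at this
    · intro c x h ih hx
      rw [← weightFiltration_eq_span g w hcomm] at h
      have := Submodule.smul_mem _ c (ih h)
      rwa [← map_smul] at this

/-- A relation between symbols in degree `d` says that a combination of ordered monomials of weight
`d` lies in the previous term of the filtration. That term is itself spanned by ordered monomials of
weight less than `d`, so independence of all ordered monomials forces the combination to be trivial.
-/
theorem linearIndependent_sortedSymb (g : I → A) (w : I → ℕ)
    (hcomm : ∀ i j, g i * g j - g j * g i ∈ (weightFiltration k g w).prev (w i + w j) ⊔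
      Submodule.span k (g '' {l | w l ≤ w i + w j}))
    (hli : LinearIndependent k (sortedMonomial g)) :
    LinearIndependent k (sortedSymb k g w) := by
  classical
  rw [linearIndependent_iff]
  intro c hc
  set 𝓕 := weightFiltration k g w with h𝓕
  rw [Finsupp.linearCombination_apply, Finsupp.sum] at hc
  ext m₀
  set d := (m₀.map w).sum with hd
  set c' := c.filter fun m => (m.map w).sum = d with hc'
  have h1 : DirectSum.component k ℕ 𝓕.Piece d (∑ m ∈ c.support, c m • sortedSymb k g w m) = 0 := by
    rw [hc, map_zero]
  have h2 : Finsupp.linearCombination k (sortedMonomial g) c' ∈ 𝓕.F d := by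
    rw [Finsupp.linearCombination_apply, Finsupp.sum]
    refine sum_mem fun m hm => Submodule.smul_mem _ _ ?_
    rw [hc', Finsupp.support_filter, Finset.mem_filter] at hm
    rw [← hm.2]
    exact sortedMonomial_mem g w m
  have h3 : DirectSum.component k ℕ 𝓕.Piece d (∑ m ∈ c.support, c m • sortedSymb k g w m)
      = 𝓕.cls d ⟨_, h2⟩ := by
    -- The test on the weight is what allows each monomial to be regarded as an element of `F d`.
    have h4 : (⟨_, h2⟩ : 𝓕.F d) = ∑ m ∈ c.support, if hm : (m.map w).sum = d then
        c m • (⟨sortedMonomial g m, hm ▸ sortedMonomial_mem g w m⟩ : 𝓕.F d) else 0 := by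
      refine Subtype.ext ?_
      rw [AddSubmonoidClass.coe_finsetSum]
      simp only [Finsupp.linearCombination_apply, Finsupp.sum, hc', Finsupp.support_filter,
        Finset.sum_filter]
      refine Finset.sum_congr rfl fun m _ => ?_
      split_ifs with hm
      · rw [Finsupp.filter_apply_pos (fun m : Multiset I => (m.map w).sum = d) c hm]
        rfl
      · rfl
    rw [h4, map_sum, map_sum]
    refine Finset.sum_congr rfl fun m _ => ?_
    split_ifs with hm
    · rw [map_smul, map_smul]
      congr 1
      have : sortedSymb k g w m = 𝓕.symb d ⟨sortedMonomial g m, hm ▸ sortedMonomial_mem g w m⟩ :=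
        𝓕.symb_congr hm _ _ rfl
      rw [this, AlgFiltration.symb, LinearMap.comp_apply, DirectSum.component.lof_self]
    · rw [map_smul, map_zero, sortedSymb, AlgFiltration.symb, LinearMap.comp_apply,
        DirectSum.component.of, dif_neg hm, smul_zero]
  rw [h3, 𝓕.cls_eq_zero] at h1
  have h5 : c' = 0 := by
    -- Rewrite the combination by lighter monomials. The two coefficient vectors then agree by
    -- independence, although one is supported in weights below `d` and the other in weight `d`;
    -- hence both vanish. For `d = 0` the previous term is zero and the empty combination serves.
    have h6 : ∃ c'' : Multiset I →₀ k, (∀ m ∈ c''.support, (m.map w).sum < d) ∧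
        Finsupp.linearCombination k (sortedMonomial g) c''
          = Finsupp.linearCombination k (sortedMonomial g) c' := by
      rcases 𝓕.mem_prev_iff.1 h1 with h0 | ⟨e, he, h⟩
      · exact ⟨0, by simp, by rw [map_zero]; exact h0.symm⟩
      · have h := (weightFiltration_eq_span g w hcomm e).le h
        rw [Finsupp.mem_span_image_iff_linearCombination] at h
        obtain ⟨c'', h, h'⟩ := h
        exact ⟨c'', fun m hm => lt_of_le_of_lt ((Finsupp.mem_supported _ _).1 h hm) he, h'⟩
    obtain ⟨c'', hlt, heq⟩ := h6
    have := hli heq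
    ext m
    by_cases hm : (m.map w).sum = d
    · rw [← this]
      by_contra hne
      exact absurd (hlt m (Finsupp.mem_support_iff.2 hne)) (by omega)
    · rw [hc', Finsupp.filter_apply_neg (fun m : Multiset I => (m.map w).sum = d) c hm]
      rfl
  have := DFunLike.congr_fun h5 m₀
  rwa [hc', Finsupp.filter_apply_pos (fun m : Multiset I => (m.map w).sum = d) c hd.symm] at this

end OrderedMonomials

/-! ### Products of evaluation representations -/

/-- The two end terms are distinct since the total is positive. `H` is left arbitrary because
"negligible" has two meanings below: polynomials of small degree, and the kernel of a symbol map on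
the tensor square. -/
theorem Finset.sum_antidiagonal_succ_sub_mem {M S : Type*} [AddCommGroup M] [SetLike S M]
    [AddSubgroupClass S M] (H : S) (r : ℕ) (f : ℕ × ℕ → M)
    (hf : ∀ p q, p + 1 + (q + 1) = r + 1 → f (p + 1, q + 1) ∈ H) :
    ∑ p ∈ Finset.HasAntidiagonal.antidiagonal (r + 1), f p - (f (r + 1, 0) + f (0, r + 1)) ∈ H := by
  rcases r with _ | r
  · rw [Finset.Nat.antidiagonal_succ]
    simp [add_comm]
  · rw [Finset.Nat.antidiagonal_succ_succ', Finset.sum_cons, Finset.sum_cons, Finset.sum_map]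
    have : ∑ p ∈ Finset.HasAntidiagonal.antidiagonal r, f (p.1 + 1, p.2 + 1) ∈ H :=
      sum_mem fun p hp => hf _ _ (by
        rw [Finset.HasAntidiagonal.mem_antidiagonal] at hp
        omega)
    convert this using 1
    change f (0, r + 2) + (f (r + 2, 0)
      + ∑ p ∈ Finset.HasAntidiagonal.antidiagonal r, f (p.1 + 1, p.2 + 1))
        - (f (r + 2, 0) + f (0, r + 2)) = _
    abel

/-- Matrix coefficients of the product of two series with constant term `1`: up to mixed terms,
they are the sums of the coefficients of the factors. -/
theorem convFamily_succ_sub_mem {N : ℕ} {A S : Type*} [Ring A] [SetLike S A] [AddSubgroupClass S A]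
    (H : S) {t t' : Fin N → Fin N → ℕ → A}
    (ht : ∀ i j, t i j 0 = if i = j then 1 else 0) (ht' : ∀ i j, t' i j 0 = if i = j then 1 else 0)
    (i j : Fin N) (r : ℕ)
    (h : ∀ a p q, p + 1 + (q + 1) = r + 1 → t i a (p + 1) * t' a j (q + 1) ∈ H) :
    convFamily t t' i j (r + 1) - (t i j (r + 1) + t' i j (r + 1)) ∈ H := by
  have := sum_mem (t := Finset.univ) (B := S) (S := H) fun a _ =>
    Finset.sum_antidiagonal_succ_sub_mem H r (fun p => t i a p.1 * t' a j p.2) (h a)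
  simpa [Finset.sum_sub_distrib, Finset.sum_add_distrib, ht, ht', convFamily] using this

section Evaluation

variable {N : ℕ} {B : Type*} [Ring B]

/-- The family of the evaluation representation at the point `z`,
`T (u) = 1 + E / (u - z)`. -/
def evalFamily (E : Fin N → Fin N → B) (z : B) (i j : Fin N) : ℕ → B
  | 0 => if i = j then 1 else 0
  | r + 1 => z ^ r * E i j

/-- For positive upper indices both sides of the defining relation vanish, since its terms depend
only on the sum of the exponents of `z`. The commutation relations of `gl_N` enter only when one
index is `0`. -/
theorem isYangianFamily_evalFamily {E : Fin N → Fin N → B} {z : B} (hz : ∀ b, z * b = b * z)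
    (hE : ∀ i j k l, E i j * E k l - E k l * E i j
      = (if k = j then E i l else 0) - if i = l then E k j else 0) :
    IsYangianFamily (evalFamily E z) where
  zero _ _ := rfl
  rel i j k l r s := by
    have hzp : ∀ n b, b * z ^ n = z ^ n * b := fun n b =>
      ((show Commute z b from hz b).pow_left n).eq.symm
    have h : ∀ p q i j k l, (z ^ p * E i j) * (z ^ q * E k l) = z ^ (p + q) * (E i j * E k l) := by
      intro p q i j k l
      rw [mul_assoc, ← mul_assoc (E i j), hzp, pow_add]
      simp only [mul_assoc]
    rcases r with _ | r <;> rcases s with _ | s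
    · simp only [evalFamily]
      split_ifs <;> simp
    · simp only [evalFamily, h, zero_add, Nat.add_zero, ← mul_sub, hE]
      split_ifs <;> simp [mul_sub]
    · simp only [evalFamily, h, zero_add, Nat.add_zero, ← mul_sub]
      have := hE i j k l
      rw [sub_eq_iff_eq_add] at this
      rw [this]
      split_ifs <;> simp [mul_sub]
    · simp only [evalFamily, h]
      rw [show r + 1 + s = r + (s + 1) by omega, show s + r = r + s by omega,
        show s + (r + 1) = r + (s + 1) by omega, show s + 1 + r = r + (s + 1) by omega, sub_self,
        sub_self]

variable {K : Type*}

/-- The product of the evaluation families for the members of a list. -/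
def listFamily (E : K → Fin N → Fin N → B) (z : K → B) : List K → Fin N → Fin N → ℕ → B
  | [] => fun i j r => if r = 0 then (if i = j then 1 else 0) else 0
  | κ :: l => convFamily (evalFamily (E κ) (z κ)) (listFamily E z l)

theorem commute_convFamily {t t' : Fin N → Fin N → ℕ → B} {b : B}
    (h : ∀ i j r, Commute b (t i j r)) (h' : ∀ i j r, Commute b (t' i j r)) (i j : Fin N) (r : ℕ) :
    Commute b (convFamily t t' i j r) :=
  Commute.sum_right _ _ _ fun _ _ => Commute.sum_right _ _ _ fun _ _ => (h _ _ _).mul_right (h' _ _ _)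

theorem commute_evalFamily {E : Fin N → Fin N → B} {z b : B} (hz : Commute b z)
    (h : ∀ i j, Commute b (E i j)) (i j : Fin N) (r : ℕ) : Commute b (evalFamily E z i j r) := by
  rcases r with _ | r
  · simp only [evalFamily]
    split_ifs <;> simp
  · exact (hz.pow_right r).mul_right (h i j)

theorem commute_listFamily {E : K → Fin N → Fin N → B} {z : K → B} (hz : ∀ κ b, z κ * b = b * z κ)
    {b : B} {l : List K} (h : ∀ κ ∈ l, ∀ i j, Commute b (E κ i j)) (i j : Fin N) (r : ℕ) :
    Commute b (listFamily E z l i j r) := by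
  induction l generalizing i j r with
  | nil =>
    simp only [listFamily]
    split_ifs <;> simp
  | cons κ l ih =>
    exact commute_convFamily (commute_evalFamily (hz κ b).symm (h κ List.mem_cons_self))
      (ih fun κ' hκ' => h κ' (List.mem_cons_of_mem _ hκ')) i j r

/-- A product of two Yangian families with mutually commuting entries is again one. The list must
have no repetitions because a copy of `gl_N` does not commute with itself. -/
theorem isYangianFamily_listFamily {E : K → Fin N → Fin N → B} {z : K → B}
    (hz : ∀ κ b, z κ * b = b * z κ)
    (hE : ∀ κ i j k l, E κ i j * E κ k l - E κ k l * E κ i j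
      = (if k = j then E κ i l else 0) - if i = l then E κ k j else 0)
    (hcomm : ∀ κ κ', κ ≠ κ' → ∀ i j k l, Commute (E κ i j) (E κ' k l))
    {l : List K} (hl : l.Nodup) : IsYangianFamily (listFamily E z l) := by
  induction l with
  | nil =>
    refine ⟨fun _ _ => rfl, fun i j k l r s => ?_⟩
    simp only [listFamily, Nat.succ_ne_zero, if_false, zero_mul, mul_zero, sub_zero]
    by_cases hr : r = 0 <;> by_cases hs : s = 0 <;> simp [hr, hs]
  | cons κ l ih =>
    rw [List.nodup_cons] at hl
    refine (isYangianFamily_evalFamily (hz κ) (hE κ)).conv (ih hl.2) fun i j r i' j' s => ?_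
    refine commute_listFamily hz (fun κ' hκ' k l => ?_) i' j' s
    refine (commute_evalFamily (hz κ _).symm (fun i j => ?_) i j r).symm
    exact hcomm κ' κ (fun h => hl.1 (h ▸ hκ')) _ _ _ _

open Polynomial in
/-- The coefficients of the product of the evaluation families at points `c κ • X` are polynomials
with known leading terms. -/
theorem listFamily_sub_monomial_mem (E : K → Fin N → Fin N → B) (c : K → B) (l : List K) (i j : Fin N)
    (r : ℕ) :
    listFamily (fun κ i j => C (E κ i j)) (fun κ => C (c κ) * X) l i j (r + 1)
      - monomial r (l.map fun κ => c κ ^ r * E κ i j).sum ∈ degreeLT B r := by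
  -- The mixed terms in a product of two series involve lower coefficients of both factors, whose
  -- degrees must be known already; hence the strong induction on `r` around the induction on the
  -- list.
  induction r using Nat.strong_induction_on generalizing l i j with
  | _ r ihr =>
  have hev : ∀ κ i j r, evalFamily (fun i j => C (E κ i j)) (C (c κ) * X) i j (r + 1)
      = monomial r (c κ ^ r * E κ i j) := by
    intro κ i j r
    rw [evalFamily, ((show Commute (C (c κ)) X from (commute_X _).symm)).mul_pow, ← C_pow, mul_assoc,
      X_pow_mul, ← mul_assoc, ← C_mul, C_mul_X_pow_eq_monomial]
  have hlt : ∀ p, p < r → ∀ l i j,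
      listFamily (fun κ i j => C (E κ i j)) (fun κ => C (c κ) * X) l i j (p + 1)
        ∈ degreeLE B p := by
    intro p hp l i j
    have := add_mem (degreeLT_mono (Nat.le_succ p) (ihr p hp l i j))
      (show monomial p (l.map fun κ => c κ ^ p * E κ i j).sum ∈ degreeLT B (p + 1) from
        mem_degreeLT.2 ((degree_monomial_le _ _).trans_lt (by exact_mod_cast Nat.lt_succ_self p)))
    rw [sub_add_cancel, mem_degreeLT, degree_lt_iff_coeff_zero] at this
    rw [mem_degreeLE, degree_le_iff_coeff_zero]
    exact fun n hn => this n (by exact_mod_cast hn)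
  induction l with
  | nil => simp [listFamily]
  | cons κ l ih =>
    have h0 : ∀ i j, listFamily (fun κ i j => C (E κ i j)) (fun κ => C (c κ) * X) l i j 0
        = if i = j then 1 else 0 := by
      clear ih
      induction l with
      | nil => intros; rfl
      | cons κ l ih => exact convFamily_zero (fun _ _ => rfl) ih
    -- A mixed term with upper indices `p + 1` and `q + 1`, where `p + q + 1 = r`, has degree at
    -- most `p + q < r` and does not affect the coefficient at `r`.
    have := convFamily_succ_sub_mem (degreeLT B r) (fun _ _ => rfl) h0 i j r
      (t := evalFamily (fun i j => C (E κ i j)) (C (c κ) * X)) (fun a p q hpq => by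
        rw [hev, mem_degreeLT]
        refine (degree_mul_le _ _).trans_lt ?_
        have h1 := degree_monomial_le p (c κ ^ p * E κ i a)
        have h2 := mem_degreeLE.1 (hlt q (by omega) l a j)
        refine (add_le_add h1 h2).trans_lt ?_
        exact_mod_cast (by omega : p + q < r))
    have := add_mem this ih
    rw [hev] at this
    convert this using 1
    rw [listFamily, List.map_cons, List.sum_cons, map_add]
    abel

end Evaluation

/-! ### Differential operators -/

/-- In a Weyl algebra the elements `x i * p j` satisfy the relations of `gl_N`. -/
theorem weyl_gl_relation {B σ : Type*} [Ring B] [DecidableEq σ] {x p : σ → B}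
    (hx : ∀ s t, x s * x t = x t * x s) (hp : ∀ s t, p s * p t = p t * p s)
    (hpx : ∀ s t, p s * x t = x t * p s + if t = s then 1 else 0) (i j k l : σ) :
    x i * p j * (x k * p l) - x k * p l * (x i * p j)
      = (if k = j then x i * p l else 0) - if i = l then x k * p j else 0 := by
  have h : ∀ i j k l, x i * p j * (x k * p l)
      = x i * x k * (p j * p l) + if k = j then x i * p l else 0 := by
    intro i j k l
    rw [mul_assoc, ← mul_assoc (p j), hpx, add_mul, mul_add]
    split_ifs <;> simp [mul_assoc]
  rw [h, h, hx k i, hp l j]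
  abel

theorem weyl_commute {B σ : Type*} [Ring B] [DecidableEq σ] {x p : σ → B}
    (hx : ∀ s t, x s * x t = x t * x s) (hp : ∀ s t, p s * p t = p t * p s)
    (hpx : ∀ s t, p s * x t = x t * p s + if t = s then 1 else 0) {i j k l : σ} (hkj : k ≠ j)
    (hil : i ≠ l) : Commute (x i * p j) (x k * p l) := by
  have := weyl_gl_relation hx hp hpx i j k l
  rw [if_neg hkj, if_neg hil, sub_zero] at this
  exact sub_eq_zero.1 this

namespace MvPolynomial

variable {σ S : Type*} [CommRing S]

/-- The commutator of two derivations is a derivation, and this one kills the variables because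
first derivatives of variables are constants. -/
theorem pderiv_pderiv_comm (i j : σ) (f : MvPolynomial σ S) :
    pderiv i (pderiv j f) = pderiv j (pderiv i f) := by
  classical
  have : ⁅(pderiv i : Derivation S (MvPolynomial σ S) _), pderiv j⁆ = 0 :=
    derivation_ext fun t => by
      rw [Derivation.commutator_apply]
      simp [pderiv_X, Pi.single_apply, apply_ite (pderiv i), apply_ite (pderiv j)]
  have := DFunLike.congr_fun this f
  rw [Derivation.commutator_apply] at this
  exact sub_eq_zero.1 this

/-- Multiplication by a variable, as an operator depending on a parameter. -/
noncomputable def varOp (S : Type*) [CommRing S] (s : σ) :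
    (Module.End S (MvPolynomial σ S))[X] :=
  Polynomial.C (Algebra.lmul S _ (X s))

/-- The operator `∂ / ∂ x_s + t y_s` depending on the parameter `t`. -/
noncomputable def derivOp (y : σ → S) (s : σ) : (Module.End S (MvPolynomial σ S))[X] :=
  Polynomial.C ((pderiv s : Derivation S (MvPolynomial σ S) _) : Module.End S (MvPolynomial σ S))
    + Polynomial.C (algebraMap S _ (y s)) * Polynomial.X

theorem varOp_comm (s t : σ) : varOp S s * varOp S t = varOp S t * varOp S s := by
  rw [varOp, varOp, ← Polynomial.C_mul, ← Polynomial.C_mul, ← map_mul, ← map_mul, mul_comm]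

/-- The summand `t y_s` is central, so adding it to `∂ / ∂ x_s` does not disturb the relations of
the Weyl algebra. Formally it is conjugation by the exponential of `t ∑ y_s x_s`. -/
theorem derivOp_varOp [DecidableEq σ] (y : σ → S) (s t : σ) :
    derivOp y s * varOp S t = varOp S t * derivOp y s + if t = s then 1 else 0 := by
  have h : ((pderiv s : Derivation S (MvPolynomial σ S) _) : Module.End S (MvPolynomial σ S))
      * Algebra.lmul S _ (X t) = Algebra.lmul S _ (X t)
        * ((pderiv s : Derivation S (MvPolynomial σ S) _) : Module.End S (MvPolynomial σ S))
        + if t = s then 1 else 0 := by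
    refine LinearMap.ext fun f => ?_
    rw [LinearMap.add_apply, Module.End.mul_apply, Module.End.mul_apply]
    simp only [Algebra.coe_lmul_eq_mul, LinearMap.mul_apply', Derivation.coeFn_coe,
      Derivation.leibniz, pderiv_X, smul_eq_mul, Pi.single_apply]
    rcases eq_or_ne t s with rfl | hts
    · simp
    · simp [hts]
  have h' : ∀ a : S, ∀ b : Module.End S (MvPolynomial σ S),
      Polynomial.C (algebraMap S _ a) * Polynomial.X * Polynomial.C b
        = Polynomial.C b * (Polynomial.C (algebraMap S _ a) * Polynomial.X) := by
    intro a b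
    rw [mul_assoc, Polynomial.X_mul_C, ← mul_assoc, ← mul_assoc, ← Polynomial.C_mul,
      ← Polynomial.C_mul, Algebra.commutes]
  rw [derivOp, varOp, add_mul, mul_add, ← Polynomial.C_mul, h, h', Polynomial.C_add,
    Polynomial.C_mul, apply_ite Polynomial.C, Polynomial.C_1, Polynomial.C_0]
  abel

theorem derivOp_comm (y : σ → S) (s t : σ) :
    derivOp y s * derivOp y t = derivOp y t * derivOp y s := by
  have h : Commute
      (Polynomial.C ((pderiv s : Derivation S (MvPolynomial σ S) _) :
        Module.End S (MvPolynomial σ S)))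
      (Polynomial.C ((pderiv t : Derivation S (MvPolynomial σ S) _) :
        Module.End S (MvPolynomial σ S))) := by
    rw [Commute, SemiconjBy, ← Polynomial.C_mul, ← Polynomial.C_mul]
    congr 1
    exact LinearMap.ext fun f => pderiv_pderiv_comm s t f
  have h' : ∀ (a : S) (b : (Module.End S (MvPolynomial σ S))[X]),
      Commute (Polynomial.C (algebraMap S _ a) * Polynomial.X) b := fun a b =>
    Commute.mul_left (by
      have : Polynomial.C (algebraMap S (Module.End S (MvPolynomial σ S)) a)
        = algebraMap S (Module.End S (MvPolynomial σ S))[X] a := rfl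
      rw [this]
      exact Algebra.commutes a b) (Polynomial.commute_X b)
  exact ((h.add_right (h' _ _).symm).add_left (h' _ _)).eq

/-- This is the purpose of the shift: in the leading coefficient with respect to `t` the derivative
disappears, leaving multiplication operators, which commute and contain the scalars `y` that are
still free to be chosen. -/
theorem varOp_mul_derivOp (y : σ → S) (s t : σ) :
    (varOp S s * derivOp y t).natDegree ≤ 1 ∧
      (varOp S s * derivOp y t).coeff 1 = Algebra.lmul S _ (X s * C (y t)) := by
  constructor
  · refine (Polynomial.natDegree_C_mul_le _ _).trans ?_
    refine Polynomial.natDegree_add_le_of_degree_le ?_ ?_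
    · rw [Polynomial.natDegree_C]
      exact Nat.zero_le _
    · exact (Polynomial.natDegree_C_mul_le _ _).trans Polynomial.natDegree_X_le
  · rw [varOp, derivOp, Polynomial.coeff_C_mul, Polynomial.coeff_add, Polynomial.coeff_C_mul,
      Polynomial.coeff_X_one, Polynomial.coeff_C, if_neg one_ne_zero, zero_add, mul_one, map_mul]
    congr 1
    exact ((Algebra.lmul S (MvPolynomial σ S)).commutes (y t)).symm

end MvPolynomial

/-! ### Linear independence of the ordered monomials -/

/-- The nodes `0, …, M - 1` are distinct, so the Vandermonde matrix is invertible; `W` is the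
inverse of its transpose. -/
theorem vandermonde_dual (M : ℕ) : ∃ W : Fin M → Fin M → ℂ, ∀ r s : Fin M,
    ∑ a : Fin M, (a : ℂ) ^ (r : ℕ) * W a s = if r = s then 1 else 0 := by
  set V := (Matrix.vandermonde fun a : Fin M => (a : ℂ)).transpose with hV
  have hdet : IsUnit V.det := by
    rw [hV, Matrix.det_transpose, isUnit_iff_ne_zero, Matrix.det_vandermonde_ne_zero_iff]
    intro a b hab
    exact Fin.ext (Nat.cast_injective (R := ℂ) hab)
  refine ⟨(V⁻¹ : Matrix (Fin M) (Fin M) ℂ), fun r s => ?_⟩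
  have := congrFun (congrFun (Matrix.mul_nonsing_inv V hdet) r) s
  rw [Matrix.mul_apply, Matrix.one_apply] at this
  exact this

theorem MvPolynomial.eq_zero_of_sum_multiset {I : Type*} {c : Multiset I →₀ ℂ}
    (h : (c.sum fun m a => a • (m.map (MvPolynomial.X (R := ℂ))).prod) = 0) : c = 0 := by
  classical
  have hX : ∀ m : Multiset I, (m.map (MvPolynomial.X (R := ℂ))).prod
      = MvPolynomial.monomial (Multiset.toFinsupp m) 1 := by
    intro m
    induction m using Multiset.induction_on with
    | empty => simp
    | cons i m ih =>
      rw [Multiset.map_cons, Multiset.prod_cons, ih, MvPolynomial.X, MvPolynomial.monomial_mul,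
        mul_one, ← Multiset.singleton_add, map_add, Multiset.toFinsupp_singleton]
  ext m
  have := congrArg (MvPolynomial.coeff (Multiset.toFinsupp m)) h
  simp only [Finsupp.sum, hX, MvPolynomial.coeff_sum, MvPolynomial.coeff_smul,
    MvPolynomial.coeff_monomial, EmbeddingLike.apply_eq_iff_eq, MvPolynomial.coeff_zero,
    smul_eq_mul, mul_ite, mul_one, mul_zero, Finset.sum_ite_eq', Finsupp.mem_support_iff] at this
  simpa using this

namespace Yangian

variable {N : ℕ}

theorem gen_eq (x : YangianIndex N) : gen x = T x.i x.j (x.r.natPred + 1) := by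
  rw [gen, PNat.natPred_add_one]

/-- The leading terms of the generators with `r ≤ M` in a suitable representation are independent
variables. -/
theorem exists_leadingTerms (N M : ℕ) : ∃ (σ : Type) (_ : DecidableEq σ) (l : List σ)
    (c : σ → ℂ) (y : σ × Fin N → MvPolynomial (YangianIndex N) ℂ)
    (e : MvPolynomial (σ × Fin N) (MvPolynomial (YangianIndex N) ℂ) →ₐ[ℂ]
      MvPolynomial (YangianIndex N) ℂ), l.Nodup ∧
      ∀ x : YangianIndex N, x.r.natPred < M →
        e (l.map fun κ => c κ ^ x.r.natPred •
          (MvPolynomial.X (κ, x.i) * MvPolynomial.C (y (κ, x.j)))).sum = MvPolynomial.X x := by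
  obtain ⟨W, hW⟩ := vandermonde_dual M
  -- The copies of `gl_N` are indexed by pairs `κ = (a, m)`, with `c κ = a`. The variable `x_κi` is
  -- specialised to `1` if `m = i` and to `0` otherwise, and `y_κj` is the sum of `W a s` times the
  -- variable attached to `T_mj^(s+1)`. The sum over `m` then selects `m = i`, and the sum of `a ^ r
  -- * W a s` over `a` selects `s = r`.
  refine ⟨Fin M × Fin N, inferInstance, Finset.univ.toList, fun κ => (κ.1 : ℂ),
    fun s => ∑ r : Fin M, W s.1.1 r • MvPolynomial.X ⟨s.1.2, s.2, (r : ℕ).succPNat⟩,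
    (MvPolynomial.aeval (R := MvPolynomial (YangianIndex N) ℂ) fun s : (Fin M × Fin N) × Fin N =>
      (if s.1.2 = s.2 then 1 else 0 : MvPolynomial (YangianIndex N) ℂ)).restrictScalars ℂ,
    Finset.nodup_toList _, fun x hx => ?_⟩
  rw [Finset.sum_map_toList, map_sum]
  simp only [map_smul, map_mul, AlgHom.coe_restrictScalars', MvPolynomial.aeval_X,
    MvPolynomial.aeval_C, Algebra.algebraMap_self, RingHom.id_apply, Fintype.sum_prod_type, ite_mul,
    one_mul, zero_mul, smul_ite, smul_zero, Finset.sum_ite_eq', Finset.mem_univ, if_true,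
    Finset.smul_sum, smul_smul]
  rw [Finset.sum_comm]
  simp only [← Finset.sum_smul]
  have := hW ⟨x.r.natPred, hx⟩
  simp only at this
  simp only [this, ite_smul, one_smul, zero_smul, Finset.sum_ite_eq, Finset.mem_univ, if_true]
  rw [PNat.succPNat_natPred]

/-- The ring of operators on polynomials, depending polynomially on a parameter. -/
abbrev OperatorRing (σ S : Type*) [CommRing S] : Type _ := (Module.End S (MvPolynomial σ S))[X]

set_option maxSynthPendingDepth 6 in
/-- A linear relation between the ordered monomials in the generators yields a linear relation between
the monomials in the leading terms of the generators in a representation by differential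
operators. -/
theorem exists_relation_leadingTerms [LinearOrder (YangianIndex N)] {σ S : Type*} [CommRing S]
    [Algebra ℂ S] {l : List σ} (hl : l.Nodup) (c : σ → ℂ) (y : σ × Fin N → S)
    {c₀ : Multiset (YangianIndex N) →₀ ℂ} (hne : c₀ ≠ 0)
    (hc₀ : (c₀.sum fun m a => a • sortedMonomial gen m) = 0) :
    ∃ c₂ : Multiset (YangianIndex N) →₀ ℂ, c₂ ≠ 0 ∧ c₂.support ⊆ c₀.support ∧
      (c₂.sum fun m a => a • sortedMonomial (fun x : YangianIndex N =>
        (l.map fun κ => c κ ^ x.r.natPred • (MvPolynomial.X (κ, x.i) * MvPolynomial.C (y (κ, x.j)) :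
          MvPolynomial (σ × Fin N) S)).sum) m) = 0 := by
  classical
  -- Two parameters are in play: `t` is the polynomial variable inside `OperatorRing`, and `X` is
  -- the variable of polynomials over `OperatorRing`. The operators `E κ i j` involve only the
  -- first.
  set E : σ → Fin N → Fin N → OperatorRing (σ × Fin N) S := fun κ i j =>
    MvPolynomial.varOp S (κ, i) * MvPolynomial.derivOp y (κ, j) with hE
  set g₁ : YangianIndex N → OperatorRing (σ × Fin N) S := fun x =>
    (l.map fun κ => algebraMap ℂ (OperatorRing (σ × Fin N) S) (c κ) ^ x.r.natPred * E κ x.i x.j).sum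
    with hg₁
  set q : YangianIndex N → MvPolynomial (σ × Fin N) S := fun x =>
    (l.map fun κ => c κ ^ x.r.natPred •
      (MvPolynomial.X (κ, x.i) * MvPolynomial.C (y (κ, x.j)))).sum with hq
  have hrel := weyl_gl_relation (B := OperatorRing (σ × Fin N) S) (MvPolynomial.varOp_comm (S := S) (σ := σ × Fin N))
    (MvPolynomial.derivOp_comm y) (MvPolynomial.derivOp_varOp y)
  -- Different copies act on disjoint sets of variables, so no contraction occurs.
  have hcomm : ∀ κ κ', κ ≠ κ' → ∀ i j k l, Commute (E κ i j) (E κ' k l) := fun κ κ' h i j k l =>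
    weyl_commute (B := OperatorRing (σ × Fin N) S) (MvPolynomial.varOp_comm (S := S) (σ := σ × Fin N))
      (MvPolynomial.derivOp_comm y) (MvPolynomial.derivOp_varOp y)
      (fun h' => h (Prod.ext_iff.1 h').1.symm) (fun h' => h (Prod.ext_iff.1 h').1)
  have hfam : IsYangianFamily (listFamily (fun κ i j => Polynomial.C (E κ i j))
      (fun κ => Polynomial.C (algebraMap ℂ (OperatorRing (σ × Fin N) S) (c κ)) * Polynomial.X) l) := by
    refine isYangianFamily_listFamily (fun κ b => ?_) (fun κ i j k l => ?_)
      (fun κ κ' h i j k l => ?_) hl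
    · have h1 : Polynomial.C (algebraMap ℂ (OperatorRing (σ × Fin N) S) (c κ)) = algebraMap ℂ (OperatorRing (σ × Fin N) S)[X] (c κ) := rfl
      rw [h1]
      exact (Commute.mul_left (Algebra.commutes (c κ) b) (Polynomial.commute_X b)).eq
    · simp only [← Polynomial.C_mul, ← Polynomial.C_sub]
      rw [hrel]
      simp [apply_ite Polynomial.C, hE]
    · exact (hcomm κ κ' h i j k l).map Polynomial.C
  have h1 : ∀ x, (lift _ hfam (gen x)).natDegree ≤ x.r.natPred ∧
      (lift _ hfam (gen x)).coeff x.r.natPred = g₁ x := by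
    intro x
    rw [gen_eq, lift_T]
    have := listFamily_sub_monomial_mem E (fun κ => algebraMap ℂ (OperatorRing (σ × Fin N) S) (c κ)) l x.i x.j x.r.natPred
    rw [Polynomial.mem_degreeLT, Polynomial.degree_lt_iff_coeff_zero] at this
    constructor
    · rw [Polynomial.natDegree_le_iff_coeff_eq_zero]
      intro n hn
      have := this n hn.le
      rwa [Polynomial.coeff_sub, Polynomial.coeff_monomial, if_neg hn.ne, sub_zero] at this
    · have := this _ le_rfl
      rwa [Polynomial.coeff_sub, Polynomial.coeff_monomial, if_pos rfl, sub_eq_zero] at this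
  -- First passage, in the variable `X`, with weight `r - 1` for `T_ij^(r)`.
  obtain ⟨c₁, hne₁, hsub₁, hc₁⟩ := exists_relation_leadingCoeff (lift _ hfam) gen
    (fun x => x.r.natPred) (fun x => (h1 x).1) hne hc₀
  rw [funext fun x => (h1 x).2] at hc₁
  have h2 : ∀ x, (g₁ x).natDegree ≤ 1 ∧ (g₁ x).coeff 1 = Algebra.lmul S _ (q x) := by
    intro x
    simp only [hg₁, hq]
    clear hc₁ hfam hl h1 hg₁ hq g₁ q
    induction l with
    | nil => simp
    | cons κ l ih =>
      simp only [List.map_cons, List.sum_cons, ← map_pow, ← Algebra.smul_def] at ih ⊢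
      have := MvPolynomial.varOp_mul_derivOp y (κ, x.i) (κ, x.j)
      refine ⟨Polynomial.natDegree_add_le_of_degree_le
        ((Polynomial.natDegree_smul_le _ _).trans this.1) ih.1, ?_⟩
      rw [Polynomial.coeff_add, ih.2, map_add, Polynomial.coeff_smul, this.2]
      congr 1
      refine LinearMap.ext fun f => ?_
      simp only [LinearMap.smul_apply, Algebra.coe_lmul_eq_mul, LinearMap.mul_apply', smul_mul_assoc]
  -- Second passage, in the variable `t`. Every `g₁ x` has degree at most one, so the monomials are
  -- graded by their number of factors, and the homomorphism is the identity.
  obtain ⟨c₂, hne₂, hsub₂, hc₂⟩ := exists_relation_leadingCoeff (AlgHom.id ℂ (OperatorRing (σ × Fin N) S)) g₁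
    (fun _ => 1) (fun x => (h2 x).1) hne₁ hc₁
  have h3 : (fun x => Polynomial.coeff (AlgHom.id ℂ _ (g₁ x)) 1) = fun x => Algebra.lmul S _ (q x) :=
    funext fun x => (h2 x).2
  rw [h3] at hc₂
  refine ⟨c₂, hne₂, hsub₂.trans hsub₁, ?_⟩
  -- The relation is now between multiplication operators; applying them to `1` turns it into a
  -- relation between polynomials.
  have hc₃ := congrArg (fun f : Module.End S (MvPolynomial (σ × Fin N) S) => f 1) hc₂
  simp only [Finsupp.sum, LinearMap.sum_apply, LinearMap.zero_apply, LinearMap.smul_apply] at hc₃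
  rw [Finsupp.sum, ← hc₃]
  refine Finset.sum_congr rfl fun m hm => ?_
  rw [← map_sortedMonomial, Algebra.coe_lmul_eq_mul, LinearMap.mul_apply', mul_one]

/-- A nontrivial relation survives both passages to leading coefficients and then says that
monomials in independent variables are linearly dependent. As the final algebra is commutative, the
chosen order is irrelevant. -/
theorem linearIndependent_sortedMonomial_gen [LinearOrder (YangianIndex N)] :
    LinearIndependent ℂ (sortedMonomial (gen (N := N))) := by
  rw [linearIndependent_iff]
  intro c₀ hc₀
  by_contra hne
  rw [Finsupp.linearCombination_apply] at hc₀
  -- A relation involves finitely many generators, so finitely many evaluation points suffice. The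
  -- bound persists because the passages to leading coefficients never enlarge the support.
  obtain ⟨M, hM⟩ : ∃ M : ℕ, ∀ m ∈ c₀.support, ∀ x ∈ m, x.r.natPred < M := by
    refine ⟨c₀.support.sup (fun m => (m.map fun x => x.r.natPred).sum) + 1, fun m hm x hx => ?_⟩
    exact Nat.lt_succ_of_le ((Multiset.single_le_sum (fun _ _ => Nat.zero_le _) _
      (Multiset.mem_map_of_mem _ hx)).trans
        (Finset.le_sup (f := fun m : Multiset (YangianIndex N) =>
          (m.map fun x => x.r.natPred).sum) hm))
  obtain ⟨σ, _, l, c, y, e, hl, he⟩ := exists_leadingTerms N M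
  obtain ⟨c₂, hne₂, hsub, hc₂⟩ := exists_relation_leadingTerms hl c y hne hc₀
  refine hne₂ (MvPolynomial.eq_zero_of_sum_multiset ?_)
  have hc₃ := congrArg e hc₂
  simp only [Finsupp.sum, map_zero, map_sum, map_smul] at hc₃
  rw [Finsupp.sum, ← hc₃]
  refine Finset.sum_congr rfl fun m hm => ?_
  rw [map_sortedMonomial, sortedMonomial_comm]
  congr 2
  exact Multiset.map_congr rfl fun x hx => (he x (hM m (hsub hm) x hx)).symm

end Yangian

/-! ### Commutators of the generators -/

namespace Yangian

variable {N : ℕ}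

theorem T_mem_filt (i j : Fin N) (r : ℕ) : T i j r ∈ (filt N).F r := by
  cases r with
  | zero =>
    rw [T_zero]
    split_ifs
    · exact (filt N).one_mem
    · exact zero_mem _
  | succ r => exact mem_weightFiltration gen (fun x => (x.r : ℕ)) ⟨i, j, r.succPNat⟩

theorem T_zero_commute (i j : Fin N) (y : Yangian N) : T i j 0 * y - y * T i j 0 = 0 := by
  rw [T_zero]
  split_ifs <;> simp

/-- Each use of the defining relation lowers `r` by one and raises `s` by one, leaving products of
degree `r + s - 1` in the current indices. The process ends at `T_ij^(0)`, which is scalar; that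
case also covers the truncated subtraction. -/
theorem commutator_mem_filt (i j k l : Fin N) (r s : ℕ) :
    T i j r * T k l s - T k l s * T i j r ∈ (filt N).F (r + s - 1) := by
  induction r generalizing s with
  | zero =>
    rw [T_zero_commute]
    exact zero_mem _
  | succ r ih =>
    rw [sub_eq_iff_eq_add.1 ((isYangianFamily_T N).rel i j k l r s)]
    refine add_mem (sub_mem ?_ ?_) ?_
    · exact (filt N).mono (by omega) ((filt N).mul_mem (T_mem_filt k j r) (T_mem_filt i l s))
    · exact (filt N).mono (by omega) ((filt N).mul_mem (T_mem_filt k j s) (T_mem_filt i l r))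
    · exact (filt N).mono (by omega) (ih (s + 1))

/-- The same descent, now measured by `deg'`: the products left behind with both indices positive
have `deg'` one less than the commutator is allowed. Only the last step contributes, and it yields
the bracket of `gl_N[z]`. -/
theorem commutator_sub_mem_filt' (i j k l : Fin N) (r s : ℕ) :
    T i j (r + 1) * T k l (s + 1) - T k l (s + 1) * T i j (r + 1)
      - ((if k = j then T i l (r + s + 1) else 0) - if i = l then T k j (r + s + 1) else 0)
      ∈ (filt' N).prev (r + s) := by
  induction r generalizing s with
  | zero =>
    -- For index `0` the right-hand side contains the factors `T_kj^(0)` and `T_il^(0)`, that is,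
    -- the Kronecker deltas of the bracket.
    have := (isYangianFamily_T N).rel i j k l 0 (s + 1)
    rw [T_zero_commute, sub_zero] at this
    rw [this, T_zero, T_zero, zero_add]
    have h0 : ∀ a b : Yangian N, (if k = j then (1 : Yangian N) else 0) * a
        - b * (if i = l then (1 : Yangian N) else 0)
        - ((if k = j then a else 0) - if i = l then b else 0) = 0 := by
      intro a b
      split_ifs <;> simp
    rw [h0]
    exact zero_mem _
  | succ r ih =>
    have h := (isYangianFamily_T N).rel i j k l (r + 1) (s + 1)
    rw [sub_eq_iff_eq_add.1 h, add_sub_assoc]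
    refine add_mem (sub_mem ?_ ?_) ?_
    · exact (filt' N).le_prev (by omega)
        ((filt' N).mul_mem (T_mem_filt' k j (r + 1)) (T_mem_filt' i l (s + 1)))
    · exact (filt' N).le_prev (by omega)
        ((filt' N).mul_mem (T_mem_filt' k j (s + 1)) (T_mem_filt' i l (r + 1)))
    · rw [show r + 1 + s = r + (s + 1) by omega]
      exact ih (s + 1)

theorem gen_commutator_filt (x y : YangianIndex N) :
    gen x * gen y - gen y * gen x ∈ (filt N).prev (x.r + y.r) :=
  (filt N).le_prev (by have := x.r.pos; omega) (commutator_mem_filt x.i x.j y.i y.j x.r y.r)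

theorem gen_commutator_filt' (x y : YangianIndex N) :
    gen x * gen y - gen y * gen x
      - ((if y.i = x.j then gen ⟨x.i, y.j, (x.r.natPred + y.r.natPred).succPNat⟩ else 0)
        - if x.i = y.j then gen ⟨y.i, x.j, (x.r.natPred + y.r.natPred).succPNat⟩ else 0)
      ∈ (filt' N).prev (((x.r : ℕ) - 1) + ((y.r : ℕ) - 1)) := by
  have := commutator_sub_mem_filt' x.i x.j y.i y.j x.r.natPred y.r.natPred
  rwa [← gen_eq, ← gen_eq] at this

theorem gen_commutator_mem (x y : YangianIndex N) :
    gen x * gen y - gen y * gen x ∈ (filt N).prev (x.r + y.r) ⊔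
      Submodule.span ℂ (gen '' {z | (z.r : ℕ) ≤ x.r + y.r}) :=
  Submodule.mem_sup_left (gen_commutator_filt x y)

/-- For `deg'` the linear part of the straightening hypothesis is really used: commutators of
generators may have full weight, but then modulo lower terms they are linear in the generators. -/
theorem gen_commutator_mem' (x y : YangianIndex N) :
    gen x * gen y - gen y * gen x ∈ (filt' N).prev (((x.r : ℕ) - 1) + ((y.r : ℕ) - 1)) ⊔
      Submodule.span ℂ (gen '' {z | (z.r : ℕ) - 1 ≤ ((x.r : ℕ) - 1) + ((y.r : ℕ) - 1)}) := by
  refine Submodule.mem_sup.2 ⟨_, gen_commutator_filt' x y, _, ?_, sub_add_cancel _ _⟩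
  refine sub_mem ?_ ?_ <;> split_ifs
  · exact Submodule.subset_span ⟨_, (le_refl _ : x.r.natPred + y.r.natPred ≤ _), rfl⟩
  · exact zero_mem _
  · exact Submodule.subset_span ⟨_, (le_refl _ : x.r.natPred + y.r.natPred ≤ _), rfl⟩
  · exact zero_mem _

/-! ### The Poincaré–Birkhoff–Witt theorem -/

theorem existsUnique_sum_orderedMonomial [LinearOrder (YangianIndex N)] (y : Yangian N) :
    ∃! c : Multiset (YangianIndex N) →₀ ℂ, y = c.sum fun m a => a • orderedMonomial m := by
  have hspan := span_sortedMonomial_eq_top (k := ℂ) gen _ gen_commutator_mem (adjoin_eq_top N)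
  obtain ⟨c, hc⟩ := Finsupp.mem_span_range_iff_exists_finsupp.1
    (hspan ▸ Submodule.mem_top : y ∈ Submodule.span ℂ (Set.range (sortedMonomial gen)))
  refine ⟨c, hc.symm, fun c' hc' => ?_⟩
  exact linearIndependent_sortedMonomial_gen (hc'.symm.trans hc.symm)

/-! ### The first associated graded algebra -/

/-- The symbols of the generators generate the algebra, and they commute because commutators of
generators fall into the previous term of the filtration. -/
theorem gr_mul_comm (x y : (filt N).Gr) : x * y = y * x := by
  have hadj : ∀ d x, (filt N).symb d x ∈ Algebra.adjoin ℂ (Set.range (grGen (N := N))) := by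
    intro d x
    rw [← Subalgebra.mem_toSubmodule]
    refine Submodule.span_le.2 ?_
      (symb_mem_span_words gen (fun x : YangianIndex N => (x.r : ℕ)) d x)
    rintro _ ⟨l, -, rfl⟩
    refine (list_prod_mem fun z hz => ?_ : _ ∈ Algebra.adjoin ℂ (Set.range (grGen (N := N))))
    obtain ⟨x, -, rfl⟩ := List.mem_map.1 hz
    exact Algebra.subset_adjoin ⟨x, rfl⟩
  have htop : ∀ x : (filt N).Gr, x ∈ Algebra.adjoin ℂ (Set.range (grGen (N := N))) := by
    intro x
    induction x using (filt N).gr_induction with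
    | zero => exact zero_mem _
    | symb d x => exact hadj d x
    | add x y hx hy => exact add_mem hx hy
  have hgen : ∀ x y : YangianIndex N, grGen x * grGen y = grGen y * grGen x := by
    intro x y
    rw [grGen, grGen, AlgFiltration.symb_mul, AlgFiltration.symb_mul, ← sub_eq_zero,
      (filt N).symb_congr (add_comm (y.r : ℕ) x.r) _ ⟨gen y * gen x, by
        rw [add_comm]
        exact (filt N).mul_mem (mem_weightFiltration _ _ _) (mem_weightFiltration _ _ _)⟩ rfl,
      ← map_sub]
    exact (filt N).symb_eq_zero _ (gen_commutator_filt x y)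
  exact Algebra.commute_of_mem_adjoin_of_forall_mem_commute (htop y) (by
    rintro _ ⟨b, rfl⟩
    exact (Algebra.commute_of_mem_adjoin_of_forall_mem_commute (htop x) (by
      rintro _ ⟨a, rfl⟩
      exact hgen b a)).symm)

/-- Evaluation at the symbols of the generators carries the monomials in the variables to the
symbols of the ordered monomials, which form a basis. Any linear order on the generators can be
used. -/
theorem exists_algEquiv_gr (N : ℕ) : ∃ e : MvPolynomial (YangianIndex N) ℂ ≃ₐ[ℂ] (filt N).Gr,
    ∀ x, e (MvPolynomial.X x) = grGen x := by
  classical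
  let _ : LinearOrder (YangianIndex N) := linearOrderOfSTO WellOrderingRel
  -- Commutativity must be known beforehand for evaluation of polynomials to make sense.
  let _ : CommRing (filt N).Gr :=
    { (inferInstance : Ring (filt N).Gr) with mul_comm := gr_mul_comm }
  let f : MvPolynomial (YangianIndex N) ℂ →ₐ[ℂ] (filt N).Gr := MvPolynomial.aeval grGen
  have hf : ∀ m, f (sortedMonomial MvPolynomial.X m)
      = sortedSymb ℂ gen (fun x : YangianIndex N => (x.r : ℕ)) m := by
    intro m
    rw [map_sortedMonomial, sortedSymb_eq]
    congr 1
    exact funext fun x => MvPolynomial.aeval_X _ _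
  have hbij : Function.Bijective f := by
    refine LinearMap.bijective_of_comp_basis f.toLinearMap (sortedMonomial MvPolynomial.X)
      (span_sortedMonomial_eq_top _ (fun _ => 0) (fun x y => ?_) MvPolynomial.adjoin_range_X) ?_ ?_
    · rw [mul_comm, sub_self]
      exact zero_mem _
    · have := linearIndependent_sortedSymb (k := ℂ) gen (fun x : YangianIndex N => (x.r : ℕ))
        gen_commutator_mem linearIndependent_sortedMonomial_gen
      exact (funext hf : _ = sortedSymb ℂ gen (fun x : YangianIndex N => (x.r : ℕ))) ▸ this
    · have := span_sortedSymb (k := ℂ) gen (fun x : YangianIndex N => (x.r : ℕ)) gen_commutator_mem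
      exact (funext hf : _ = sortedSymb ℂ gen (fun x : YangianIndex N => (x.r : ℕ))) ▸ this
  exact ⟨AlgEquiv.ofBijective f hbij, fun x => MvPolynomial.aeval_X _ _⟩

end Yangian

/-! ### The second associated graded algebra -/

section Enveloping

attribute [local instance 100] LieRing.ofAssociativeRing

namespace GlCurrent

variable {N : ℕ}

/-- The basis element `E_ij z ^ (r - 1)` of the polynomial current Lie algebra. -/
noncomputable def unit (x : YangianIndex N) : GlCurrent N := elem (Matrix.single x.i x.j 1) ((x.r : ℕ) - 1)

/-- The indices of the generators of the Yangian as indices of a basis of the polynomial current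
Lie algebra. -/
def indexEquiv (N : ℕ) : ℕ × (Fin N × Fin N) ≃ YangianIndex N where
  toFun p := ⟨p.2.1, p.2.2, p.1.succPNat⟩
  invFun x := (x.r.natPred, (x.i, x.j))
  left_inv p := by simp
  right_inv x := by simp

/-- The standard basis of the polynomial current Lie algebra. -/
noncomputable def basis (N : ℕ) : Module.Basis (YangianIndex N) ℂ (GlCurrent N) :=
  (((Polynomial.basisMonomials ℂ).tensorProduct (Matrix.stdBasis ℂ (Fin N) (Fin N))).reindex
    (indexEquiv N) : Module.Basis (YangianIndex N) ℂ (ℂ[X] ⊗[ℂ] Matrix (Fin N) (Fin N) ℂ))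

theorem basis_apply (x : YangianIndex N) : basis N x = unit x := by
  have : basis N x = (((Polynomial.basisMonomials ℂ).tensorProduct
    (Matrix.stdBasis ℂ (Fin N) (Fin N))).reindex (indexEquiv N)) x := rfl
  rw [this, Module.Basis.reindex_apply, indexEquiv, Equiv.coe_fn_symm_mk,
    Module.Basis.tensorProduct_apply, Matrix.stdBasis_eq_single, Polynomial.coe_basisMonomials]
  exact congrArg (· ⊗ₜ[ℂ] Matrix.single x.i x.j (1 : ℂ)) (Polynomial.X_pow_eq_monomial _).symm

/-- The formula has the shape of the commutator formula for the `T̃_ij^(r)`, so that the two can be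
compared term by term. -/
theorem lie_unit (x y : YangianIndex N) : ⁅unit x, unit y⁆
    = (if y.i = x.j then unit ⟨x.i, y.j, (x.r.natPred + y.r.natPred).succPNat⟩ else 0)
      - if x.i = y.j then unit ⟨y.i, x.j, (x.r.natPred + y.r.natPred).succPNat⟩ else 0 := by
  have h : ∀ i j k l : Fin N, Matrix.single i j (1 : ℂ) * Matrix.single k l (1 : ℂ)
      = if k = j then Matrix.single i l 1 else 0 := by
    intro i j k l
    split_ifs with h
    · rw [h, Matrix.single_mul_single_same, mul_one]
    · rw [Matrix.single_mul_single_of_ne _ _ _ _ (Ne.symm h)]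
  have hsub : ∀ (a b : Matrix (Fin N) (Fin N) ℂ) (s : ℕ), elem (a - b) s = elem a s - elem b s :=
    fun a b s => TensorProduct.tmul_sub _ _ _
  have hzero : ∀ s : ℕ, elem (0 : Matrix (Fin N) (Fin N) ℂ) s = 0 := fun s =>
    TensorProduct.tmul_zero _ _
  rw [unit, unit, lie_elem, h, h, hsub, apply_ite (elem · _), apply_ite (elem · _), hzero]
  rfl

end GlCurrent

namespace Yangian

variable {N : ℕ}

/-- The congruence for commutators of generators modulo smaller `deg'` becomes an equality between
symbols. -/
theorem grGen'_commutator (x y : YangianIndex N) : grGen' x * grGen' y - grGen' y * grGen' x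
    = (if y.i = x.j then grGen' ⟨x.i, y.j, (x.r.natPred + y.r.natPred).succPNat⟩ else 0)
      - if x.i = y.j then grGen' ⟨y.i, x.j, (x.r.natPred + y.r.natPred).succPNat⟩ else 0 := by
  set d := ((x.r : ℕ) - 1) + ((y.r : ℕ) - 1) with hd
  have hyx : gen y * gen x ∈ (filt' N).F d := by
    rw [hd, add_comm]
    exact (filt' N).mul_mem (mem_weightFiltration _ _ _) (mem_weightFiltration _ _ _)
  have hxy : gen x * gen y ∈ (filt' N).F d :=
    (filt' N).mul_mem (mem_weightFiltration _ _ _) (mem_weightFiltration _ _ _)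
  have hg : ∀ i j, gen ⟨i, j, (x.r.natPred + y.r.natPred).succPNat⟩ ∈ (filt' N).F d := fun i j =>
    mem_weightFiltration gen (fun x => (x.r : ℕ) - 1) ⟨i, j, (x.r.natPred + y.r.natPred).succPNat⟩
  have h1 : grGen' x * grGen' y = (filt' N).symb d ⟨_, hxy⟩ := AlgFiltration.symb_mul _ _ _
  have h2 : grGen' y * grGen' x = (filt' N).symb d ⟨_, hyx⟩ :=
    (AlgFiltration.symb_mul _ _ _).trans ((filt' N).symb_congr (add_comm _ _) _ _ rfl)
  -- The indices `natPred` are `r - 1` and `s - 1`, so the generator on the right has upper index `r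
  -- + s - 1` and its `deg'` is exactly `d`.
  have h3 : ∀ i j, grGen' ⟨i, j, (x.r.natPred + y.r.natPred).succPNat⟩
      = (filt' N).symb d ⟨_, hg i j⟩ := fun i j => rfl
  have h4 : ∀ (p : Prop) [Decidable p] (i j : Fin N),
      (if p then (filt' N).symb d ⟨_, hg i j⟩ else 0)
        = (filt' N).symb d (if p then ⟨_, hg i j⟩ else 0) := by
    intro p _ i j
    split_ifs
    · rfl
    · rw [map_zero]
  rw [h1, h2, h3, h3, h4, h4, ← map_sub, ← map_sub, ← sub_eq_zero, ← map_sub]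
  refine (filt' N).symb_eq_zero _ ?_
  have := gen_commutator_filt' x y
  convert this using 1
  simp only [AddSubgroupClass.coe_sub]
  congr 2 <;> split_ifs <;> rfl

/-- The linear map `E_ij z ^ (r - 1) ↦ T̃_ij^(r)`. -/
noncomputable def currentLinearMap (N : ℕ) : GlCurrent N →ₗ[ℂ] (filt' N).Gr :=
  (GlCurrent.basis N).constr ℂ grGen'

theorem currentLinearMap_unit (x : YangianIndex N) :
    currentLinearMap N (GlCurrent.unit x) = grGen' x := by
  rw [← GlCurrent.basis_apply, currentLinearMap, Module.Basis.constr_basis]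

theorem currentLinearMap_lie (x y : GlCurrent N) : currentLinearMap N ⁅x, y⁆
    = currentLinearMap N x * currentLinearMap N y - currentLinearMap N y * currentLinearMap N x := by
  have hx : x ∈ Submodule.span ℂ (Set.range (GlCurrent.basis N)) := by
    rw [Module.Basis.span_eq]
    trivial
  have hy : y ∈ Submodule.span ℂ (Set.range (GlCurrent.basis N)) := by
    rw [Module.Basis.span_eq]
    trivial
  induction hx using Submodule.span_induction with
  | zero => simp
  | add x x' _ _ hx hx' =>
    simp only [add_lie, map_add, hx, hx', add_mul, mul_add]
    abel
  | smul c x _ hx => simp only [smul_lie, map_smul, hx, smul_mul_assoc, mul_smul_comm, smul_sub]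
  | mem x hx =>
    obtain ⟨x, rfl⟩ := hx
    induction hy using Submodule.span_induction with
    | zero => simp
    | add x x' _ _ hx hx' =>
      simp only [lie_add, map_add, hx, hx', add_mul, mul_add]
      abel
    | smul c x _ hx => simp only [lie_smul, map_smul, hx, smul_mul_assoc, mul_smul_comm, smul_sub]
    | mem y hy =>
      obtain ⟨y, rfl⟩ := hy
      rw [GlCurrent.basis_apply, GlCurrent.basis_apply, currentLinearMap_unit,
        currentLinearMap_unit, grGen'_commutator, GlCurrent.lie_unit, map_sub,
        apply_ite (currentLinearMap N), apply_ite (currentLinearMap N), map_zero,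
        currentLinearMap_unit, currentLinearMap_unit]

/-- The homomorphism `E_ij z ^ (r - 1) ↦ T̃_ij^(r)` from the enveloping algebra. -/
noncomputable def envelopingHom (N : ℕ) : UniversalEnvelopingAlgebra ℂ (GlCurrent N) →ₐ[ℂ] (filt' N).Gr :=
  UniversalEnvelopingAlgebra.lift ℂ
    { currentLinearMap N with map_lie' := fun {x y} => currentLinearMap_lie x y }

theorem envelopingHom_ι (x : GlCurrent N) :
    envelopingHom N (UniversalEnvelopingAlgebra.ι ℂ x) = currentLinearMap N x :=
  UniversalEnvelopingAlgebra.lift_ι_apply ..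

theorem envelopingHom_unit (x : YangianIndex N) :
    envelopingHom N (UniversalEnvelopingAlgebra.ι ℂ (GlCurrent.unit x)) = grGen' x := by
  rw [envelopingHom_ι, currentLinearMap_unit]

theorem adjoin_unit (N : ℕ) : Algebra.adjoin ℂ (Set.range fun x : YangianIndex N =>
    UniversalEnvelopingAlgebra.ι ℂ (GlCurrent.unit x)) = ⊤ := by
  rw [eq_top_iff, ← UniversalEnvelopingAlgebra.adjoin_ι, Algebra.adjoin_le_iff]
  rintro _ ⟨x, rfl⟩
  have hx : x ∈ Submodule.span ℂ (Set.range (GlCurrent.basis N)) := by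
    rw [Module.Basis.span_eq]
    trivial
  induction hx using Submodule.span_induction with
  | zero => rw [map_zero]; exact zero_mem _
  | add x y _ _ hx hy => rw [map_add]; exact add_mem hx hy
  | smul c x _ hx => rw [map_smul]; exact Subalgebra.smul_mem _ hx c
  | mem x hx =>
    obtain ⟨x, rfl⟩ := hx
    rw [GlCurrent.basis_apply]
    exact Algebra.subset_adjoin ⟨x, rfl⟩

/-- The ordered monomials in a basis of `gl_N[z]` span the enveloping algebra, and their images are
the symbols of the ordered monomials of the Yangian, which are a basis. The Poincaré–Birkhoff–Witt
theorem for `gl_N[z]` comes out as a consequence. -/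
theorem envelopingHom_bijective (N : ℕ) : Function.Bijective (envelopingHom N) := by
  classical
  let _ : LinearOrder (YangianIndex N) := linearOrderOfSTO WellOrderingRel
  have hf : ∀ m, envelopingHom N
      (sortedMonomial (fun x => UniversalEnvelopingAlgebra.ι ℂ (GlCurrent.unit x)) m)
      = sortedSymb ℂ gen (fun x : YangianIndex N => (x.r : ℕ) - 1) m := by
    intro m
    rw [map_sortedMonomial, sortedSymb_eq]
    congr 1
    exact funext fun x => envelopingHom_unit x
  refine LinearMap.bijective_of_comp_basis (envelopingHom N).toLinearMap
    (sortedMonomial fun x => UniversalEnvelopingAlgebra.ι ℂ (GlCurrent.unit x))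
    (span_sortedMonomial_eq_top _ (fun _ => 0) (fun x y => ?_) (adjoin_unit N)) ?_ ?_
  -- With all weights zero, the linear part alone must contain the commutator, and it does because
  -- basis elements bracket to combinations of basis elements.
  · refine Submodule.mem_sup_right ?_
    rw [← LieRing.of_associative_ring_bracket, ← LieHom.map_lie, GlCurrent.lie_unit, map_sub]
    refine sub_mem ?_ ?_ <;> split_ifs
    · exact Submodule.subset_span ⟨_, le_refl 0, rfl⟩
    · rw [map_zero]
      exact zero_mem _
    · exact Submodule.subset_span ⟨_, le_refl 0, rfl⟩
    · rw [map_zero]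
      exact zero_mem _
  · have := linearIndependent_sortedSymb (k := ℂ) gen (fun x : YangianIndex N => (x.r : ℕ) - 1)
      gen_commutator_mem' linearIndependent_sortedMonomial_gen
    exact (funext hf : _ = sortedSymb ℂ gen (fun x : YangianIndex N => (x.r : ℕ) - 1)) ▸ this
  · have := span_sortedSymb (k := ℂ) gen (fun x : YangianIndex N => (x.r : ℕ) - 1) gen_commutator_mem'
    exact (funext hf : _ = sortedSymb ℂ gen (fun x : YangianIndex N => (x.r : ℕ) - 1)) ▸ this

end Yangian

end Enveloping

/-! ### Compatibility with the coalgebra structure, the antipode and the grading -/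

section Enveloping

attribute [local instance 100] LieRing.ofAssociativeRing

namespace Yangian

variable {N : ℕ}

theorem counit_grGen' (x : YangianIndex N) : Coalgebra.counit (R := ℂ) (grGen' x) = 0 := by
  rw [grGen', AlgFiltration.counit_symb]
  simp only [gen, counit_T, x.r.ne_zero, if_false, ite_self]

/-- The mixed terms `T_ik^(p+1) ⊗ T_kj^(q+1)` have total `deg'` equal to `p + q`, one less than the
degree of the generator, and the symbol map kills them. In the two end terms `T^(0)` reduces the sum
over `k` to a single summand. -/
theorem comul_grGen' (x : YangianIndex N) :
    Coalgebra.comul (R := ℂ) (grGen' x) = grGen' x ⊗ₜ 1 + 1 ⊗ₜ grGen' x := by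
  set r := x.r.natPred with hr
  have hmix : ∀ k p q, p + 1 + (q + 1) = r + 1 → T x.i k (p + 1) ⊗ₜ[ℂ] T k x.j (q + 1)
      ∈ LinearMap.ker ((filt' N).tensorSymb r) := by
    intro k p q hpq
    exact (filt' N).tensorSymb_eq_zero (show p + q < r by omega)
      ((filt' N).tmul_mem_tensorF le_rfl (T_mem_filt' x.i k (p + 1)) (T_mem_filt' k x.j (q + 1)))
  have h1 := sum_mem (t := Finset.univ) (S := LinearMap.ker ((filt' N).tensorSymb r)) fun k _ =>
    Finset.sum_antidiagonal_succ_sub_mem (LinearMap.ker ((filt' N).tensorSymb r)) r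
      (fun p => T x.i k p.1 ⊗ₜ[ℂ] T k x.j p.2) (hmix k)
  rw [Finset.sum_sub_distrib, ← comul_T, LinearMap.mem_ker, map_sub, sub_eq_zero,
    hr, ← gen_eq, ← hr] at h1
  have h2 : ∑ k, (T x.i k (r + 1) ⊗ₜ[ℂ] T k x.j 0 + T x.i k 0 ⊗ₜ[ℂ] T k x.j (r + 1))
      = gen x ⊗ₜ[ℂ] 1 + 1 ⊗ₜ[ℂ] gen x := by
    simp [Finset.sum_add_distrib, T_zero, TensorProduct.tmul_ite, TensorProduct.ite_tmul, gen_eq, hr]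
  have hx : gen x ∈ (filt' N).F r := mem_weightFiltration gen (fun x => (x.r : ℕ) - 1) x
  change (filt' N).grComul ((filt' N).symb r ⟨gen x, hx⟩) = _
  rw [AlgFiltration.grComul_symb, h1]
  simp only at h2 ⊢
  rw [h2, map_add, (filt' N).tensorSymb_tmul (add_zero r) hx (filt' N).one_mem,
    (filt' N).tensorSymb_tmul (zero_add r) (filt' N).one_mem hx]
  rfl

theorem antipode_of_primitive {A : Type*} [Ring A] [HopfAlgebra ℂ A] {p : A}
    (hc : Coalgebra.counit (R := ℂ) p = 0)
    (h : Coalgebra.comul (R := ℂ) p = p ⊗ₜ 1 + 1 ⊗ₜ p) : HopfAlgebra.antipode ℂ p = -p := by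
  have := HopfAlgebra.mul_antipode_rTensor_comul_apply (R := ℂ) p
  rw [h, hc, map_zero, map_add, map_add, LinearMap.rTensor_tmul, LinearMap.rTensor_tmul,
    LinearMap.mul'_apply, LinearMap.mul'_apply, HopfAlgebra.antipode_one, mul_one, one_mul] at this
  exact eq_neg_of_add_eq_zero_left this

/-- The isomorphism `E_ij z ^ (r - 1) ↦ T̃_ij^(r)`. -/
noncomputable def envelopingEquiv (N : ℕ) :
    UniversalEnvelopingAlgebra ℂ (GlCurrent N) ≃ₐc[ℂ] (filt' N).Gr :=
  BialgEquiv.ofAlgEquiv (AlgEquiv.ofBijective (envelopingHom N) (envelopingHom_bijective N))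
    (AlgHom.ext_of_adjoin_eq_top (adjoin_unit N) (by
      rintro _ ⟨x, rfl⟩
      change Coalgebra.counit (R := ℂ) (envelopingHom N _) = Coalgebra.counit (R := ℂ)
        (UniversalEnvelopingAlgebra.ι ℂ (GlCurrent.unit x))
      rw [envelopingHom_unit, counit_grGen', UniversalEnvelopingAlgebra.counit_ι]))
    (AlgHom.ext_of_adjoin_eq_top (adjoin_unit N) (by
      rintro _ ⟨x, rfl⟩
      change Algebra.TensorProduct.map (envelopingHom N) (envelopingHom N)
        (Coalgebra.comul (R := ℂ) (UniversalEnvelopingAlgebra.ι ℂ (GlCurrent.unit x)))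
        = Coalgebra.comul (R := ℂ) (envelopingHom N _)
      rw [envelopingHom_unit, comul_grGen', UniversalEnvelopingAlgebra.comul_ι, map_add,
        Algebra.TensorProduct.map_tmul, Algebra.TensorProduct.map_tmul, envelopingHom_unit, map_one]))

/-- Both sides reverse products, so it is enough to compare them on the generators; there both
antipodes are the negation, as on any primitive element. -/
theorem envelopingHom_antipode (u : UniversalEnvelopingAlgebra ℂ (GlCurrent N)) :
    envelopingHom N (HopfAlgebra.antipode ℂ u) = HopfAlgebra.antipode ℂ (envelopingHom N u) := by
  have hu := adjoin_unit N ▸ (Algebra.mem_top : u ∈ ⊤)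
  induction hu using Algebra.adjoin_induction with
  | mem u hu =>
    obtain ⟨x, rfl⟩ := hu
    simp only
    rw [UniversalEnvelopingAlgebra.antipode_ι, map_neg, envelopingHom_unit,
      antipode_of_primitive (counit_grGen' x) (comul_grGen' x)]
  | algebraMap c =>
    simp only [Algebra.algebraMap_eq_smul_one, map_smul, HopfAlgebra.antipode_one, map_one]
  | add u v _ _ hu hv => simp only [map_add, hu, hv]
  | mul u v _ _ hu hv =>
    simp only [HopfAlgebra.antipode_mul_antidistrib, map_mul, hu, hv]

theorem mul_mem_grComponent {a b : ℕ} {x y : (filt' N).Gr} (hx : x ∈ (filt' N).grComponent a)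
    (hy : y ∈ (filt' N).grComponent b) : x * y ∈ (filt' N).grComponent (a + b) := by
  obtain ⟨x, rfl⟩ := hx
  obtain ⟨y, rfl⟩ := hy
  exact ⟨_, (DirectSum.of_mul_of (A := (filt' N).Piece) x y).symm⟩

theorem currentLinearMap_elem_mem (X : Matrix (Fin N) (Fin N) ℂ) (s : ℕ) :
    currentLinearMap N (GlCurrent.elem X s) ∈ (filt' N).grComponent s := by
  have h : GlCurrent.elem X s
      = ∑ i, ∑ j, X i j • GlCurrent.unit (⟨i, j, s.succPNat⟩ : YangianIndex N) := by
    have h1 : ∀ i j, X i j • GlCurrent.unit (⟨i, j, s.succPNat⟩ : YangianIndex N)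
        = (((Polynomial.X : ℂ[X]) ^ s) ⊗ₜ[ℂ] Matrix.single i j (X i j) :
          ℂ[X] ⊗[ℂ] Matrix (Fin N) (Fin N) ℂ) := by
      intro i j
      have : Matrix.single i j (X i j) = X i j • Matrix.single i j (1 : ℂ) := by
        rw [Matrix.smul_single, smul_eq_mul, mul_one]
      rw [this, TensorProduct.tmul_smul]
      rfl
    simp only [h1]
    conv_lhs => rw [Matrix.matrix_eq_sum_single X]
    refine (TensorProduct.tmul_sum _ _ _).trans ?_
    exact Finset.sum_congr rfl fun i _ => TensorProduct.tmul_sum _ _ _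
  rw [h, map_sum]
  refine sum_mem fun i _ => ?_
  rw [map_sum]
  refine sum_mem fun j _ => ?_
  rw [map_smul, currentLinearMap_unit]
  exact Submodule.smul_mem _ _ ⟨_, rfl⟩

/-- One inclusion holds because degrees add under multiplication, the other because a component of
the graded algebra is spanned by words in the `T̃_ij^(r)` of exactly that weight. -/
theorem map_envComponent (N d : ℕ) :
    (GlCurrent.envComponent N d).map (envelopingHom N).toLinearMap = (filt' N).grComponent d := by
  apply le_antisymm
  · rw [GlCurrent.envComponent, Submodule.map_span, Submodule.span_le]
    rintro _ ⟨_, ⟨l, rfl, rfl⟩, rfl⟩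
    induction l with
    | nil =>
      change envelopingHom N 1 ∈ (filt' N).grComponent 0
      rw [map_one]
      exact ⟨_, rfl⟩
    | cons p l ih =>
      simp only [List.map_cons, List.prod_cons, List.sum_cons, AlgHom.toLinearMap_apply, map_mul,
        envelopingHom_ι] at ih ⊢
      exact mul_mem_grComponent (currentLinearMap_elem_mem p.1 p.2) ih
  · rintro _ ⟨x, rfl⟩
    obtain ⟨x, rfl⟩ := (filt' N).cls_surjective d x
    -- Each such word is the image of the corresponding word in the `E_ij z ^ (r - 1)`, which has
    -- the same total degree.
    refine Submodule.span_le.2 ?_ (symb_mem_span_words gen (fun x : YangianIndex N => (x.r : ℕ) - 1) d x)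
    rintro _ ⟨l, hl, rfl⟩
    refine ⟨(l.map fun x => UniversalEnvelopingAlgebra.ι ℂ (GlCurrent.unit x)).prod,
      Submodule.subset_span ⟨l.map fun x => (Matrix.single x.i x.j 1, (x.r : ℕ) - 1), ?_, ?_⟩, ?_⟩
    · rw [← hl, List.map_map]
      rfl
    · rw [List.map_map]
      rfl
    · rw [AlgHom.toLinearMap_apply, map_list_prod, List.map_map]
      congr 2
      exact funext fun x => envelopingHom_unit x

end Yangian

end Enveloping

/-! ### The theorem -/

theorem mainTheorem3 (N : ℕ) :
    (∀ (_ : LinearOrder (YangianIndex N)) (y : Yangian N),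
      ∃! c : Multiset (YangianIndex N) →₀ ℂ,
        y = c.sum fun m a => a • Yangian.orderedMonomial m) ∧
    (∃ e : UniversalEnvelopingAlgebra ℂ (GlCurrent N) ≃ₐc[ℂ] (Yangian.filt' N).Gr,
      (∀ x : YangianIndex N,
        e (UniversalEnvelopingAlgebra.ι ℂ
          (GlCurrent.elem (Matrix.single x.i x.j 1) ((x.r : ℕ) - 1))) = Yangian.grGen' x) ∧
      (∀ u, e (HopfAlgebra.antipode ℂ u) = HopfAlgebra.antipode ℂ (e u)) ∧
      ∀ d, e '' GlCurrent.envComponent N d = (Yangian.filt' N).grComponent d) ∧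
    ∃ e : MvPolynomial (YangianIndex N) ℂ ≃ₐ[ℂ] (Yangian.filt N).Gr,
      ∀ x, e (MvPolynomial.X x) = Yangian.grGen x :=
  ⟨fun _ y => Yangian.existsUnique_sum_orderedMonomial y,
    ⟨Yangian.envelopingEquiv N, Yangian.envelopingHom_unit, Yangian.envelopingHom_antipode,
      fun d => by
        rw [← Yangian.map_envComponent]
        rfl⟩,
    Yangian.exists_algEquiv_gr N⟩
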